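/- For a distribution $V$ on $\mathbb R$ write $V(x)=V((-\infty,x])$ and $\overline V(x)=V((x,\infty))$. A distribution $V$ on $[0,\infty)$ is *convolution equivalent* with index $\alpha\ge 0$ if $\overline V(x)>0$ for all $x$, $\overline V(x-y)/\overline V(x)\to e^{\alpha y}$ as $x\to\infty$ for every $y\in\mathbb R$, and $\overline{V*V}(x)/\overline V(x)$ converges to a finite limit as $x\to\infty$; a distribution $V$ on $\mathbb R$ belongs to $\mathcal S(\alpha)$ if $V(x)\mathbf 1_{\{x\ge 0\}}$ is convolution equivalent with index $\alpha$. A distribution $U$ on $\mathbb R$ is of *strongly regular variation*, $U\in\mathcal R^*_{-\alpha}$, if $V(x)=1-\overline U(e^x)/\overline U(0)$ (the conditional distribution of $\ln\xi$ given $\xi>0$, where $\xi\sim U$) belongs to $\mathcal S(\alpha)$. Let $F$ be a distribution on $\mathbb R$, $G$ a distribution on $(0,\infty)$, $\theta\in[-1,1]$, $\alpha\ge 0$. Let $(X,Y),(X_1,Y_1),(X_2,Y_2),\dots$ be i.i.d. random pairs with the Farlie–Gumbel–Morgenstern distribution $$\Pr(X\le x,\,Y\le y)=F(x)G(y)\bigl(1+\theta\,\overline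 F(x)\,\overline G(y)\bigr),\qquad x\in\mathbb R,\ y>0 ,$$ and suppose (Assumption A) that $pF+(1-p)G\in\mathcal R^*_{-\alpha}$ for every $0<p<1$. Put $S_0=0$, $S_n=\sum_{i=1}^n X_i\prod_{j=1}^i Y_j$, $M_n=\max_{0\le k\le n}S_k$. For a random variable $\xi$ let $\mathrm E\xi_+^\alpha=\mathrm E[\xi^\alpha\mathbf 1_{\{\xi>0\}}]$ (so it is $\Pr(\xi>0)$ when $\alpha=0$), $\mu_\alpha=\mathrm EY^\alpha$, and let $\check\xi$ be distributed as the maximum of two independent copies of $\xi$ and be independent of everything else. Put $$A'_n=\bigl((1-\theta)\mu_\alpha+\theta\,\mathrm E\check Y^\alpha\bigr)\sum_{i=1}^n\mu_\alpha^{i-1},$$ $$B'_n=\sum_{i=1}^n\mu_\alpha^{i-1}\Bigl((1-\theta)\mathrm E(M_{n-i}+X_{n-i+1})_+^\alpha+\theta\,\mathrm E(M_{n-i}+\check X_{n-i+1})_+^\alpha\Bigr),$$ $$C'_n=\sum_{i=1}^n\mu_\alpha^{i-1}\Bigl((1-\theta)\mathrm E(S_{n-i}+X_{n-i+1})_+^\alpha+\theta\,\mathrm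 E(S_{n-i}+\check X_{n-i+1})_+^\alpha\Bigr).$$ Below, $a(x)\sim b(x)$ means $a(x)-b(x)=o(b(x))$ as $x\to\infty$; that is, $a(x)/b(x)\to1$ where $b$ is eventually positive, while in the degenerate case $X\le 0$ a.s. both sides vanish for large $x$. All moments occurring in $A'_n,B'_n,C'_n$ are finite, and: (a) For every integer $n\ge1$, as $x\to\infty$, $$\Pr(M_n>x)\sim A'_n\overline F(x)+B'_n\overline G(x),\qquad \Pr(S_n>x)\sim A'_n\overline F(x)+C'_n\overline G(x).$$ (b) If $\mu_\alpha<1$, then $M_n$ converges a.s. to a finite random variable $M_\infty$, and $$\Pr(M_\infty>x)\sim A'_\infty\overline F(x)+B'_\infty\overline G(x),$$ where $$A'_\infty=\frac{(1-\theta)\mu_\alpha+\theta\,\mathrm E\check Y^\alpha}{1-\mu_\alpha},\qquad B'_\infty=\frac{(1-\theta)\mathrm E(M_\infty+X)_+^\alpha+\theta\,\mathrm E(M_\infty+\check X)_+^\alpha}{1-\mu_\alpha},$$ with finite moments in $B'_\infty$. (c) If $\mu_\alpha<1$ and $\mathrm E\ln(X_-\vee1)<\infty$, where $X_-=\max(-X,0)$,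 then $S_n$ converges a.s. to a finite random variable $S_\infty$, and $$\Pr(S_\infty>x)\sim A'_\infty\overline F(x)+C'_\infty\overline G(x),\qquad C'_\infty=\frac{(1-\theta)\mathrm E(S_\infty+X)_+^\alpha+\theta\,\mathrm E(S_\infty+\check X)_+^\alpha}{1-\mu_\alpha},$$ with finite moments in $C'_\infty$. -/

import Mathlib

open MeasureTheory ProbabilityTheory Filter Topology Asymptotics

noncomputable section

namespace RiskModel

/-- The tail `V̄(x) = V((x, ∞))` of a distribution on the real line. -/
def tail (V : Measure ℝ) (x : ℝ) : ℝ := V.real (Set.Ioi x)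

/-- Convolution equivalence with index `α` of a distribution on `[0, ∞)`. -/
structure IsConvEquivNonneg (α : ℝ) (V : Measure ℝ) : Prop where
  tail_pos : ∀ x : ℝ, 0 < tail V x
  tail_shift : ∀ y : ℝ,
    Tendsto (fun x : ℝ => tail V (x - y) / tail V x) atTop (𝓝 (Real.exp (α * y)))
  tail_conv : ∃ c : ℝ,
    Tendsto (fun x : ℝ => tail (Measure.conv V V) x / tail V x) atTop (𝓝 (2 * c))

/-- The class `S(α)` of distributions on the real line: `V` belongs to it iff the distribution
function `V(x) 1_{x ≥ 0}`, that is, the law of the positive part of a variable with law `V`,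
is convolution equivalent with index `α`. -/
def IsConvEquiv (α : ℝ) (V : Measure ℝ) : Prop :=
  IsConvEquivNonneg α (V.map (fun x : ℝ => max x 0))

/-- The conditional law of `log ξ` given `ξ > 0`, for `ξ` with law `U`; its distribution function
is `1 - Ū(eˣ) / Ū(0)`. -/
def logLaw (U : Measure ℝ) : Measure ℝ :=
  (ProbabilityTheory.cond U (Set.Ioi 0)).map Real.log

/-- The class `R*_{-α}` of distributions of strongly regular variation. -/
def IsStronglyRegVarying (α : ℝ) (U : Measure ℝ) : Prop :=
  IsConvEquiv α (logLaw U)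

/-- Every convex combination `p F + (1 - p) G`, `0 < p < 1`, belongs to `R*_{-α}`. -/
def ConvexCombStronglyRegVarying (α : ℝ) (F G : Measure ℝ) : Prop :=
  ∀ p : ℝ, 0 < p → p < 1 →
    IsStronglyRegVarying α (ENNReal.ofReal p • F + ENNReal.ofReal (1 - p) • G)

/-- `π` is the Farlie-Gumbel-Morgenstern distribution on `ℝ × (0, ∞)` with marginal distributions
`F` and `G` and parameter `θ`:
`π(x, y) = F(x) G(y) (1 + θ F̄(x) Ḡ(y))` for all real `x` and all `y > 0`. -/
def IsFGM (π : Measure (ℝ × ℝ)) (F G : Measure ℝ) (θ : ℝ) : Prop :=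
  ∀ x y : ℝ, 0 < y → π.real (Set.Iic x ×ˢ Set.Iic y)
    = F.real (Set.Iic x) * G.real (Set.Iic y) * (1 + θ * tail F x * tail G y)

/-- The law of `ξ₁ ∨ ξ₂` for independent `ξ₁, ξ₂` with law `V`. -/
def maxLaw (V : Measure ℝ) : Measure ℝ :=
  (V.prod V).map (fun z : ℝ × ℝ => max z.1 z.2)

/-- The moment `E ξ₊^α = E [ξ^α; ξ > 0]` of a variable `ξ` with law `V`.
For `α = 0` this is `Pr(ξ > 0)`. -/
def posMoment (α : ℝ) (V : Measure ℝ) : ℝ := ∫ z in Set.Ioi (0 : ℝ), z ^ α ∂V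

/-- Finiteness of `E ξ₊^α`. -/
def FinitePosMoment (α : ℝ) (V : Measure ℝ) : Prop :=
  IntegrableOn (fun z : ℝ => z ^ α) (Set.Ioi 0) V

variable {Ω : Type*}

/-- `S_n = ∑_{i=1}^n X_i ∏_{j=1}^i Y_j`. The sequences are indexed from `1`; the variables of
index `0` are the generic ones and do not enter here. -/
def S (X Y : ℕ → Ω → ℝ) (n : ℕ) (ω : Ω) : ℝ :=
  ∑ i ∈ Finset.Icc 1 n, X i ω * ∏ j ∈ Finset.Icc 1 i, Y j ω

/-- `M_n = max_{0 ≤ k ≤ n} S_k`. -/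
def M (X Y : ℕ → Ω → ℝ) (n : ℕ) (ω : Ω) : ℝ :=
  (Finset.range (n + 1)).sup' Finset.nonempty_range_add_one (fun k => S X Y k ω)

/-- The factor `(1 - θ) μ_α + θ E Y̌^α`. -/
def coeffY (θ α : ℝ) (G : Measure ℝ) : ℝ :=
  (1 - θ) * posMoment α G + θ * posMoment α (maxLaw G)

/-- `A'_n`. -/
def coeffA (θ α : ℝ) (G : Measure ℝ) (n : ℕ) : ℝ :=
  coeffY θ α G * ∑ i ∈ Finset.Icc 1 n, posMoment α G ^ (i - 1)

/-- `A'_∞`. -/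
def coeffAInf (θ α : ℝ) (G : Measure ℝ) : ℝ :=
  1 / (1 - posMoment α G) * coeffY θ α G

variable [MeasurableSpace Ω]

/-- The law of `Z + X̌`, where `X̌` is independent of `Z` and distributed as the maximum of two
independent variables with law `F`. -/
def lawAddCheck (P : Measure Ω) (F : Measure ℝ) (Z : Ω → ℝ) : Measure ℝ :=
  Measure.conv (P.map Z) (maxLaw F)

/-- `(1 - θ) E (Z + X)₊^α + θ E (Z + X̌)₊^α`, for variables `Z` and `X` on `Ω` and an
`X̌` independent of `Z` (see `lawAddCheck`). -/
def coeffX (P : Measure Ω) (θ α : ℝ) (F : Measure ℝ) (Z X : Ω → ℝ) : ℝ :=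
  (1 - θ) * posMoment α (P.map (fun ω => Z ω + X ω)) + θ * posMoment α (lawAddCheck P F Z)

/-- The moments `E (Z + X)₊^α` and `E (Z + X̌)₊^α` are finite. -/
def FiniteMomentsX (P : Measure Ω) (α : ℝ) (F : Measure ℝ) (Z X : Ω → ℝ) : Prop :=
  FinitePosMoment α (P.map (fun ω => Z ω + X ω)) ∧ FinitePosMoment α (lawAddCheck P F Z)

/-- `∑_{i=1}^n μ_α^{i-1} ((1 - θ) E (Z_{n-i} + X_{n-i+1})₊^α + θ E (Z_{n-i} + X̌_{n-i+1})₊^α)`.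
This is `B'_n` for `Z = M` and `C'_n` for `Z = S`. -/
def coeffBC (P : Measure Ω) (θ α : ℝ) (F G : Measure ℝ) (Z X : ℕ → Ω → ℝ) (n : ℕ) : ℝ :=
  ∑ i ∈ Finset.Icc 1 n,
    posMoment α G ^ (i - 1) * coeffX P θ α F (Z (n - i)) (X (n - i + 1))

/-- `(1 - μ_α)⁻¹ ((1 - θ) E (Z + X)₊^α + θ E (Z + X̌)₊^α)`.
This is `B'_∞` for `Z = M_∞` and `C'_∞` for `Z = S_∞`, with `X` the generic variable, which is
independent of them. -/
def coeffBCInf (P : Measure Ω) (θ α : ℝ) (F G : Measure ℝ) (Z X : Ω → ℝ) : ℝ :=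
  1 / (1 - posMoment α G) * coeffX P θ α F Z X

end RiskModel

end

/-!
The tails of `S_n` and `M_n` obey the recursion `Z ↦ Y (X + Z)`, with `(X, Y)` a pair independent
of `Z` (for `M_n`, followed by the positive part). Everything rests on what one such step does to a
tail of the form `a F̄ + b Ḡ + o(H̄)`, where `H = (F + G) / 2`.

* The Farlie-Gumbel-Morgenstern law is a mixture, with nonnegative weights, of the four products of
  the laws of minima and maxima of two independent copies of `X` and of `Y`
  (`IsFGM.eq_fgmMixture`). The tail of a minimum is `V̄² = o(H̄)` and that of a maximum is
  `2 V̄ - V̄²`, so the dependent step reduces to sums and products of independent variables.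
* `H` is of strongly regular variation. Writing `F̄` and `Ḡ` as linear combinations of the tails of
  two different mixtures of `F` and `G` shows that each satisfies `V̄(x / w) = w^α V̄(x) + o(H̄(x))`
  (`ConvexCombStronglyRegVarying.riskTails`), although neither need be regularly varying.
* Sums: the tail of an independent sum is the sum of the tails up to `o(H̄)` (`TailLE.conv`,
  `TailLE.le_conv`). Products: a product is large either because one factor is large and the other
  bounded, which contributes `E U^α` times the tail of the large factor, or because both are large.
  The latter is negligible on the logarithmic scale by Rogozin's theorem
  (`IsConvEquivNonneg.limit_le`): for a convolution equivalent `V` the limit of `tail (V * V) / V̄`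
  is twice the exponential moment, which leaves no mass for the event that both summands are large.
  This gives `TailLE.mconv` and `TailLE.le_mconv`.

Together these turn `a F̄ + b Ḡ` into
`(coeffY + μ a) F̄ + (stepCoeff + μ b) Ḡ` with `μ = E Y^α` (`TailLE.stepLaw`, `TailLE.le_stepLaw`),
and the finite horizon follows by induction. For the infinite horizon with `μ < 1`, the step
contracts uniform bounds by a multiple of `H̄` (`exists_uniform_tail_bound`), so that the limits
have tails `O(H̄)`; they are fixed points of the step, and iterating it makes a priori bounds on the
coefficients converge geometrically to the fixed coefficients (`fixedPoint_tail`). The coefficients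
are positive unless `X ≤ 0` almost surely, when both sides vanish on the positive half-line; this
is what passes from errors `o(H̄)` to asymptotic equivalence.
-/

namespace RiskModel

/-! ### Tails of finite measures and stochastic domination -/

lemma tail_nonneg (V : Measure ℝ) (x : ℝ) : 0 ≤ tail V x := measureReal_nonneg

lemma tail_antitone (V : Measure ℝ) [IsFiniteMeasure V] : Antitone (tail V) :=
  fun _ _ h => measureReal_mono (Set.Ioi_subset_Ioi h)

lemma measurable_tail (V : Measure ℝ) [IsFiniteMeasure V] : Measurable (tail V) :=
  (tail_antitone V).measurable

lemma tail_le_one (V : Measure ℝ) [IsProbabilityMeasure V] (x : ℝ) : tail V x ≤ 1 :=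
  measureReal_le_one

lemma tail_eq (V : Measure ℝ) [IsFiniteMeasure V] (x : ℝ) :
    tail V x = V.real Set.univ - V.real (Set.Iic x) := by
  rw [tail, ← measureReal_compl measurableSet_Iic, Set.compl_Iic]

lemma tendsto_tail_atTop (V : Measure ℝ) [IsFiniteMeasure V] :
    Tendsto (tail V) atTop (𝓝 0) := by
  have h : Tendsto (fun x : ℝ => V.real (Set.Iic x)) atTop (𝓝 (V.real Set.univ)) :=
    (ENNReal.tendsto_toReal (measure_ne_top V _)).comp (tendsto_measure_Iic_atTop V)
  have := (tendsto_const_nhds (x := V.real Set.univ)).sub h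
  rw [sub_self] at this
  exact this.congr fun x => (tail_eq V x).symm

lemma tendsto_tail_atBot (V : Measure ℝ) [IsFiniteMeasure V] :
    Tendsto (tail V) atBot (𝓝 (V.real Set.univ)) := by
  have h : Tendsto (fun x : ℝ => V.real (Set.Ici (x + 1))) atBot (𝓝 (V.real Set.univ)) :=
    ((ENNReal.tendsto_toReal (measure_ne_top V _)).comp (tendsto_measure_Ici_atBot V)).comp
      (tendsto_atBot_add_const_right _ 1 tendsto_id)
  refine tendsto_of_tendsto_of_tendsto_of_le_of_le h tendsto_const_nhds (fun x => ?_) fun x => ?_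
  · exact measureReal_mono fun y hy => lt_of_lt_of_le (lt_add_one x) hy
  · exact measureReal_mono (Set.subset_univ _)

lemma measureReal_prod_eq_integral {α β : Type*} [MeasurableSpace α] [MeasurableSpace β]
    (μ : Measure α) (ν : Measure β) [IsFiniteMeasure μ] [IsFiniteMeasure ν] {s : Set (α × β)}
    (hs : MeasurableSet s) :
    (μ.prod ν).real s = ∫ x, ν.real (Prod.mk x ⁻¹' s) ∂μ := by
  rw [Measure.real, Measure.prod_apply hs, ← integral_toReal]
  · rfl
  · exact (measurable_measure_prodMk_left hs).aemeasurable
  · exact ae_of_all _ fun x => measure_lt_top _ _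

lemma measureReal_prod_swap_eq_integral {α β : Type*} [MeasurableSpace α] [MeasurableSpace β]
    (μ : Measure α) (ν : Measure β) [IsFiniteMeasure μ] [IsFiniteMeasure ν] {s : Set (α × β)}
    (hs : MeasurableSet s) :
    (μ.prod ν).real s = ∫ y, μ.real ((fun x => (x, y)) ⁻¹' s) ∂ν := by
  rw [Measure.real, Measure.prod_apply_symm hs, ← integral_toReal]
  · rfl
  · exact (measurable_measure_prodMk_right hs).aemeasurable
  · exact ae_of_all _ fun x => measure_lt_top _ _

/-- Stochastic domination: comparing tails on the positive half-line compares the integrals of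
continuous nondecreasing functions that vanish on the negative half-line. -/
lemma lintegral_le_of_tail_le {μ ν : Measure ℝ}
    (h : ∀ x, 0 ≤ x → μ (Set.Ioi x) ≤ ν (Set.Ioi x)) {ψ : ℝ → ℝ} (hm : Monotone ψ)
    (hc : Continuous ψ) (h0 : ∀ x ≤ 0, ψ x = 0) :
    ∫⁻ x, ENNReal.ofReal (ψ x) ∂μ ≤ ∫⁻ x, ENNReal.ofReal (ψ x) ∂ν := by
  have hn : ∀ x, 0 ≤ ψ x := fun x => by
    rcases le_total x 0 with hx | hx
    · rw [h0 x hx]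
    · rw [← h0 0 le_rfl]; exact hm hx
  rw [lintegral_eq_lintegral_meas_lt μ (ae_of_all _ hn) hc.aemeasurable,
    lintegral_eq_lintegral_meas_lt ν (ae_of_all _ hn) hc.aemeasurable]
  refine setLIntegral_mono' measurableSet_Ioi fun t ht => ?_
  have ht : 0 < t := ht
  rcases Set.eq_empty_or_nonempty {a | t < ψ a} with he | hne
  · simp [he]
  have hpos : ∀ a ∈ {a | t < ψ a}, 0 < a := fun a ha => by
    by_contra hcon
    have ha : t < ψ a := ha
    rw [h0 a (not_lt.mp hcon)] at ha
    linarith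
  have hbdd : BddBelow {a | t < ψ a} := ⟨0, fun a ha => (hpos a ha).le⟩
  have hs : {a | t < ψ a} = Set.Ioi (sInf {a | t < ψ a}) := by
    ext x
    constructor
    · intro hx
      refine lt_of_le_of_ne (csInf_le hbdd hx) fun heq => ?_
      have hopen : {a | t < ψ a} ∈ 𝓝 x := (isOpen_lt continuous_const hc).mem_nhds hx
      obtain ⟨y, hy, hys⟩ := exists_Ioc_subset_of_mem_nhds hopen ⟨x - 1, by linarith⟩
      have hmem : (y + x) / 2 ∈ {a | t < ψ a} := hys ⟨by linarith, by linarith⟩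
      have := csInf_le hbdd hmem
      linarith
    · intro hx
      obtain ⟨y, hy, hyx⟩ := exists_lt_of_csInf_lt hne hx
      exact lt_of_lt_of_le hy (hm hyx.le)
  rw [hs]
  exact h _ (le_csInf hne fun a ha => (hpos a ha).le)

/-! ### Convolution equivalent distributions -/

section ConvEquiv

variable {α : ℝ} {V : Measure ℝ}

/-- The sum of two independent variables is large because one of them is and the other is at most
`a`, or because both exceed `a`. -/
lemma tail_conv_eq (V : Measure ℝ) [IsFiniteMeasure V] {a t : ℝ} (ht : 2 * a ≤ t) :
    tail (Measure.conv V V) t = 2 * ∫ u in Set.Iic a, tail V (t - u) ∂V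
      + (V.prod V).real {p | a < p.1 ∧ a < p.2 ∧ t < p.1 + p.2} := by
  have m0 : MeasurableSet {p : ℝ × ℝ | t < p.1 + p.2} :=
    measurableSet_lt measurable_const (measurable_fst.add measurable_snd)
  have m1 : MeasurableSet {p : ℝ × ℝ | p.1 ≤ a ∧ t < p.1 + p.2} :=
    (measurableSet_le measurable_fst measurable_const).inter m0
  have m2 : MeasurableSet {p : ℝ × ℝ | p.2 ≤ a ∧ t < p.1 + p.2} :=
    (measurableSet_le measurable_snd measurable_const).inter m0
  have m3 : MeasurableSet {p : ℝ × ℝ | a < p.1 ∧ a < p.2 ∧ t < p.1 + p.2} :=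
    (measurableSet_lt measurable_const measurable_fst).inter
      ((measurableSet_lt measurable_const measurable_snd).inter m0)
  have hpre : tail (Measure.conv V V) t = (V.prod V).real {p | t < p.1 + p.2} := by
    rw [tail, Measure.conv, map_measureReal_apply (by fun_prop)
      measurableSet_Ioi]
    rfl
  have hun : {p : ℝ × ℝ | t < p.1 + p.2} = ({p | p.1 ≤ a ∧ t < p.1 + p.2} ∪
      {p | p.2 ≤ a ∧ t < p.1 + p.2}) ∪ {p | a < p.1 ∧ a < p.2 ∧ t < p.1 + p.2} := by
    ext p
    simp only [Set.mem_ofPred_eq, Set.mem_union]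
    rcases le_or_gt p.1 a with h1 | h1 <;> rcases le_or_gt p.2 a with h2 | h2 <;>
      simp [h1, h2, not_le.mpr, not_lt.mpr]
  have hd1 : Disjoint {p : ℝ × ℝ | p.1 ≤ a ∧ t < p.1 + p.2} {p | p.2 ≤ a ∧ t < p.1 + p.2} := by
    rw [Set.disjoint_left]
    rintro p ⟨h1, h2⟩ ⟨h3, -⟩
    linarith
  have hd2 : Disjoint ({p : ℝ × ℝ | p.1 ≤ a ∧ t < p.1 + p.2} ∪ {p | p.2 ≤ a ∧ t < p.1 + p.2})
      {p | a < p.1 ∧ a < p.2 ∧ t < p.1 + p.2} := by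
    rw [Set.disjoint_left]
    rintro p (⟨h1, h2⟩ | ⟨h1, h2⟩) ⟨h3, h4, -⟩ <;> linarith
  have hi : ∀ u, V.real {y : ℝ | u ≤ a ∧ t < u + y} =
      (Set.Iic a).indicator (fun u => tail V (t - u)) u := by
    intro u
    by_cases hu : u ≤ a
    · rw [Set.indicator_of_mem (show u ∈ Set.Iic a from hu)]
      simp only [hu, true_and, tail]
      congr 1
      ext y
      simp only [Set.mem_ofPred_eq, Set.mem_Ioi]
      constructor <;> intro <;> linarith
    · rw [Set.indicator_of_notMem (show u ∉ Set.Iic a from hu)]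
      simp [hu]
  have e1 : (V.prod V).real {p | p.1 ≤ a ∧ t < p.1 + p.2} =
      ∫ u in Set.Iic a, tail V (t - u) ∂V := by
    rw [measureReal_prod_eq_integral V V m1, ← integral_indicator measurableSet_Iic]
    exact integral_congr_ae (ae_of_all _ fun u => hi u)
  have e2 : (V.prod V).real {p | p.2 ≤ a ∧ t < p.1 + p.2} =
      ∫ u in Set.Iic a, tail V (t - u) ∂V := by
    rw [measureReal_prod_swap_eq_integral V V m2, ← integral_indicator measurableSet_Iic]
    refine integral_congr_ae (ae_of_all _ fun u => ?_)
    simp only [Set.preimage_ofPred_eq, add_comm _ u]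
    exact hi u
  rw [hpre, hun, measureReal_union hd2 m3, measureReal_union hd1 m2, e1, e2]
  ring

/-- Conditioning on the summand that stays bounded. -/
lemma IsConvEquivNonneg.tendsto_truncated [IsProbabilityMeasure V]
    (h : IsConvEquivNonneg α V) (a : ℝ) :
    Tendsto (fun t => (∫ u in Set.Iic a, tail V (t - u) ∂V) / tail V t) atTop
      (𝓝 (∫ u in Set.Iic a, Real.exp (α * u) ∂V)) := by
  have hb := (h.tail_shift a).eventually (gt_mem_nhds (lt_add_one _))
  simp_rw [← integral_div]
  refine tendsto_integral_filter_of_dominated_convergence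
    (fun _ => Real.exp (α * a) + 1) (Eventually.of_forall fun t => ?_) ?_
    (integrable_const _) (ae_of_all _ fun u => h.tail_shift u)
  · exact (((measurable_tail V).comp (measurable_const.sub measurable_id)).div_const
      _).aestronglyMeasurable
  · filter_upwards [hb] with t ht
    rw [ae_restrict_iff' measurableSet_Iic]
    refine ae_of_all _ fun u hu => ?_
    have hp := h.tail_pos t
    rw [Real.norm_of_nonneg (div_nonneg (tail_nonneg _ _) hp.le)]
    refine le_trans ?_ ht.le
    gcongr
    exact tail_antitone V (sub_le_sub_left hu t)

lemma integrableOn_exp_Iic [IsFiniteMeasure V] (hα : 0 ≤ α) (a : ℝ) :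
    IntegrableOn (fun u => Real.exp (α * u)) (Set.Iic a) V := by
  refine Integrable.mono' (integrable_const (Real.exp (α * a))) (by fun_prop) ?_
  rw [ae_restrict_iff' measurableSet_Iic]
  refine ae_of_all _ fun u hu => ?_
  rw [Real.norm_of_nonneg (Real.exp_pos _).le]
  exact Real.exp_le_exp.mpr (mul_le_mul_of_nonneg_left hu hα)

lemma tendsto_both_large [IsProbabilityMeasure V]
    (h : IsConvEquivNonneg α V) {c : ℝ}
    (hc : Tendsto (fun x => tail (Measure.conv V V) x / tail V x) atTop (𝓝 (2 * c))) (a : ℝ) :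
    Tendsto (fun t => (V.prod V).real {p | a < p.1 ∧ a < p.2 ∧ t < p.1 + p.2} / tail V t) atTop
      (𝓝 (2 * c - 2 * ∫ u in Set.Iic a, Real.exp (α * u) ∂V)) := by
  refine (hc.sub ((h.tendsto_truncated a).const_mul 2)).congr' ?_
  filter_upwards [eventually_ge_atTop (2 * a)] with t ht
  rw [tail_conv_eq V ht]
  ring

lemma integral_exp_Iic_le [IsProbabilityMeasure V]
    (h : IsConvEquivNonneg α V) {c : ℝ}
    (hc : Tendsto (fun x => tail (Measure.conv V V) x / tail V x) atTop (𝓝 (2 * c))) (a : ℝ) :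
    ∫ u in Set.Iic a, Real.exp (α * u) ∂V ≤ c := by
  have := ge_of_tendsto' (tendsto_both_large h hc a) fun t =>
    div_nonneg measureReal_nonneg (tail_nonneg _ _)
  linarith

lemma IsConvEquivNonneg.integrable_exp [IsProbabilityMeasure V] (hα : 0 ≤ α)
    (h : IsConvEquivNonneg α V) : Integrable (fun u => Real.exp (α * u)) V := by
  obtain ⟨c, hc⟩ := h.tail_conv
  have hcov := aecover_Iic (μ := V) (tendsto_id (x := (atTop : Filter ℝ)))
  exact hcov.integrable_of_integral_bounded_of_nonneg_ae c
    (fun a => integrableOn_exp_Iic hα a) (ae_of_all _ fun _ => (Real.exp_pos _).le)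
    (Eventually.of_forall fun a => integral_exp_Iic_le h hc a)

/-- Convolution equivalent distributions have no exponential moment beyond `α`: the tail decays
more slowly than `exp (-(α + s) x)`. -/
lemma IsConvEquivNonneg.tendsto_exp_mul_tail (h : IsConvEquivNonneg α V) {s : ℝ} (hs : 0 < s) :
    Tendsto (fun n : ℕ => Real.exp ((α + s) * n) * tail V n) atTop atTop := by
  have h1 := h.tail_shift (-1)
  have hlt : Real.exp (-(α + s / 2)) < Real.exp (α * -1) := Real.exp_lt_exp.mpr (by linarith)
  obtain ⟨x₀, hx₀⟩ := eventually_atTop.mp (h1.eventually (lt_mem_nhds hlt))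
  obtain ⟨N, hN⟩ := exists_nat_ge x₀
  have key : ∀ k : ℕ, Real.exp (s / 2) ^ k * (Real.exp ((α + s) * N) * tail V N) ≤
      Real.exp ((α + s) * (k + N : ℕ)) * tail V (k + N : ℕ) := by
    intro k
    induction k with
    | zero => simp
    | succ k ih =>
      have hk := hx₀ ((k + N : ℕ) : ℝ)
        (hN.trans (by push_cast; linarith [Nat.cast_nonneg (α := ℝ) k]))
      rw [lt_div_iff₀ (h.tail_pos _)] at hk
      have e1 : ((k + 1 + N : ℕ) : ℝ) = ((k + N : ℕ) : ℝ) - -1 := by push_cast; ring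
      have e2 : Real.exp ((α + s) * (k + 1 + N : ℕ)) =
          Real.exp ((α + s) * (k + N : ℕ)) * Real.exp (α + s) := by
        rw [← Real.exp_add]; congr 1; push_cast; ring
      have e3 : Real.exp (α + s) * Real.exp (-(α + s / 2)) = Real.exp (s / 2) := by
        rw [← Real.exp_add]; congr 1; ring
      calc Real.exp (s / 2) ^ (k + 1) * (Real.exp ((α + s) * N) * tail V N)
          = Real.exp (s / 2) * (Real.exp (s / 2) ^ k * (Real.exp ((α + s) * N) * tail V N)) := by
            ring
        _ ≤ Real.exp (s / 2) * (Real.exp ((α + s) * (k + N : ℕ)) * tail V (k + N : ℕ)) := by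
            gcongr
        _ = Real.exp ((α + s) * (k + N : ℕ)) * Real.exp (α + s) *
            (Real.exp (-(α + s / 2)) * tail V (k + N : ℕ)) := by rw [← e3]; ring
        _ ≤ Real.exp ((α + s) * (k + N : ℕ)) * Real.exp (α + s) *
            tail V ((k + N : ℕ) - -1) := by gcongr
        _ = _ := by rw [e2, e1]
  rw [← tendsto_add_atTop_iff_nat N]
  refine tendsto_atTop_mono key (Tendsto.atTop_mul_const ?_ ?_)
  · exact mul_pos (Real.exp_pos _) (h.tail_pos _)
  · exact tendsto_pow_atTop_atTop_of_one_lt (Real.one_lt_exp_iff.mpr (by linarith))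

/-- The test function `exp (α x) exp (s (x ∧ k))`. -/
noncomputable def expTest (α s : ℝ) (k : ℕ) (x : ℝ) : ℝ := Real.exp (α * x + s * min x k)

lemma continuous_expTest (α s : ℝ) (k : ℕ) : Continuous (expTest α s k) := by
  unfold expTest
  fun_prop

lemma expTest_le (α : ℝ) {s : ℝ} (hs : 0 ≤ s) (k : ℕ) (x : ℝ) :
    expTest α s k x ≤ Real.exp (s * k) * Real.exp (α * x) := by
  rw [← Real.exp_add, expTest, Real.exp_le_exp]
  nlinarith [mul_le_mul_of_nonneg_left (min_le_right x (k : ℝ)) hs]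

lemma integrable_expTest {W : Measure ℝ} (hW : Integrable (fun u => Real.exp (α * u)) W) {s : ℝ}
    (hs : 0 ≤ s) (k : ℕ) : Integrable (expTest α s k) W := by
  refine (hW.const_mul (Real.exp (s * k))).mono' (continuous_expTest α s k).aestronglyMeasurable
    (ae_of_all _ fun x => ?_)
  rw [Real.norm_of_nonneg (show 0 ≤ expTest α s k x from (Real.exp_pos _).le)]
  exact expTest_le α hs k x

lemma expTest_add_le (α : ℝ) {s : ℝ} (hs : 0 ≤ s) (k : ℕ) {x y : ℝ} (hx : 0 ≤ x) (hy : 0 ≤ y) :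
    expTest α s k (x + y) ≤ expTest α s k x * expTest α s k y := by
  rw [expTest, expTest, expTest, ← Real.exp_add, Real.exp_le_exp]
  have : min (x + y) (k : ℝ) ≤ min x k + min y k := by
    have hk : (0 : ℝ) ≤ k := Nat.cast_nonneg k
    rcases le_total x k with h1 | h1 <;> rcases le_total y k with h2 | h2 <;>
      simp only [h1, h2, min_eq_left, min_eq_right] <;>
      first
        | exact min_le_left _ _
        | exact (min_le_right _ _).trans (by linarith)
  nlinarith [mul_le_mul_of_nonneg_left this hs]

/-- Rogozin's theorem: the limit of `tail (V * V) / tail V` is twice the exponential moment.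
If `c` exceeded the moment `m`, then the submultiplicative function `expTest α s k`, of integral
`u`, would give `(2 c - ε) (u - m) ≤ u² - m² + o(1)` as `s → 0`. Since `u` grows in `k` to infinity
by factors at most `exp s`, it can be placed just above `m`, which is absurd. -/
theorem IsConvEquivNonneg.limit_le [IsProbabilityMeasure V] (hα : 0 ≤ α)
    (h : IsConvEquivNonneg α V) (hV : V (Set.Iio 0) = 0) {c : ℝ}
    (hc : Tendsto (fun x => tail (Measure.conv V V) x / tail V x) atTop (𝓝 (2 * c))) :
    c ≤ ∫ u, Real.exp (α * u) ∂V := by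
  set m := ∫ u, Real.exp (α * u) ∂V with hm
  by_contra! hlt
  have hint := h.integrable_exp hα
  have hae : ∀ᵐ x ∂V, 0 ≤ x := by
    rw [ae_iff]
    exact measure_mono_null (fun x hx => not_le.mp hx) hV
  have hm0 : 0 ≤ m := integral_nonneg fun _ => (Real.exp_pos _).le
  set ε := (c - m) / 2 with hε
  have hεp : 0 < ε := by rw [hε]; linarith
  obtain ⟨x₀', hx₀'⟩ := eventually_atTop.mp
    (hc.eventually (lt_mem_nhds (show 2 * c - ε < 2 * c by linarith)))
  set x₀ := max x₀' 0 with hx₀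
  have hT : ∀ x, x₀ ≤ x → (2 * c - ε) * tail V x ≤ tail (Measure.conv V V) x := fun x hx => by
    have := hx₀' x ((le_max_left _ _).trans hx)
    rw [lt_div_iff₀ (h.tail_pos x)] at this
    exact this.le
  have hx₀0 : 0 ≤ x₀ := le_max_right _ _
  -- the integral inequality for the test function with parameters `s` and `k`
  have main : ∀ s : ℝ, 0 < s → ∀ k : ℕ,
      (2 * c - ε) * ((∫ x, expTest α s k x ∂V) - m) ≤ (∫ x, expTest α s k x ∂V) ^ 2 - m ^ 2
        + 2 * c * (Real.exp (α * x₀) * (Real.exp (s * x₀) - 1)) := by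
    intro s hs k
    set u := ∫ x, expTest α s k x ∂V with hu
    have hiu := integrable_expTest hint hs.le k
    set ψ : ℝ → ℝ := fun x =>
      Real.exp (α * max x 0) * (Real.exp (s * min (max x 0) k) - 1) with hψ
    have hk0 : (0 : ℝ) ≤ k := Nat.cast_nonneg k
    have hψ0 : ∀ x ≤ 0, ψ x = 0 := fun x hx => by
      simp [hψ, max_eq_right hx, hk0]
    have hfac : ∀ x : ℝ, 0 ≤ Real.exp (s * min (max x 0) k) - 1 := fun x => by
      have : 0 ≤ s * min (max x 0) (k : ℝ) := mul_nonneg hs.le (le_min (le_max_right _ _) hk0)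
      linarith [Real.one_le_exp this]
    have hψn : ∀ x, 0 ≤ ψ x := fun x => mul_nonneg (Real.exp_pos _).le (hfac x)
    have hψm : Monotone ψ := by
      intro x y hxy
      simp only [hψ]
      have h1 : max x 0 ≤ max y 0 := max_le_max_right _ hxy
      have h2 : min (max x 0) (k : ℝ) ≤ min (max y 0) k := min_le_min_right _ h1
      refine mul_le_mul ?_ ?_ (hfac x) (Real.exp_pos _).le
      · exact Real.exp_le_exp.mpr (mul_le_mul_of_nonneg_left h1 hα)
      · have := Real.exp_le_exp.mpr (mul_le_mul_of_nonneg_left h2 hs.le)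
        linarith
    have hψc : Continuous ψ := by
      simp only [hψ]; fun_prop
    have hψeq : ∀ x, 0 ≤ x → ψ x = expTest α s k x - Real.exp (α * x) := fun x hx => by
      simp only [hψ, expTest, max_eq_left hx, Real.exp_add]; ring
    have hψV : ∫ x, ψ x ∂V = u - m := by
      rw [hu, hm, ← integral_sub hiu hint]
      refine integral_congr_ae ?_
      filter_upwards [hae] with x hx using hψeq x hx
    have hψVi : Integrable ψ V := by
      refine (hiu.sub hint).congr ?_
      filter_upwards [hae] with x hx using (hψeq x hx).symm
    have hprod1 : Integrable (fun p : ℝ × ℝ => expTest α s k p.1 * expTest α s k p.2)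
      (V.prod V) := hiu.mul_prod hiu
    have hprod2 : Integrable (fun p : ℝ × ℝ => Real.exp (α * p.1) * Real.exp (α * p.2))
      (V.prod V) := hint.mul_prod hint
    have hae2 : ∀ᵐ p ∂(V.prod V), 0 ≤ p.1 ∧ 0 ≤ p.2 :=
      (Measure.quasiMeasurePreserving_fst.ae hae).and (Measure.quasiMeasurePreserving_snd.ae hae)
    have hle2 : ∀ᵐ p ∂(V.prod V), ψ (p.1 + p.2) ≤ expTest α s k p.1 * expTest α s k p.2 -
        Real.exp (α * p.1) * Real.exp (α * p.2) := by
      filter_upwards [hae2] with p hp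
      rw [hψeq _ (add_nonneg hp.1 hp.2), ← Real.exp_add, ← mul_add]
      linarith [expTest_add_le α hs.le k hp.1 hp.2]
    have hψ2i : Integrable (fun p : ℝ × ℝ => ψ (p.1 + p.2)) (V.prod V) := by
      refine (hprod1.sub hprod2).mono' (by fun_prop) ?_
      filter_upwards [hle2] with p hp
      rwa [Real.norm_of_nonneg (hψn _)]
    have hψ2 : ∫ p : ℝ × ℝ, ψ (p.1 + p.2) ∂(V.prod V) ≤ u ^ 2 - m ^ 2 := by
      refine (integral_mono_ae hψ2i (hprod1.sub hprod2) hle2).trans (le_of_eq ?_)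
      have e1 := integral_prod_mul (μ := V) (ν := V) (expTest α s k) (expTest α s k)
      have e2 := integral_prod_mul (μ := V) (ν := V) (fun x => Real.exp (α * x))
        (fun x => Real.exp (α * x))
      simp only [Pi.sub_apply]
      rw [integral_sub hprod1 hprod2, e1, e2, ← hu, ← hm]
      ring
    -- stochastic domination of `(2 c - ε) V` by `V * V + 2 c δ_{x₀}`
    have hc0 : 0 ≤ 2 * c := by linarith
    have hcε : 0 ≤ 2 * c - ε := by rw [hε]; linarith
    have hdom := lintegral_le_of_tail_le (μ := ENNReal.ofReal (2 * c - ε) • V)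
      (ν := Measure.conv V V + ENNReal.ofReal (2 * c) • Measure.dirac x₀) (fun x _ => by
        have hVx : V (Set.Ioi x) = ENNReal.ofReal (tail V x) := by
          rw [tail, ofReal_measureReal]
        rw [Measure.smul_apply, Measure.add_apply, Measure.smul_apply, smul_eq_mul, smul_eq_mul,
          Measure.dirac_apply' _ measurableSet_Ioi, hVx, ← ENNReal.ofReal_mul hcε]
        rcases lt_or_ge x x₀ with hx | hx
        · rw [Set.indicator_of_mem (show x₀ ∈ Set.Ioi x from hx)]
          simp only [Pi.one_apply, mul_one]
          refine le_add_left (ENNReal.ofReal_le_ofReal ?_)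
          nlinarith [tail_le_one V x, tail_nonneg V x]
        · refine le_add_right ?_
          have : (Measure.conv V V) (Set.Ioi x) = ENNReal.ofReal (tail (Measure.conv V V) x) := by
            rw [tail, ofReal_measureReal]
          rw [this]
          exact ENNReal.ofReal_le_ofReal (hT x hx)) hψm hψc hψ0
    rw [lintegral_smul_measure, lintegral_add_measure, lintegral_smul_measure, lintegral_dirac,
      Measure.conv, lintegral_map (by fun_prop) (by fun_prop), smul_eq_mul, smul_eq_mul,
      ← ofReal_integral_eq_lintegral_ofReal hψVi (ae_of_all _ hψn),
      ← ofReal_integral_eq_lintegral_ofReal hψ2i (ae_of_all _ fun _ => hψn _),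
      ← ENNReal.ofReal_mul hcε, ← ENNReal.ofReal_mul hc0,
      ← ENNReal.ofReal_add (integral_nonneg fun _ => hψn _) (mul_nonneg hc0 (hψn _)),
      ENNReal.ofReal_le_ofReal_iff (add_nonneg (integral_nonneg fun _ => hψn _)
        (mul_nonneg hc0 (hψn _))), hψV] at hdom
    have hψx₀ : ψ x₀ ≤ Real.exp (α * x₀) * (Real.exp (s * x₀) - 1) := by
      simp only [hψ, max_eq_left hx₀0]
      refine mul_le_mul_of_nonneg_left ?_ (Real.exp_pos _).le
      have := Real.exp_le_exp.mpr (mul_le_mul_of_nonneg_left (min_le_left x₀ (k : ℝ)) hs.le)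
      linarith
    nlinarith [mul_le_mul_of_nonneg_left hψx₀ hc0]
  -- place the integral between `v` and `exp s * v`
  set v := m + ε with hv
  have place : ∀ s : ℝ, 0 < s → ∃ k : ℕ, v < (∫ x, expTest α s k x ∂V) ∧
      (∫ x, expTest α s k x ∂V) ≤ Real.exp s * v := by
    intro s hs
    have hex : ∃ k : ℕ, v < ∫ x, expTest α s k x ∂V := by
      obtain ⟨k, hk⟩ := ((h.tendsto_exp_mul_tail hs).eventually_gt_atTop v).exists
      refine ⟨k, hk.trans_le ?_⟩
      have hsub : Real.exp ((α + s) * k) * tail V k =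
          ∫ _ in Set.Ioi (k : ℝ), Real.exp ((α + s) * k) ∂V := by
        rw [setIntegral_const, tail, smul_eq_mul, mul_comm]
      rw [hsub]
      have hiu := integrable_expTest hint hs.le k
      refine le_trans (setIntegral_mono_on (integrable_const _).integrableOn hiu.integrableOn
        measurableSet_Ioi fun x hx => ?_)
        (setIntegral_le_integral hiu (ae_of_all _ fun _ => (Real.exp_pos _).le))
      have hx : (k : ℝ) < x := hx
      rw [expTest, min_eq_right hx.le, Real.exp_le_exp]
      nlinarith [mul_le_mul_of_nonneg_left hx.le hα]
    classical
    refine ⟨Nat.find hex, Nat.find_spec hex, ?_⟩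
    have hpos : Nat.find hex ≠ 0 := by
      intro h0
      have := Nat.find_spec hex
      rw [h0] at this
      have hle : ∫ x, expTest α s 0 x ∂V ≤ m := by
        refine integral_mono (integrable_expTest hint hs.le 0) hint fun x => ?_
        simpa using expTest_le α hs.le 0 x
      linarith
    obtain ⟨j, hj⟩ := Nat.exists_eq_succ_of_ne_zero hpos
    have hjv : ∫ x, expTest α s j x ∂V ≤ v :=
      not_lt.mp (Nat.find_min hex (hj ▸ Nat.lt_succ_self j))
    rw [hj]
    calc ∫ x, expTest α s (j + 1) x ∂V ≤ ∫ x, Real.exp s * expTest α s j x ∂V := by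
          refine integral_mono (integrable_expTest hint hs.le _)
            ((integrable_expTest hint hs.le j).const_mul _) fun x => ?_
          simp only [expTest]
          rw [← Real.exp_add, Real.exp_le_exp]
          have : min x ((j + 1 : ℕ) : ℝ) ≤ min x j + 1 := by
            rw [← min_add_add_right]
            exact min_le_min (by linarith) (by push_cast; exact le_rfl)
          nlinarith [mul_le_mul_of_nonneg_left this hs.le]
      _ = Real.exp s * ∫ x, expTest α s j x ∂V := integral_const_mul _ _
      _ ≤ Real.exp s * v := by gcongr
  -- let `s → 0`
  have hlim1 : Tendsto (fun s : ℝ => ε * (2 * c - ε - Real.exp s * v - m)) (𝓝[>] 0)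
      (𝓝 (ε * (2 * c - ε - Real.exp 0 * v - m))) :=
    (Continuous.tendsto (by fun_prop) 0).mono_left nhdsWithin_le_nhds
  have hlim2 : Tendsto (fun s : ℝ => 2 * c * (Real.exp (α * x₀) * (Real.exp (s * x₀) - 1)))
      (𝓝[>] 0) (𝓝 (2 * c * (Real.exp (α * x₀) * (Real.exp (0 * x₀) - 1)))) :=
    (Continuous.tendsto (by fun_prop) 0).mono_left nhdsWithin_le_nhds
  have hle : ε * (2 * c - ε - Real.exp 0 * v - m) ≤
      2 * c * (Real.exp (α * x₀) * (Real.exp (0 * x₀) - 1)) := by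
    have hsmall : ∀ᶠ s in 𝓝[>] (0 : ℝ), 0 < 2 * c - ε - Real.exp s * v - m := by
      have : Tendsto (fun s : ℝ => 2 * c - ε - Real.exp s * v - m) (𝓝[>] 0)
          (𝓝 (2 * c - ε - Real.exp 0 * v - m)) :=
        (Continuous.tendsto (by fun_prop) 0).mono_left nhdsWithin_le_nhds
      refine this.eventually (lt_mem_nhds ?_)
      rw [Real.exp_zero, hv, hε]
      linarith
    refine le_of_tendsto_of_tendsto hlim1 hlim2 ?_
    filter_upwards [self_mem_nhdsWithin, hsmall] with s hs hsm
    obtain ⟨k, hk1, hk2⟩ := place s hs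
    have := main s hs k
    set u := ∫ x, expTest α s k x ∂V
    have h1 : ε ≤ u - m := by linarith
    have h2 : 2 * c - ε - Real.exp s * v - m ≤ 2 * c - ε - u - m := by linarith
    calc ε * (2 * c - ε - Real.exp s * v - m) ≤ (u - m) * (2 * c - ε - u - m) :=
          mul_le_mul h1 h2 hsm.le (by linarith)
      _ ≤ _ := by linarith
  rw [Real.exp_zero, zero_mul, Real.exp_zero, sub_self, mul_zero, mul_zero, one_mul, hv] at hle
  have : 0 < ε * (2 * c - ε - (m + ε) - m) := mul_pos hεp (by rw [hε]; linarith)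
  linarith

/-- Two independent convolution equivalent summands are rarely both large when their sum is. -/
theorem IsConvEquivNonneg.both_large [IsProbabilityMeasure V] (hα : 0 ≤ α)
    (h : IsConvEquivNonneg α V) (hV : V (Set.Iio 0) = 0) {ε : ℝ} (hε : 0 < ε) :
    ∃ a, 0 ≤ a ∧ ∀ᶠ t in atTop,
      (V.prod V).real {p | a < p.1 ∧ a < p.2 ∧ t < p.1 + p.2} ≤ ε * tail V t := by
  obtain ⟨c, hc⟩ := h.tail_conv
  have hcov := aecover_Iic (μ := V) (tendsto_id (x := (atTop : Filter ℝ)))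
  have hlim := hcov.integral_tendsto_of_countably_generated (h.integrable_exp hα)
  have hcm := h.limit_le hα hV hc
  obtain ⟨a, ha, ha0⟩ := ((hlim.eventually (lt_mem_nhds
    (show (∫ u, Real.exp (α * u) ∂V) - ε / 2 < _ by linarith))).and (eventually_ge_atTop 0)).exists
  refine ⟨a, ha0, ?_⟩
  have ha : (∫ u, Real.exp (α * u) ∂V) - ε / 2 < ∫ u in Set.Iic a, Real.exp (α * u) ∂V := ha
  have := (tendsto_both_large h hc a).eventually
    (gt_mem_nhds (show _ < ε by linarith))
  filter_upwards [this] with t ht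
  rw [div_lt_iff₀ (h.tail_pos t)] at ht
  exact ht.le

end ConvEquiv


/-! ### Strong regular variation on the multiplicative scale -/

/-- The consequences of `IsStronglyRegVarying α H` used below: the tail of `H` is regularly varying
with index `-α`, the positive part has a finite moment of order `α`, and two independent variables
with law `H` are rarely both large when their product is. -/
structure StrongRegVar (α : ℝ) (H : Measure ℝ) : Prop where
  pos : ∀ x, 0 < tail H x
  scale : ∀ w, 0 < w → Tendsto (fun x => tail H (x / w) / tail H x) atTop (𝓝 (w ^ α))
  moment : FinitePosMoment α H
  both_large : ∀ ε, 0 < ε → ∃ A, 0 < A ∧ ∀ᶠ x in atTop,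
    (H.prod H).real {p | A < p.1 ∧ A < p.2 ∧ x < p.1 * p.2} ≤ ε * tail H x

theorem IsStronglyRegVarying.strongRegVar {α : ℝ} {H : Measure ℝ} [IsProbabilityMeasure H]
    (hα : 0 ≤ α) (h : IsStronglyRegVarying α H) : StrongRegVar α H := by
  set f : ℝ → ℝ := fun u => max (Real.log u) 0 with hf
  have hfm : Measurable f := Real.measurable_log.max measurable_const
  set c := ProbabilityTheory.cond H (Set.Ioi 0) with hc
  set V := c.map f with hV
  have hCE : IsConvEquivNonneg α V := by
    have h' : IsConvEquivNonneg α ((c.map Real.log).map (fun x : ℝ => max x 0)) := h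
    rwa [Measure.map_map (by fun_prop) Real.measurable_log] at h'
  have hq0 : H (Set.Ioi 0) ≠ 0 := fun h0 => by
    have hc0 : c = 0 := by rw [hc, cond_eq_zero]; exact Or.inr h0
    have := hCE.tail_pos 0
    rw [hV, hc0] at this
    simp [tail] at this
  have : IsProbabilityMeasure c := cond_isProbabilityMeasure hq0
  have : IsProbabilityMeasure V := Measure.isProbabilityMeasure_map hfm.aemeasurable
  set q := tail H 0 with hq
  have hqp : 0 < q := lt_of_le_of_ne (tail_nonneg H 0)
    (Ne.symm ((measureReal_ne_zero_iff (measure_ne_top _ _)).mpr hq0))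
  have hHc : H.restrict (Set.Ioi 0) = H (Set.Ioi 0) • c := by
    rw [hc, ProbabilityTheory.cond, smul_smul, ENNReal.mul_inv_cancel hq0 (measure_ne_top _ _),
      one_smul]
  have hpre : ∀ t, 0 ≤ t → ∀ u, 0 < u → (t < f u ↔ Real.exp t < u) := fun t ht u hu => by
    rw [hf, lt_max_iff, Real.lt_log_iff_exp_lt hu]
    exact or_iff_left (not_lt.mpr ht)
  have htail : ∀ x, 1 ≤ x → tail H x = q * tail V (Real.log x) := fun x hx => by
    have hx0 : 0 < x := by linarith
    rw [tail, tail, hV, map_measureReal_apply hfm measurableSet_Ioi]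
    have : H.real (Set.Ioi x) = (H.restrict (Set.Ioi 0)).real (f ⁻¹' Set.Ioi (Real.log x)) := by
      rw [measureReal_restrict_apply (hfm measurableSet_Ioi)]
      congr 1
      ext u
      simp only [Set.mem_inter_iff, Set.mem_preimage, Set.mem_Ioi]
      constructor
      · intro hu
        have hu0 : 0 < u := hx0.trans hu
        exact ⟨(hpre _ (Real.log_nonneg hx) u hu0).mpr (by rwa [Real.exp_log hx0]), hu0⟩
      · rintro ⟨h1, h2⟩
        have := (hpre _ (Real.log_nonneg hx) u h2).mp h1
        rwa [Real.exp_log hx0] at this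
    rw [this, hHc, measureReal_ennreal_smul_apply]
    rfl
  have hpos : ∀ x, 0 < tail H x := fun x => by
    have h1 : 0 < tail H (max x 1) := by
      rw [htail _ (le_max_right _ _)]
      exact mul_pos hqp (hCE.tail_pos _)
    exact h1.trans_le (tail_antitone H (le_max_left _ _))
  refine ⟨hpos, fun w hw => ?_, ?_, fun ε hε => ?_⟩
  · have := (hCE.tail_shift (Real.log w)).comp Real.tendsto_log_atTop
    rw [mul_comm, ← Real.rpow_def_of_pos hw] at this
    refine this.congr' ?_
    filter_upwards [eventually_ge_atTop 1, eventually_ge_atTop w] with x hx1 hxw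
    have hx0 : 0 < x := by linarith
    rw [Function.comp, htail x hx1, htail (x / w) ((one_le_div hw).mpr hxw),
      Real.log_div hx0.ne' hw.ne', mul_div_mul_left _ _ hqp.ne']
  · have hi := hCE.integrable_exp hα
    rw [hV, integrable_map_measure (by fun_prop) hfm.aemeasurable] at hi
    rw [FinitePosMoment, IntegrableOn, hHc]
    refine Integrable.smul_measure ?_ (measure_ne_top _ _)
    refine hi.mono' (by fun_prop) ?_
    have hae : ∀ᵐ u ∂c, u ∈ Set.Ioi (0 : ℝ) := by
      rw [hc]
      exact ae_cond_mem measurableSet_Ioi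
    filter_upwards [hae] with u hu
    have hu : 0 < u := hu
    rw [Real.norm_of_nonneg (Real.rpow_nonneg hu.le _), Real.rpow_def_of_pos hu, Function.comp,
      Real.exp_le_exp, mul_comm]
    exact mul_le_mul_of_nonneg_left (le_max_left _ _) hα
  · have hV0 : V (Set.Iio 0) = 0 := by
      rw [hV, Measure.map_apply hfm measurableSet_Iio]
      convert measure_empty (μ := c)
      ext u
      simp [hf]
    obtain ⟨a, ha, hlarge⟩ := hCE.both_large hα hV0 hε
    refine ⟨Real.exp a, Real.exp_pos a, ?_⟩
    filter_upwards [Real.tendsto_log_atTop.eventually hlarge, eventually_ge_atTop 1] with x hx hx1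
    have hx0 : 0 < x := by linarith
    rw [htail x hx1]
    set E : Set (ℝ × ℝ) := {p | Real.exp a < p.1 ∧ Real.exp a < p.2 ∧ x < p.1 * p.2} with hE
    set E' : Set (ℝ × ℝ) := {p | a < p.1 ∧ a < p.2 ∧ Real.log x < p.1 + p.2} with hE'
    have hEm' : MeasurableSet E' := (measurableSet_lt measurable_const measurable_fst).inter
      ((measurableSet_lt measurable_const measurable_snd).inter
        (measurableSet_lt measurable_const (measurable_fst.add measurable_snd)))
    have hVV : V.prod V = (c.prod c).map (Prod.map f f) := by
      rw [hV, Measure.map_prod_map _ _ hfm hfm]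
    have hHH : (H.prod H).restrict (Set.Ioi 0 ×ˢ Set.Ioi 0) =
        H (Set.Ioi 0) • H (Set.Ioi 0) • c.prod c := by
      rw [← Measure.prod_restrict, hHc, Measure.prod_smul_left, Measure.prod_smul_right]
    have hsub : E ⊆ (Prod.map f f ⁻¹' E') ∩ (Set.Ioi 0 ×ˢ Set.Ioi 0) := by
      rintro ⟨u, v⟩ ⟨h1, h2, h3⟩
      have hu : 0 < u := (Real.exp_pos a).trans h1
      have hv : 0 < v := (Real.exp_pos a).trans h2
      refine ⟨⟨(hpre a ha u hu).mpr h1, (hpre a ha v hv).mpr h2, ?_⟩, hu, hv⟩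
      have := Real.log_lt_log hx0 h3
      simp only at this
      rw [Real.log_mul hu.ne' hv.ne'] at this
      exact this.trans_le (add_le_add (le_max_left _ _) (le_max_left _ _))
    have hmE : MeasurableSet (Prod.map f f ⁻¹' E') := (hfm.prodMap hfm) hEm'
    calc (H.prod H).real E ≤ (H.prod H).real ((Prod.map f f ⁻¹' E') ∩ (Set.Ioi 0 ×ˢ Set.Ioi 0)) :=
          measureReal_mono hsub
      _ = q * (q * (V.prod V).real E') := by
          rw [← measureReal_restrict_apply hmE, hHH, measureReal_ennreal_smul_apply,
            measureReal_ennreal_smul_apply, hVV,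
            map_measureReal_apply (hfm.prodMap hfm) hEm']
          rfl
      _ ≤ 1 * (q * (ε * tail V (Real.log x))) := by
          refine mul_le_mul (tail_le_one H 0) (mul_le_mul_of_nonneg_left hx hqp.le)
            (mul_nonneg hqp.le measureReal_nonneg) zero_le_one
      _ = ε * (q * tail V (Real.log x)) := by ring


/-! ### Comparison of tails up to a negligible error -/

/-- `f ≤ g + o(tail H)` at infinity. -/
def TailLE (H : Measure ℝ) (f g : ℝ → ℝ) : Prop :=
  ∀ ε, 0 < ε → ∀ᶠ x in atTop, f x ≤ g x + ε * tail H x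

/-- The tail of `ν` is bounded by a multiple of the tail of `H`, on the whole line. -/
def TailBounded (H ν : Measure ℝ) : Prop := ∃ C, 0 ≤ C ∧ ∀ x, tail ν x ≤ C * tail H x

/-- Nonnegative functions of order at most `tail H` that are regularly varying of index `-α` up to
an error `o(tail H)`. Under the standing assumption the combinations `a F̄ + b Ḡ` are of this kind,
even though neither `F̄` nor `Ḡ` has to be regularly varying itself. -/
structure TailReg (α : ℝ) (H : Measure ℝ) (g : ℝ → ℝ) : Prop where
  nonneg : ∀ x, 0 ≤ g x
  bdd : ∃ C, 0 ≤ C ∧ ∀ x, g x ≤ C * tail H x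
  meas : Measurable g
  scale : ∀ w, 0 < w → Tendsto (fun x => (g (x / w) - w ^ α * g x) / tail H x) atTop (𝓝 0)

section Comparison

variable {α : ℝ} {H : Measure ℝ} {f f' g g' k : ℝ → ℝ}

lemma TailLE.of_eventually_le (h : ∀ᶠ x in atTop, f x ≤ g x) : TailLE H f g := fun ε hε => by
  filter_upwards [h] with x hx
  linarith [mul_nonneg hε.le (tail_nonneg H x)]

lemma TailLE.of_le (h : ∀ x, f x ≤ g x) : TailLE H f g := .of_eventually_le (.of_forall h)

lemma TailLE.trans (h : TailLE H f g) (h' : TailLE H g k) : TailLE H f k := fun ε hε => by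
  filter_upwards [h (ε / 2) (half_pos hε), h' (ε / 2) (half_pos hε)] with x h1 h2
  linarith

lemma TailLE.add (h : TailLE H f g) (h' : TailLE H f' g') :
    TailLE H (fun x => f x + f' x) (fun x => g x + g' x) := fun ε hε => by
  filter_upwards [h (ε / 2) (half_pos hε), h' (ε / 2) (half_pos hε)] with x h1 h2
  linarith

lemma TailLE.const_mul {c : ℝ} (hc : 0 ≤ c) (h : TailLE H f g) :
    TailLE H (fun x => c * f x) (fun x => c * g x) := fun ε hε => by
  filter_upwards [h (ε / (c + 1)) (by positivity)] with x hx
  have h1 : c * (ε / (c + 1)) ≤ ε := by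
    rw [mul_div_assoc', div_le_iff₀ (by linarith)]
    nlinarith
  nlinarith [mul_le_mul_of_nonneg_left hx hc, mul_le_mul_of_nonneg_right h1 (tail_nonneg H x)]

lemma TailLE.of_forall_error (h : ∀ η, 0 < η → TailLE H f (fun x => g x + η * tail H x)) :
    TailLE H f g := fun ε hε => by
  filter_upwards [h (ε / 2) (half_pos hε) (ε / 2) (half_pos hε)] with x hx
  linarith

lemma TailLE.of_tendsto (hpos : ∀ x, 0 < tail H x) {l : ℝ} (hl : l ≤ 0)
    (h : Tendsto (fun x => (f x - g x) / tail H x) atTop (𝓝 l)) : TailLE H f g := fun ε hε => by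
  filter_upwards [h.eventually (gt_mem_nhds (show l < ε by linarith))] with x hx
  rw [div_lt_iff₀ (hpos x)] at hx
  linarith

lemma StrongRegVar.eventually_tail_div_le (hH : StrongRegVar α H) {w : ℝ} (hw : 0 < w) :
    ∀ᶠ x in atTop, tail H (x / w) ≤ (w ^ α + 1) * tail H x := by
  filter_upwards [(hH.scale w hw).eventually (gt_mem_nhds (lt_add_one _))] with x hx
  rw [div_lt_iff₀ (hH.pos x)] at hx
  exact hx.le

lemma TailLE.comp_div (hH : StrongRegVar α H) (h : TailLE H f g) {w : ℝ} (hw : 0 < w) :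
    TailLE H (fun x => f (x / w)) (fun x => g (x / w)) := fun ε hε => by
  have hwα : 0 < w ^ α + 1 := by positivity
  have ht : Tendsto (fun x : ℝ => x / w) atTop atTop := tendsto_id.atTop_div_const hw
  filter_upwards [ht.eventually (h (ε / (w ^ α + 1)) (by positivity)),
    hH.eventually_tail_div_le hw] with x h1 h2
  have : ε / (w ^ α + 1) * tail H (x / w) ≤ ε * tail H x := by
    rw [div_mul_eq_mul_div, div_le_iff₀ hwα]
    nlinarith [mul_le_mul_of_nonneg_left h2 hε.le]
  linarith

lemma TailReg.div_le (hH : StrongRegVar α H) (h : TailReg α H g) {w : ℝ} (hw : 0 < w) :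
    TailLE H (fun x => g (x / w)) (fun x => w ^ α * g x) :=
  .of_tendsto hH.pos le_rfl (h.scale w hw)

lemma TailReg.le_div (hH : StrongRegVar α H) (h : TailReg α H g) {w : ℝ} (hw : 0 < w) :
    TailLE H (fun x => w ^ α * g x) (fun x => g (x / w)) := by
  refine .of_tendsto hH.pos le_rfl (l := 0) ?_
  have := (h.scale w hw).neg
  rw [neg_zero] at this
  refine this.congr fun x => ?_
  ring

lemma TailReg.add (h : TailReg α H g) (h' : TailReg α H g') :
    TailReg α H (fun x => g x + g' x) where
  nonneg x := add_nonneg (h.nonneg x) (h'.nonneg x)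
  bdd := by
    obtain ⟨C, hC, hb⟩ := h.bdd
    obtain ⟨C', hC', hb'⟩ := h'.bdd
    exact ⟨C + C', add_nonneg hC hC', fun x => by linarith [hb x, hb' x]⟩
  meas := h.meas.add h'.meas
  scale w hw := by
    have := (h.scale w hw).add (h'.scale w hw)
    rw [add_zero] at this
    refine this.congr fun x => ?_
    ring

lemma TailReg.const_mul {c : ℝ} (hc : 0 ≤ c) (h : TailReg α H g) :
    TailReg α H (fun x => c * g x) where
  nonneg x := mul_nonneg hc (h.nonneg x)
  bdd := by
    obtain ⟨C, hC, hb⟩ := h.bdd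
    exact ⟨c * C, mul_nonneg hc hC, fun x => by
      nlinarith [mul_le_mul_of_nonneg_left (hb x) hc]⟩
  meas := h.meas.const_mul c
  scale w hw := by
    have := (h.scale w hw).const_mul c
    rw [mul_zero] at this
    refine this.congr fun x => ?_
    ring

lemma TailBounded.eventually_div {ν : Measure ℝ} (hH : StrongRegVar α H) (h : TailBounded H ν)
    {w : ℝ} (hw : 0 < w) : ∃ C, 0 ≤ C ∧ ∀ᶠ x in atTop, tail ν (x / w) ≤ C * tail H x := by
  obtain ⟨C, hC, hb⟩ := h
  refine ⟨C * (w ^ α + 1), by positivity, ?_⟩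
  filter_upwards [hH.eventually_tail_div_le hw] with x hx
  exact (hb _).trans (by rw [mul_assoc]; exact mul_le_mul_of_nonneg_left hx hC)

/-- A product of a tail of order `tail H` and a function tending to zero is negligible. -/
lemma TailBounded.mul_tendsto_zero {ν : Measure ℝ} (hH : StrongRegVar α H) (h : TailBounded H ν)
    {w : ℝ} (hw : 0 < w) {r : ℝ → ℝ} (hr : Tendsto r atTop (𝓝 0)) :
    TailLE H (fun x => tail ν (x / w) * r x) (fun _ => 0) := fun ε hε => by
  obtain ⟨C, hC, hb⟩ := h.eventually_div hH hw
  filter_upwards [hb, hr.eventually (gt_mem_nhds (show 0 < ε / (C + 1) by positivity))] with x h1 h2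
  have h3 : tail ν (x / w) * r x ≤ C * tail H x * (ε / (C + 1)) :=
    (mul_le_mul_of_nonneg_left h2.le (tail_nonneg _ _)).trans
      (mul_le_mul_of_nonneg_right h1 (by positivity))
  have h4 : C * tail H x * (ε / (C + 1)) = C / (C + 1) * (ε * tail H x) := by ring
  have h5 : C / (C + 1) * (ε * tail H x) ≤ ε * tail H x :=
    mul_le_of_le_one_left (mul_nonneg hε.le (tail_nonneg _ _))
      ((div_le_one (by positivity)).mpr (by linarith))
  linarith

end Comparison

section Bounds

variable {α : ℝ} {H : Measure ℝ} [IsProbabilityMeasure H] {g g₁ g₂ : ℝ → ℝ}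
  {ν ν₁ ν₂ : Measure ℝ}

lemma TailBounded.of_eventually [IsProbabilityMeasure ν] (hH : StrongRegVar α H) {C : ℝ}
    (hC : 0 ≤ C) (h : ∀ᶠ x in atTop, tail ν x ≤ C * tail H x) : TailBounded H ν := by
  obtain ⟨x₀, hx₀⟩ := eventually_atTop.mp h
  have hp := hH.pos x₀
  refine ⟨max C (1 / tail H x₀), le_max_of_le_left hC, fun x => ?_⟩
  rcases le_total x₀ x with hx | hx
  · exact (hx₀ x hx).trans (mul_le_mul_of_nonneg_right (le_max_left _ _) (tail_nonneg _ _))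
  · calc tail ν x ≤ 1 := tail_le_one ν x
      _ = 1 / tail H x₀ * tail H x₀ := by field_simp
      _ ≤ max C (1 / tail H x₀) * tail H x :=
        mul_le_mul (le_max_right _ _) (tail_antitone H hx) hp.le (le_max_of_le_left hC)

lemma TailLE.tailBounded [IsProbabilityMeasure ν] (hH : StrongRegVar α H) (hg : TailReg α H g)
    (h : TailLE H (tail ν) g) : TailBounded H ν := by
  obtain ⟨C, hC, hb⟩ := hg.bdd
  refine .of_eventually hH (C := C + 1) (by linarith) ?_
  filter_upwards [h 1 one_pos] with x hx
  linarith [hb x]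

/-- A tail of order `tail H` has a finite positive moment of order `α`. -/
lemma TailBounded.finitePosMoment [IsFiniteMeasure ν] (hα : 0 ≤ α) (hH : StrongRegVar α H)
    (h : TailBounded H ν) : FinitePosMoment α ν := by
  rcases hα.eq_or_lt with rfl | hα
  · simp only [FinitePosMoment, Real.rpow_zero]
    exact integrableOn_const (measure_ne_top _ _)
  obtain ⟨C, hC, hb⟩ := h
  set ψ : ℝ → ℝ := fun z => max z 0 ^ α with hψ
  have hψ0 : ∀ x ≤ 0, ψ x = 0 := fun x hx => by
    simp [hψ, max_eq_right hx, Real.zero_rpow hα.ne']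
  have hψn : ∀ x, 0 ≤ ψ x := fun x => Real.rpow_nonneg (le_max_right _ _) _
  have hψm : Monotone ψ := fun x y hxy =>
    Real.rpow_le_rpow (le_max_right _ _) (max_le_max_right _ hxy) hα.le
  have hψc : Continuous ψ :=
    (continuous_id.max continuous_const).rpow_const fun _ => Or.inr hα.le
  have hdom := lintegral_le_of_tail_le (μ := ν) (ν := ENNReal.ofReal C • H) (fun x _ => by
    rw [Measure.smul_apply, smul_eq_mul, ← ofReal_measureReal (μ := ν),
      ← ofReal_measureReal (μ := H), ← ENNReal.ofReal_mul hC]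
    exact ENNReal.ofReal_le_ofReal (hb x)) hψm hψc hψ0
  have hψi : Integrable ψ H := by
    have : Integrable ((Set.Ioi (0 : ℝ)).indicator fun z => z ^ α) H :=
      (integrable_indicator_iff measurableSet_Ioi).mpr hH.moment
    refine this.congr (ae_of_all _ fun z => ?_)
    by_cases hz : 0 < z
    · rw [Set.indicator_of_mem (show z ∈ Set.Ioi (0 : ℝ) from hz)]
      simp [hψ, max_eq_left hz.le]
    · rw [Set.indicator_of_notMem (show z ∉ Set.Ioi (0 : ℝ) from hz), hψ0 z (not_lt.mp hz)]
  have hψν : Integrable ψ ν := by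
    refine (lintegral_ofReal_ne_top_iff_integrable hψc.aestronglyMeasurable
      (ae_of_all _ hψn)).mp (ne_of_lt (hdom.trans_lt ?_))
    rw [lintegral_smul_measure, smul_eq_mul]
    exact ENNReal.mul_lt_top ENNReal.ofReal_lt_top
      (lt_top_iff_ne_top.mpr ((lintegral_ofReal_ne_top_iff_integrable hψc.aestronglyMeasurable
      (ae_of_all _ hψn)).mpr hψi))
  refine hψν.integrableOn.congr_fun (fun z hz => ?_) measurableSet_Ioi
  have hz : 0 < z := hz
  simp [hψ, max_eq_left hz.le]

lemma posMoment_nonneg (α : ℝ) (ν : Measure ℝ) : 0 ≤ posMoment α ν :=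
  setIntegral_nonneg measurableSet_Ioi fun _ hz => Real.rpow_nonneg (le_of_lt hz) _

lemma posMoment_pos_of_tail_pos (hν : FinitePosMoment α ν) (h : 0 < tail ν 0) :
    0 < posMoment α ν := by
  have hne : ν (Set.Ioi 0) ≠ 0 := fun h0 => by
    rw [tail, Measure.real, h0] at h
    simp at h
  rw [posMoment, setIntegral_pos_iff_support_of_nonneg_ae]
  · refine lt_of_lt_of_le (pos_iff_ne_zero.mpr hne) (measure_mono fun z hz => ⟨?_, hz⟩)
    exact (Real.rpow_pos_of_pos hz α).ne'
  · rw [EventuallyLE, ae_restrict_iff' measurableSet_Ioi]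
    exact ae_of_all _ fun z hz => Real.rpow_nonneg (le_of_lt hz) _
  · exact hν

lemma posMoment_eq_zero_of_tail_eq_zero [IsFiniteMeasure ν] (h : tail ν 0 = 0) :
    posMoment α ν = 0 :=
  setIntegral_measure_zero _ ((measureReal_eq_zero_iff (measure_ne_top _ _)).mp h)

/-! ### Products of independent variables -/

/-- The product of two independent variables, the first one positive, is large because one factor
is and the other is at most `A`, or because both factors exceed `A`. -/
lemma tail_mconv_eq [IsFiniteMeasure ν₁] [IsFiniteMeasure ν₂] (h₁ : ν₁ (Set.Iic 0) = 0)
    {A x : ℝ} (hA : 0 < A) (hx : A * A ≤ x) :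
    tail (Measure.mconv ν₁ ν₂) x = (∫ u in Set.Ioc 0 A, tail ν₂ (x / u) ∂ν₁)
      + (∫ v in Set.Ioc 0 A, tail ν₁ (x / v) ∂ν₂)
      + (ν₁.prod ν₂).real {p | A < p.1 ∧ A < p.2 ∧ x < p.1 * p.2} := by
  have hx0 : 0 < x := lt_of_lt_of_le (mul_pos hA hA) hx
  have m0 : MeasurableSet {p : ℝ × ℝ | x < p.1 * p.2} :=
    measurableSet_lt measurable_const (measurable_fst.mul measurable_snd)
  have m1 : MeasurableSet {p : ℝ × ℝ | p.1 ∈ Set.Ioc 0 A ∧ x < p.1 * p.2} :=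
    (measurable_fst measurableSet_Ioc).inter m0
  have m2 : MeasurableSet {p : ℝ × ℝ | p.2 ∈ Set.Ioc 0 A ∧ x < p.1 * p.2} :=
    (measurable_snd measurableSet_Ioc).inter m0
  have m3 : MeasurableSet {p : ℝ × ℝ | A < p.1 ∧ A < p.2 ∧ x < p.1 * p.2} :=
    (measurableSet_lt measurable_const measurable_fst).inter
      ((measurableSet_lt measurable_const measurable_snd).inter m0)
  have hae : ∀ᵐ p ∂(ν₁.prod ν₂), 0 < p.1 := by
    refine Measure.quasiMeasurePreserving_fst.ae (p := fun u => 0 < u) ?_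
    rw [ae_iff]
    exact measure_mono_null (fun u hu => not_lt.mp hu) h₁
  have hpre : tail (Measure.mconv ν₁ ν₂) x = (ν₁.prod ν₂).real {p | x < p.1 * p.2} := by
    rw [tail, Measure.mconv, map_measureReal_apply (by fun_prop) measurableSet_Ioi]
    rfl
  have hun : (ν₁.prod ν₂).real {p : ℝ × ℝ | x < p.1 * p.2} = (ν₁.prod ν₂).real
      (({p | p.1 ∈ Set.Ioc 0 A ∧ x < p.1 * p.2} ∪ {p | p.2 ∈ Set.Ioc 0 A ∧ x < p.1 * p.2}) ∪
        {p | A < p.1 ∧ A < p.2 ∧ x < p.1 * p.2}) := by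
    refine measureReal_congr ?_
    filter_upwards [hae] with p hp
    refine propext ⟨fun h => ?_, fun h => ?_⟩
    · have h : x < p.1 * p.2 := h
      have h2 : 0 < p.2 := (mul_pos_iff_of_pos_left hp).mp (hx0.trans h)
      rcases le_or_gt p.1 A with h3 | h3
      · exact Or.inl (Or.inl ⟨⟨hp, h3⟩, h⟩)
      rcases le_or_gt p.2 A with h4 | h4
      · exact Or.inl (Or.inr ⟨⟨h2, h4⟩, h⟩)
      · exact Or.inr ⟨h3, h4, h⟩
    · rcases h with (h | h) | h
      exacts [h.2, h.2, h.2.2]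
  have hd1 : Disjoint {p : ℝ × ℝ | p.1 ∈ Set.Ioc 0 A ∧ x < p.1 * p.2}
      {p | p.2 ∈ Set.Ioc 0 A ∧ x < p.1 * p.2} := by
    rw [Set.disjoint_left]
    rintro p ⟨⟨h1, h2⟩, h3⟩ ⟨⟨h4, h5⟩, -⟩
    nlinarith [mul_le_mul h2 h5 h4.le hA.le]
  have hd2 : Disjoint ({p : ℝ × ℝ | p.1 ∈ Set.Ioc 0 A ∧ x < p.1 * p.2} ∪
      {p | p.2 ∈ Set.Ioc 0 A ∧ x < p.1 * p.2}) {p | A < p.1 ∧ A < p.2 ∧ x < p.1 * p.2} := by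
    rw [Set.disjoint_left]
    rintro p (⟨⟨h1, h2⟩, -⟩ | ⟨⟨h1, h2⟩, -⟩) ⟨h3, h4, -⟩ <;> linarith
  have hi : ∀ (ν : Measure ℝ) (u : ℝ), ν.real {y : ℝ | u ∈ Set.Ioc 0 A ∧ x < u * y} =
      (Set.Ioc 0 A).indicator (fun u => tail ν (x / u)) u := by
    intro ν u
    by_cases hu : u ∈ Set.Ioc 0 A
    · rw [Set.indicator_of_mem hu]
      simp only [hu, true_and, tail]
      congr 1
      ext y
      exact (div_lt_iff₀' hu.1).symm
    · rw [Set.indicator_of_notMem hu]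
      simp [hu]
  have e1 : (ν₁.prod ν₂).real {p | p.1 ∈ Set.Ioc 0 A ∧ x < p.1 * p.2} =
      ∫ u in Set.Ioc 0 A, tail ν₂ (x / u) ∂ν₁ := by
    rw [measureReal_prod_eq_integral ν₁ ν₂ m1, ← integral_indicator measurableSet_Ioc]
    exact integral_congr_ae (ae_of_all _ fun u => hi ν₂ u)
  have e2 : (ν₁.prod ν₂).real {p | p.2 ∈ Set.Ioc 0 A ∧ x < p.1 * p.2} =
      ∫ v in Set.Ioc 0 A, tail ν₁ (x / v) ∂ν₂ := by
    rw [measureReal_prod_swap_eq_integral ν₁ ν₂ m2, ← integral_indicator measurableSet_Ioc]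
    refine integral_congr_ae (ae_of_all _ fun u => ?_)
    simp only [Set.preimage_ofPred_eq, mul_comm _ u]
    exact hi ν₁ u
  rw [hpre, hun, measureReal_union hd2 m3, measureReal_union hd1 m2, e1, e2]

/-- The contribution of two large factors is monotone in the second tail. -/
lemma measureReal_both_large_le {μ : Measure ℝ} [IsFiniteMeasure μ] [IsFiniteMeasure ν₁]
    [IsFiniteMeasure ν₂] {A C x : ℝ} (hA : 0 < A)
    (h : ∀ z, A ≤ z → tail ν₁ z ≤ C * tail ν₂ z) :
    (μ.prod ν₁).real {p | A < p.1 ∧ A < p.2 ∧ x < p.1 * p.2} ≤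
      C * (μ.prod ν₂).real {p | A < p.1 ∧ A < p.2 ∧ x < p.1 * p.2} := by
  have m3 : MeasurableSet {p : ℝ × ℝ | A < p.1 ∧ A < p.2 ∧ x < p.1 * p.2} :=
    (measurableSet_lt measurable_const measurable_fst).inter
      ((measurableSet_lt measurable_const measurable_snd).inter
        (measurableSet_lt measurable_const (measurable_fst.mul measurable_snd)))
  have hi : ∀ (ν : Measure ℝ) (u : ℝ), ν.real {y : ℝ | A < u ∧ A < y ∧ x < u * y} =
      (Set.Ioi A).indicator (fun u => tail ν (max A (x / u))) u := by
    intro ν u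
    by_cases hu : A < u
    · rw [Set.indicator_of_mem (show u ∈ Set.Ioi A from hu)]
      simp only [hu, true_and, tail]
      congr 1
      ext y
      simp only [Set.mem_ofPred_eq, Set.mem_Ioi, max_lt_iff]
      rw [div_lt_iff₀' (hA.trans hu)]
    · rw [Set.indicator_of_notMem (show u ∉ Set.Ioi A from hu)]
      simp [hu]
  have e : ∀ (ν : Measure ℝ) [IsFiniteMeasure ν],
      (μ.prod ν).real {p | A < p.1 ∧ A < p.2 ∧ x < p.1 * p.2} =
      ∫ u in Set.Ioi A, tail ν (max A (x / u)) ∂μ := fun ν _ => by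
    rw [measureReal_prod_eq_integral μ ν m3, ← integral_indicator measurableSet_Ioi]
    exact integral_congr_ae (ae_of_all _ fun u => hi ν u)
  have hint : ∀ (ν : Measure ℝ) [IsFiniteMeasure ν],
      Integrable (fun u => tail ν (max A (x / u))) (μ.restrict (Set.Ioi A)) := fun ν _ => by
    refine (integrable_const (ν.real Set.univ)).mono' ?_ (ae_of_all _ fun u => ?_)
    · exact ((measurable_tail ν).comp
        (measurable_const.max (measurable_const.div measurable_id))).aestronglyMeasurable
    · rw [Real.norm_of_nonneg (tail_nonneg _ _)]
      exact measureReal_mono (Set.subset_univ _)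
  rw [e ν₁, e ν₂, ← integral_const_mul]
  exact integral_mono (hint ν₁) ((hint ν₂).const_mul C) fun u => h _ (le_max_left _ _)

lemma measureReal_both_large_swap [IsFiniteMeasure ν₁] [IsFiniteMeasure ν₂] (A x : ℝ) :
    (ν₁.prod ν₂).real {p | A < p.1 ∧ A < p.2 ∧ x < p.1 * p.2} =
      (ν₂.prod ν₁).real {p | A < p.1 ∧ A < p.2 ∧ x < p.1 * p.2} := by
  have m3 : MeasurableSet {p : ℝ × ℝ | A < p.1 ∧ A < p.2 ∧ x < p.1 * p.2} :=
    (measurableSet_lt measurable_const measurable_fst).inter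
      ((measurableSet_lt measurable_const measurable_snd).inter
        (measurableSet_lt measurable_const (measurable_fst.mul measurable_snd)))
  rw [← Measure.prod_swap (μ := ν₁) (ν := ν₂), map_measureReal_apply measurable_swap m3]
  congr 1
  ext p
  simp only [Set.mem_ofPred_eq, Set.mem_preimage, Prod.fst_swap, Prod.snd_swap, mul_comm p.2]
  tauto

lemma integrable_comp_div_Ioc [IsFiniteMeasure ν] {f : ℝ → ℝ} (hf : Measurable f) {B : ℝ}
    (hB : ∀ x, |f x| ≤ B) (A x : ℝ) :
    Integrable (fun u => f (x / u)) (ν.restrict (Set.Ioc 0 A)) :=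
  (integrable_const B).mono'
    (hf.comp (measurable_const.div measurable_id)).aestronglyMeasurable
    (ae_of_all _ fun _ => hB _)

/-- Comparison up to `o(tail H)` is preserved by integration over bounded scaling factors. -/
lemma TailLE.integral_comp_div [IsFiniteMeasure ν] (hH : StrongRegVar α H) {f f' : ℝ → ℝ}
    (hf : Measurable f) (hf' : Measurable f') {B B' : ℝ} (hB : ∀ x, |f x| ≤ B)
    (hB' : ∀ x, |f' x| ≤ B') (h : TailLE H f f') {A : ℝ} (hA : 0 < A) :
    TailLE H (fun x => ∫ u in Set.Ioc 0 A, f (x / u) ∂ν)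
      (fun x => ∫ u in Set.Ioc 0 A, f' (x / u) ∂ν) := fun ε hε => by
  set K := (ν.restrict (Set.Ioc 0 A)).real Set.univ * (A ^ α + 1) + 1 with hK
  have hKp : 0 < K := by positivity
  obtain ⟨x₀, hx₀⟩ := eventually_atTop.mp (h (ε / K) (by positivity))
  filter_upwards [hH.eventually_tail_div_le hA, eventually_ge_atTop (A * x₀),
    eventually_ge_atTop 0] with x hx1 hx2 hx3
  have hle : ∀ᵐ u ∂(ν.restrict (Set.Ioc 0 A)), f (x / u) ≤
      f' (x / u) + ε / K * ((A ^ α + 1) * tail H x) := by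
    rw [ae_restrict_iff' measurableSet_Ioc]
    refine ae_of_all _ fun u hu => ?_
    have h1 : x / A ≤ x / u := div_le_div_of_nonneg_left hx3 hu.1 hu.2
    have h2 : x₀ ≤ x / u := le_trans ((le_div_iff₀' hA).mpr hx2) h1
    have h3 : ε / K * tail H (x / u) ≤ ε / K * ((A ^ α + 1) * tail H x) :=
      mul_le_mul_of_nonneg_left ((tail_antitone H h1).trans hx1) (by positivity)
    linarith [hx₀ _ h2]
  refine (integral_mono_ae (integrable_comp_div_Ioc hf hB A x)
    ((integrable_comp_div_Ioc hf' hB' A x).add (integrable_const _)) hle).trans ?_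
  simp only [Pi.add_apply]
  rw [integral_add (integrable_comp_div_Ioc hf' hB' A x) (integrable_const _), integral_const,
    smul_eq_mul]
  refine add_le_add le_rfl ?_
  have : (ν.restrict (Set.Ioc 0 A)).real Set.univ * (ε / K * ((A ^ α + 1) * tail H x)) =
      (K - 1) / K * (ε * tail H x) := by rw [hK]; ring
  rw [this]
  have h1 : (K - 1) / K ≤ 1 := (div_le_one hKp).mpr (by linarith)
  nlinarith [mul_nonneg hε.le (tail_nonneg H x)]

lemma integrableOn_rpow_Ioc [IsFiniteMeasure ν] (hα : 0 ≤ α) (A : ℝ) :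
    Integrable (fun u => u ^ α) (ν.restrict (Set.Ioc 0 A)) := by
  refine (integrable_const (A ^ α)).mono' (by fun_prop) ?_
  rw [ae_restrict_iff' measurableSet_Ioc]
  refine ae_of_all _ fun u hu => ?_
  rw [Real.norm_of_nonneg (Real.rpow_nonneg hu.1.le _)]
  exact Real.rpow_le_rpow hu.1.le hu.2 hα

lemma TailReg.abs_le (hg : TailReg α H g) : ∃ B, ∀ x, |g x| ≤ B := by
  obtain ⟨C, hC, hb⟩ := hg.bdd
  refine ⟨C, fun x => ?_⟩
  rw [abs_of_nonneg (hg.nonneg x)]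
  exact (hb x).trans (mul_le_of_le_one_right hC (tail_le_one H x))

lemma abs_tail_le [IsFiniteMeasure ν] (x : ℝ) : |tail ν x| ≤ ν.real Set.univ := by
  rw [abs_of_nonneg (tail_nonneg _ _)]
  exact measureReal_mono (Set.subset_univ _)

/-- Regular variation, integrated over bounded scaling factors. -/
lemma TailReg.tendsto_integral_comp_div [IsFiniteMeasure ν] (hα : 0 ≤ α)
    (hH : StrongRegVar α H) (hg : TailReg α H g) {A : ℝ} (hA : 0 < A) :
    Tendsto (fun x => ((∫ u in Set.Ioc 0 A, g (x / u) ∂ν)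
      - (∫ u in Set.Ioc 0 A, u ^ α ∂ν) * g x) / tail H x) atTop (𝓝 0) := by
  obtain ⟨C, hC, hb⟩ := hg.bdd
  obtain ⟨B, hB⟩ := hg.abs_le
  have hlim : Tendsto (fun x => ∫ u in Set.Ioc 0 A, (g (x / u) - u ^ α * g x) / tail H x ∂ν)
      atTop (𝓝 (∫ u in Set.Ioc 0 A, (0 : ℝ) ∂ν)) := by
    refine tendsto_integral_filter_of_dominated_convergence
      (fun _ => C * (A ^ α + 1) + A ^ α * C) (Eventually.of_forall fun x => ?_) ?_
      (integrable_const _) ?_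
    · have := hg.meas
      exact Measurable.aestronglyMeasurable (by fun_prop)
    · filter_upwards [hH.eventually_tail_div_le hA, eventually_ge_atTop 0] with x hx1 hx3
      rw [ae_restrict_iff' measurableSet_Ioc]
      refine ae_of_all _ fun u hu => ?_
      have h1 : x / A ≤ x / u := div_le_div_of_nonneg_left hx3 hu.1 hu.2
      have h2 : g (x / u) ≤ C * ((A ^ α + 1) * tail H x) :=
        (hb _).trans (mul_le_mul_of_nonneg_left ((tail_antitone H h1).trans hx1) hC)
      have hu0 : 0 ≤ u ^ α := Real.rpow_nonneg hu.1.le _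
      have h3 : u ^ α * g x ≤ A ^ α * (C * tail H x) :=
        mul_le_mul (Real.rpow_le_rpow hu.1.le hu.2 hα) (hb x) (hg.nonneg x)
          (Real.rpow_nonneg hA.le _)
      have h4 : 0 ≤ u ^ α * g x := mul_nonneg hu0 (hg.nonneg x)
      rw [Real.norm_eq_abs, abs_div, abs_of_pos (hH.pos x), div_le_iff₀ (hH.pos x), _root_.abs_le]
      have h5 := hg.nonneg (x / u)
      constructor <;> nlinarith
    · rw [ae_restrict_iff' measurableSet_Ioc]
      exact ae_of_all _ fun u hu => hg.scale u hu.1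
  rw [integral_zero] at hlim
  refine hlim.congr fun x => ?_
  rw [integral_div, integral_sub (integrable_comp_div_Ioc hg.meas hB A x)
    ((integrableOn_rpow_Ioc hα A).mul_const _), integral_mul_const]

lemma setIntegral_rpow_Ioc_le (hν : FinitePosMoment α ν) (A : ℝ) :
    ∫ u in Set.Ioc 0 A, u ^ α ∂ν ≤ posMoment α ν := by
  refine setIntegral_mono_set hν ?_ (Set.Ioc_subset_Ioi_self.eventuallyLE)
  rw [EventuallyLE, ae_restrict_iff' measurableSet_Ioi]
  exact ae_of_all _ fun z hz => Real.rpow_nonneg (le_of_lt hz) _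

lemma tendsto_setIntegral_rpow_Ioc (hν : FinitePosMoment α ν) :
    Tendsto (fun A => ∫ u in Set.Ioc 0 A, u ^ α ∂ν) atTop (𝓝 (posMoment α ν)) := by
  have h := (aecover_Iic (μ := ν.restrict (Set.Ioi 0))
    (tendsto_id (x := (atTop : Filter ℝ)))).integral_tendsto_of_countably_generated hν
  refine h.congr fun A => ?_
  rw [Measure.restrict_restrict measurableSet_Iic, id, Set.inter_comm, Set.Ioi_inter_Iic]

/-- Upper tail bound for a product of independent variables, the first one positive. -/
theorem TailLE.mconv [IsProbabilityMeasure ν₁] [IsProbabilityMeasure ν₂] (hα : 0 ≤ α)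
    (hH : StrongRegVar α H) (h0 : ν₁ (Set.Iic 0) = 0) (hg₁ : TailReg α H g₁)
    (hg₂ : TailReg α H g₂) (h₁ : TailLE H (tail ν₁) g₁) (h₂ : TailLE H (tail ν₂) g₂) :
    TailLE H (tail (Measure.mconv ν₁ ν₂))
      (fun x => posMoment α ν₁ * g₂ x + posMoment α ν₂ * g₁ x) := by
  obtain ⟨C₁, hC₁, hb₁⟩ := h₁.tailBounded hH hg₁
  obtain ⟨C₂, hC₂, hb₂⟩ := h₂.tailBounded hH hg₂
  have hm₁ := TailBounded.finitePosMoment hα hH ⟨C₁, hC₁, hb₁⟩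
  have hm₂ := TailBounded.finitePosMoment hα hH ⟨C₂, hC₂, hb₂⟩
  obtain ⟨B₁, hB₁⟩ := hg₁.abs_le
  obtain ⟨B₂, hB₂⟩ := hg₂.abs_le
  refine .of_forall_error fun η hη => ?_
  obtain ⟨A, hA, hlarge⟩ := hH.both_large (η / (C₁ * C₂ + 1)) (by positivity)
  have key : ∀ {ν ν' : Measure ℝ} [IsProbabilityMeasure ν] [IsProbabilityMeasure ν'] {g : ℝ → ℝ},
      FinitePosMoment α ν → TailReg α H g → TailLE H (tail ν') g →
      TailLE H (fun x => ∫ u in Set.Ioc 0 A, tail ν' (x / u) ∂ν)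
        (fun x => posMoment α ν * g x) := by
    intro ν ν' _ _ g hν hg h
    obtain ⟨B, hB⟩ := hg.abs_le
    refine (h.integral_comp_div hH (measurable_tail _) hg.meas abs_tail_le hB hA).trans
      (TailLE.trans (.of_tendsto hH.pos le_rfl (hg.tendsto_integral_comp_div hα hH hA))
        (.of_le fun x => ?_))
    exact mul_le_mul_of_nonneg_right (setIntegral_rpow_Ioc_le hν A) (hg.nonneg x)
  refine TailLE.trans ?_ (((key hm₁ hg₂ h₂).add (key hm₂ hg₁ h₁)).add
    (.of_le (H := H) (f := fun x => η * tail H x) fun _ => le_rfl))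
  refine .of_eventually_le ?_
  filter_upwards [hlarge, eventually_ge_atTop (A * A)] with x hx1 hx2
  rw [tail_mconv_eq h0 hA hx2]
  refine add_le_add le_rfl ?_
  have hs1 := measureReal_both_large_le (μ := ν₁) (ν₁ := ν₂) (ν₂ := H) (x := x) hA
    fun z _ => hb₂ z
  have hs2 := measureReal_both_large_le (μ := H) (ν₁ := ν₁) (ν₂ := H) (x := x) hA
    fun z _ => hb₁ z
  rw [measureReal_both_large_swap] at hs2
  have hx1' : C₂ * (C₁ * (H.prod H).real {p | A < p.1 ∧ A < p.2 ∧ x < p.1 * p.2}) ≤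
      C₂ * (C₁ * (η / (C₁ * C₂ + 1) * tail H x)) := by gcongr
  have hfin : C₂ * (C₁ * (η / (C₁ * C₂ + 1) * tail H x)) ≤ η * tail H x := by
    have : C₂ * (C₁ * (η / (C₁ * C₂ + 1) * tail H x)) =
        C₁ * C₂ / (C₁ * C₂ + 1) * (η * tail H x) := by ring
    rw [this]
    refine mul_le_of_le_one_left (mul_nonneg hη.le (tail_nonneg _ _)) ?_
    exact (div_le_one (by positivity)).mpr (by linarith)
  exact (hs1.trans (mul_le_mul_of_nonneg_left hs2 hC₂)).trans (hx1'.trans hfin)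

/-- Lower tail bound for a product of independent variables, the first one positive. -/
theorem TailLE.le_mconv [IsProbabilityMeasure ν₁] [IsProbabilityMeasure ν₂] (hα : 0 ≤ α)
    (hH : StrongRegVar α H) (h0 : ν₁ (Set.Iic 0) = 0) (hg₁ : TailReg α H g₁)
    (hg₂ : TailReg α H g₂) (hb₁ : TailBounded H ν₁) (hb₂ : TailBounded H ν₂)
    (h₁ : TailLE H g₁ (tail ν₁)) (h₂ : TailLE H g₂ (tail ν₂)) :
    TailLE H (fun x => posMoment α ν₁ * g₂ x + posMoment α ν₂ * g₁ x)
      (tail (Measure.mconv ν₁ ν₂)) := by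
  have hm₁ := hb₁.finitePosMoment hα hH
  have hm₂ := hb₂.finitePosMoment hα hH
  have key : ∀ {ν ν' : Measure ℝ} [IsProbabilityMeasure ν] [IsProbabilityMeasure ν'] {g : ℝ → ℝ},
      FinitePosMoment α ν → TailReg α H g → TailLE H g (tail ν') → ∀ η, 0 < η →
      ∀ᶠ A in atTop, 0 < A → TailLE H (fun x => posMoment α ν * g x)
        (fun x => (∫ u in Set.Ioc 0 A, tail ν' (x / u) ∂ν) + η * tail H x) := by
    intro ν ν' _ _ g hν hg h η hη
    obtain ⟨B, hB⟩ := hg.abs_le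
    obtain ⟨C, hC, hb⟩ := hg.bdd
    filter_upwards [(tendsto_setIntegral_rpow_Ioc hν).eventually (lt_mem_nhds
      (show posMoment α ν - η / (C + 1) < _ from sub_lt_self _ (by positivity)))] with A hA1 hA
    have hl : Tendsto (fun x => ((∫ u in Set.Ioc 0 A, u ^ α ∂ν) * g x -
        (∫ u in Set.Ioc 0 A, g (x / u) ∂ν)) / tail H x) atTop (𝓝 0) := by
      have := (hg.tendsto_integral_comp_div (ν := ν) hα hH hA).neg
      rw [neg_zero] at this
      exact this.congr fun x => by ring
    refine TailLE.trans (.of_le fun x => ?_) (((TailLE.of_tendsto hH.pos le_rfl hl).trans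
      (h.integral_comp_div hH hg.meas (measurable_tail _) hB abs_tail_le hA)).add
        (.of_le (H := H) (f := fun x => η * tail H x) fun _ => le_rfl))
    have h1 : η / (C + 1) * g x ≤ η / (C + 1) * (C * tail H x) :=
      mul_le_mul_of_nonneg_left (hb x) (by positivity)
    have h2 : η / (C + 1) * (C * tail H x) ≤ η * tail H x := by
      have : η / (C + 1) * (C * tail H x) = C / (C + 1) * (η * tail H x) := by ring
      rw [this]
      refine mul_le_of_le_one_left (mul_nonneg hη.le (tail_nonneg _ _)) ?_
      exact (div_le_one (by positivity)).mpr (by linarith)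
    nlinarith [mul_le_mul_of_nonneg_right hA1.le (hg.nonneg x)]
  refine .of_forall_error fun η hη => ?_
  obtain ⟨A, ⟨hA1, hA2⟩, hA⟩ := (((key hm₁ hg₂ h₂ (η / 2) (half_pos hη)).and
    (key hm₂ hg₁ h₁ (η / 2) (half_pos hη))).and (eventually_gt_atTop 0)).exists
  refine ((hA1 hA).add (hA2 hA)).trans (.of_eventually_le ?_)
  filter_upwards [eventually_ge_atTop (A * A)] with x hx
  rw [tail_mconv_eq h0 hA hx]
  -- a lower bound may drop the event that both factors are large
  have : 0 ≤ (ν₁.prod ν₂).real {p | A < p.1 ∧ A < p.2 ∧ x < p.1 * p.2} := measureReal_nonneg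
  linarith

/-! ### Sums of independent variables -/

/-- A sum exceeds `x` only if a summand exceeds `x / w` or both exceed `x - x / w`. -/
lemma tail_conv_le [IsProbabilityMeasure ν₁] [IsProbabilityMeasure ν₂] (w x : ℝ) :
    tail (Measure.conv ν₁ ν₂) x ≤ tail ν₁ (x / w) + tail ν₂ (x / w)
      + tail ν₁ (x - x / w) * tail ν₂ (x - x / w) := by
  have hpre : tail (Measure.conv ν₁ ν₂) x = (ν₁.prod ν₂).real {p | x < p.1 + p.2} := by
    rw [tail, Measure.conv, map_measureReal_apply (by fun_prop) measurableSet_Ioi]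
    rfl
  have hsub : {p : ℝ × ℝ | x < p.1 + p.2} ⊆ ((Set.Ioi (x / w) ×ˢ Set.univ) ∪
      (Set.univ ×ˢ Set.Ioi (x / w))) ∪ (Set.Ioi (x - x / w) ×ˢ Set.Ioi (x - x / w)) := by
    intro p hp
    have hp : x < p.1 + p.2 := hp
    rcases lt_or_ge (x / w) p.1 with h1 | h1
    · exact Or.inl (Or.inl ⟨h1, trivial⟩)
    rcases lt_or_ge (x / w) p.2 with h2 | h2
    · exact Or.inl (Or.inr ⟨trivial, h2⟩)
    · exact Or.inr ⟨show x - x / w < p.1 by linarith, show x - x / w < p.2 by linarith⟩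
  rw [hpre]
  refine (measureReal_mono hsub).trans ((measureReal_union_le _ _).trans ?_)
  refine add_le_add ((measureReal_union_le _ _).trans (le_of_eq ?_)) (le_of_eq ?_)
  · simp [measureReal_prod_prod, tail]
  · simp [measureReal_prod_prod, tail]

/-- A sum exceeds `x` if one summand exceeds `x + d` and the other exceeds `-d`. -/
lemma le_tail_conv [IsProbabilityMeasure ν₁] [IsProbabilityMeasure ν₂] (d x : ℝ) :
    tail ν₁ (x + d) * tail ν₂ (-d) + tail ν₂ (x + d) * tail ν₁ (-d)
      - tail ν₁ (x + d) * tail ν₂ (x + d) ≤ tail (Measure.conv ν₁ ν₂) x := by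
  have hpre : tail (Measure.conv ν₁ ν₂) x = (ν₁.prod ν₂).real {p | x < p.1 + p.2} := by
    rw [tail, Measure.conv, map_measureReal_apply (by fun_prop) measurableSet_Ioi]
    rfl
  set E₁ : Set (ℝ × ℝ) := Set.Ioi (x + d) ×ˢ Set.Ioi (-d)
  set E₂ : Set (ℝ × ℝ) := Set.Ioi (-d) ×ˢ Set.Ioi (x + d)
  have hE₂ : MeasurableSet E₂ := measurableSet_Ioi.prod measurableSet_Ioi
  have hsub : E₁ ∪ E₂ ⊆ {p : ℝ × ℝ | x < p.1 + p.2} := by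
    rintro p (⟨h1, h2⟩ | ⟨h1, h2⟩)
    · have h1 : x + d < p.1 := h1
      have h2 : -d < p.2 := h2
      exact show x < p.1 + p.2 by linarith
    · have h1 : -d < p.1 := h1
      have h2 : x + d < p.2 := h2
      exact show x < p.1 + p.2 by linarith
  have hin : (ν₁.prod ν₂).real (E₁ ∩ E₂) ≤ tail ν₁ (x + d) * tail ν₂ (x + d) := by
    have : E₁ ∩ E₂ ⊆ Set.Ioi (x + d) ×ˢ Set.Ioi (x + d) := fun p hp => ⟨hp.1.1, hp.2.2⟩
    refine (measureReal_mono this).trans (le_of_eq ?_)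
    rw [measureReal_prod_prod]; rfl
  have hu := measureReal_union_add_inter (μ := ν₁.prod ν₂) (s := E₁) hE₂
  have h1 : (ν₁.prod ν₂).real E₁ = tail ν₁ (x + d) * tail ν₂ (-d) := measureReal_prod_prod _ _
  have h2 : (ν₁.prod ν₂).real E₂ = tail ν₁ (-d) * tail ν₂ (x + d) := measureReal_prod_prod _ _
  rw [hpre]
  have := measureReal_mono (μ := ν₁.prod ν₂) hsub
  linarith

lemma exists_rpow_near_one (α : ℝ) {η : ℝ} (hη : 0 < η) :
    ∃ w : ℝ, 1 < w ∧ w ^ α < 1 + η ∧ 1 - η < (w⁻¹) ^ α := by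
  have h1 : Tendsto (fun w : ℝ => w ^ α) (𝓝[>] 1) (𝓝 ((1 : ℝ) ^ α)) :=
    ((Real.continuousAt_rpow_const 1 α (Or.inl one_ne_zero)).tendsto).mono_left nhdsWithin_le_nhds
  have h2 : Tendsto (fun w : ℝ => (w⁻¹) ^ α) (𝓝[>] 1) (𝓝 (((1 : ℝ)⁻¹) ^ α)) := by
    refine Tendsto.mono_left ?_ nhdsWithin_le_nhds
    exact ((Real.continuousAt_rpow_const _ α (Or.inl (by norm_num))).comp
      (continuousAt_inv₀ one_ne_zero)).tendsto
  rw [Real.one_rpow] at h1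
  rw [inv_one, Real.one_rpow] at h2
  obtain ⟨w, ⟨hw1, hw2⟩, hw3⟩ := (((h1.eventually (gt_mem_nhds (show 1 < 1 + η by linarith))).and
    (h2.eventually (lt_mem_nhds (show 1 - η < 1 by linarith)))).and self_mem_nhdsWithin).exists
  exact ⟨w, hw3, hw1, hw2⟩

/-- Upper tail bound for a sum of independent variables. -/
theorem TailLE.conv [IsProbabilityMeasure ν₁] [IsProbabilityMeasure ν₂]
    (hH : StrongRegVar α H) (hg₁ : TailReg α H g₁) (hg₂ : TailReg α H g₂)
    (h₁ : TailLE H (tail ν₁) g₁) (h₂ : TailLE H (tail ν₂) g₂) :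
    TailLE H (tail (Measure.conv ν₁ ν₂)) (fun x => g₁ x + g₂ x) := by
  obtain ⟨C, hC, hb⟩ := (hg₁.add hg₂).bdd
  refine .of_forall_error fun η hη => ?_
  obtain ⟨w, hw1, hw2, -⟩ := exists_rpow_near_one α (show 0 < η / (C + 1) by positivity)
  have hw0 : 0 < w := by linarith
  have hv0 : 0 < 1 - w⁻¹ := by
    have := inv_lt_one_of_one_lt₀ hw1
    linarith
  have hsub : ∀ x : ℝ, x - x / w = x / (1 - w⁻¹)⁻¹ := fun x => by
    rw [div_inv_eq_mul, div_eq_mul_inv]; ring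
  have hr : Tendsto (fun x => tail ν₂ (x - x / w)) atTop (𝓝 0) := by
    simp_rw [hsub]
    exact (tendsto_tail_atTop ν₂).comp (tendsto_id.atTop_div_const (inv_pos.mpr hv0))
  have h3 := (h₁.tailBounded hH hg₁).mul_tendsto_zero hH (inv_pos.mpr hv0) hr
  have hall := (((h₁.comp_div hH hw0).trans (hg₁.div_le hH hw0)).add
    ((h₂.comp_div hH hw0).trans (hg₂.div_le hH hw0))).add h3
  refine TailLE.trans (.of_le fun x => ?_) (hall.trans (.of_le fun x => ?_))
  · rw [← hsub]
    exact tail_conv_le w x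
  · have h1 : η / (C + 1) * (g₁ x + g₂ x) ≤ η / (C + 1) * (C * tail H x) :=
      mul_le_mul_of_nonneg_left (hb x) (by positivity)
    have h2 : η / (C + 1) * (C * tail H x) ≤ η * tail H x := by
      have : η / (C + 1) * (C * tail H x) = C / (C + 1) * (η * tail H x) := by ring
      rw [this]
      refine mul_le_of_le_one_left (mul_nonneg hη.le (tail_nonneg _ _)) ?_
      exact (div_le_one (by positivity)).mpr (by linarith)
    nlinarith [mul_le_mul_of_nonneg_right hw2.le (add_nonneg (hg₁.nonneg x) (hg₂.nonneg x))]

end Bounds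

/-- Lower tail bound for a sum of independent variables. -/
theorem TailLE.le_conv {α : ℝ} {H ν₁ ν₂ : Measure ℝ} {g₁ g₂ : ℝ → ℝ}
    [IsProbabilityMeasure ν₁] [IsProbabilityMeasure ν₂]
    (hH : StrongRegVar α H) (hg₁ : TailReg α H g₁) (hg₂ : TailReg α H g₂)
    (hb₁ : TailBounded H ν₁) (hb₂ : TailBounded H ν₂)
    (h₁ : TailLE H g₁ (tail ν₁)) (h₂ : TailLE H g₂ (tail ν₂)) :
    TailLE H (fun x => g₁ x + g₂ x) (tail (Measure.conv ν₁ ν₂)) := by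
  obtain ⟨C, hC, hb⟩ := (hg₁.add hg₂).bdd
  refine .of_forall_error fun η hη => ?_
  obtain ⟨w, hw1, -, hw2⟩ := exists_rpow_near_one α (show 0 < η / (C + 1) by positivity)
  have hw0 : 0 < w := by linarith
  have hwi : 0 < w⁻¹ := inv_pos.mpr hw0
  have hd : Tendsto (fun x : ℝ => -((w - 1) * x)) atTop atBot :=
    tendsto_neg_atTop_atBot.comp (tendsto_id.const_mul_atTop (by linarith))
  have hr : ∀ (ν : Measure ℝ) [IsProbabilityMeasure ν],
      Tendsto (fun x => 1 - tail ν (-((w - 1) * x))) atTop (𝓝 0) := fun ν _ => by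
    have := ((tendsto_tail_atBot ν).comp hd).const_sub 1
    rwa [probReal_univ, sub_self] at this
  have hr2 : Tendsto (fun x => tail ν₂ (x / w⁻¹)) atTop (𝓝 0) :=
    (tendsto_tail_atTop ν₂).comp (tendsto_id.atTop_div_const hwi)
  have e1 := hb₁.mul_tendsto_zero hH hwi (hr ν₂)
  have e2 := hb₂.mul_tendsto_zero hH hwi (hr ν₁)
  have e3 := hb₁.mul_tendsto_zero hH hwi hr2
  have hall := ((((hg₁.le_div hH hwi).trans (h₁.comp_div hH hwi)).add
    ((hg₂.le_div hH hwi).trans (h₂.comp_div hH hwi))))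
  intro ε hε
  filter_upwards [hall (ε / 4) (by positivity), e1 (ε / 4) (by positivity),
    e2 (ε / 4) (by positivity), e3 (ε / 4) (by positivity)] with x k0 k1 k2 k3
  have hx : x / w⁻¹ = x + (w - 1) * x := by rw [div_inv_eq_mul]; ring
  have hlow := le_tail_conv (ν₁ := ν₁) (ν₂ := ν₂) ((w - 1) * x) x
  rw [← hx] at hlow
  have h1 : η / (C + 1) * (g₁ x + g₂ x) ≤ η / (C + 1) * (C * tail H x) :=
    mul_le_mul_of_nonneg_left (hb x) (by positivity)
  have h2 : η / (C + 1) * (C * tail H x) ≤ η * tail H x := by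
    have : η / (C + 1) * (C * tail H x) = C / (C + 1) * (η * tail H x) := by ring
    rw [this]
    refine mul_le_of_le_one_left (mul_nonneg hη.le (tail_nonneg _ _)) ?_
    exact (div_le_one (by positivity)).mpr (by linarith)
  have h3 := mul_le_mul_of_nonneg_right hw2.le (add_nonneg (hg₁.nonneg x) (hg₂.nonneg x))
  have k0' : (w⁻¹) ^ α * g₁ x + (w⁻¹) ^ α * g₂ x ≤
    tail ν₁ (x / w⁻¹) + tail ν₂ (x / w⁻¹) + ε / 4 * tail H x := k0
  linarith


/-! ### The Farlie-Gumbel-Morgenstern law as a mixture of product laws -/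

/-- The law of `ξ₁ ∧ ξ₂` for independent `ξ₁, ξ₂` with law `V`. -/
noncomputable def minLaw (V : Measure ℝ) : Measure ℝ :=
  (V.prod V).map (fun z : ℝ × ℝ => min z.1 z.2)

section MaxMin

variable (V : Measure ℝ) [IsProbabilityMeasure V]

instance : IsProbabilityMeasure (maxLaw V) :=
  Measure.isProbabilityMeasure_map (measurable_fst.max measurable_snd).aemeasurable

instance : IsProbabilityMeasure (minLaw V) :=
  Measure.isProbabilityMeasure_map (measurable_fst.min measurable_snd).aemeasurable

lemma real_Iic_eq (x : ℝ) : V.real (Set.Iic x) = 1 - tail V x := by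
  rw [tail_eq, probReal_univ]; ring

lemma maxLaw_real_Iic (x : ℝ) : (maxLaw V).real (Set.Iic x) = V.real (Set.Iic x) ^ 2 := by
  rw [maxLaw, map_measureReal_apply (measurable_fst.max measurable_snd) measurableSet_Iic, sq,
    ← measureReal_prod_prod]
  congr 1
  ext z
  simp only [Set.mem_preimage, Set.mem_Iic, max_le_iff, Set.mem_prod]

lemma tail_maxLaw (x : ℝ) : tail (maxLaw V) x = 2 * tail V x - tail V x ^ 2 := by
  have h1 := real_Iic_eq (maxLaw V) x
  rw [maxLaw_real_Iic, real_Iic_eq V x] at h1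
  linarith

lemma tail_minLaw (x : ℝ) : tail (minLaw V) x = tail V x ^ 2 := by
  rw [tail, minLaw, map_measureReal_apply (measurable_fst.min measurable_snd) measurableSet_Ioi,
    sq, tail, ← measureReal_prod_prod]
  congr 1
  ext z
  simp

lemma minLaw_real_Iic (x : ℝ) :
    (minLaw V).real (Set.Iic x) = 2 * V.real (Set.Iic x) - V.real (Set.Iic x) ^ 2 := by
  rw [real_Iic_eq, tail_minLaw, real_Iic_eq]; ring

lemma minLaw_add_maxLaw : minLaw V + maxLaw V = V + V := by
  refine Measure.ext_of_Iic _ _ fun x => ?_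
  refine (ENNReal.toReal_eq_toReal_iff' (measure_ne_top _ _) (measure_ne_top _ _)).mp ?_
  change (minLaw V + maxLaw V).real _ = (V + V).real _
  rw [measureReal_add_apply, measureReal_add_apply, minLaw_real_Iic, maxLaw_real_Iic]
  ring

variable {V} in
lemma maxLaw_Iic_eq_zero {x : ℝ} (h : V (Set.Iic x) = 0) : maxLaw V (Set.Iic x) = 0 := by
  rw [← measureReal_eq_zero_iff, maxLaw_real_Iic, Measure.real, h]
  simp

variable {V} in
lemma minLaw_Iic_eq_zero {x : ℝ} (h : V (Set.Iic x) = 0) : minLaw V (Set.Iic x) = 0 := by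
  rw [← measureReal_eq_zero_iff, minLaw_real_Iic, Measure.real, h]
  simp

end MaxMin

section FGM

variable {F G : Measure ℝ} [IsProbabilityMeasure F] [IsProbabilityMeasure G] {θ : ℝ}

/-- The mixture of the four products of the laws of minima and maxima of two independent copies
that constitutes the Farlie-Gumbel-Morgenstern distribution. All weights are nonnegative. -/
noncomputable def fgmMixture (F G : Measure ℝ) (θ : ℝ) : Measure (ℝ × ℝ) :=
  ENNReal.ofReal ((1 + θ) / 4) • ((minLaw F).prod (minLaw G))
    + ENNReal.ofReal ((1 + θ) / 4) • ((maxLaw F).prod (maxLaw G))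
    + ENNReal.ofReal ((1 - θ) / 4) • ((minLaw F).prod (maxLaw G))
    + ENNReal.ofReal ((1 - θ) / 4) • ((maxLaw F).prod (minLaw G))

lemma measureReal_mixture {β : Type*} [MeasurableSpace β] (hθ : θ ∈ Set.Icc (-1 : ℝ) 1)
    (π₁ π₂ π₃ π₄ : Measure β) [IsFiniteMeasure π₁] [IsFiniteMeasure π₂] [IsFiniteMeasure π₃]
    [IsFiniteMeasure π₄] (s : Set β) :
    (ENNReal.ofReal ((1 + θ) / 4) • π₁ + ENNReal.ofReal ((1 + θ) / 4) • π₂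
      + ENNReal.ofReal ((1 - θ) / 4) • π₃ + ENNReal.ofReal ((1 - θ) / 4) • π₄).real s =
      (1 + θ) / 4 * (π₁.real s + π₂.real s) + (1 - θ) / 4 * (π₃.real s + π₄.real s) := by
  have h1 : 0 ≤ (1 + θ) / 4 := by linarith [hθ.1]
  have h2 : 0 ≤ (1 - θ) / 4 := by linarith [hθ.2]
  have hf : ∀ (r : ℝ) (ρ : Measure β) [IsFiniteMeasure ρ], (ENNReal.ofReal r • ρ) s ≠ ⊤ :=
    fun r ρ _ => by
      rw [Measure.smul_apply, smul_eq_mul]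
      exact ENNReal.mul_ne_top ENNReal.ofReal_ne_top (measure_ne_top _ _)
  have e1 := hf ((1 + θ) / 4) π₁
  have e2 := hf ((1 + θ) / 4) π₂
  have e3 := hf ((1 - θ) / 4) π₃
  have e4 := hf ((1 - θ) / 4) π₄
  rw [measureReal_add_apply (ENNReal.add_ne_top.mpr ⟨ENNReal.add_ne_top.mpr ⟨e1, e2⟩, e3⟩) e4,
    measureReal_add_apply (ENNReal.add_ne_top.mpr ⟨e1, e2⟩) e3, measureReal_add_apply e1 e2]
  simp only [measureReal_ennreal_smul_apply, ENNReal.toReal_ofReal h1, ENNReal.toReal_ofReal h2]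
  ring

/-- With `f = F(x)` and `g = G(y)`, the minima and maxima have distribution functions
`2 f - f²` and `f²`, and the mixture evaluates to `f g (1 + θ (1 - f) (1 - g))`. -/
theorem IsFGM.eq_fgmMixture {π : Measure (ℝ × ℝ)} [IsProbabilityMeasure π]
    (hθ : θ ∈ Set.Icc (-1 : ℝ) 1) (hG : G (Set.Iic 0) = 0) (h : IsFGM π F G θ) :
    π = fgmMixture F G θ := by
  have hgen : (Prod.instMeasurableSpace : MeasurableSpace (ℝ × ℝ)) = MeasurableSpace.generateFrom
      (Set.image2 (fun x1 x2 => x1 ×ˢ x2) (Set.range Set.Iic) (Set.range Set.Iic)) := by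
    have hb : MeasurableSpace.generateFrom (Set.range (Set.Iic : ℝ → Set ℝ)) =
        Real.measurableSpace := by
      rw [← borel_eq_generateFrom_Iic, BorelSpace.measurable_eq (α := ℝ)]
    have hs : IsCountablySpanning (Set.range (Set.Iic : ℝ → Set ℝ)) := by
      refine ⟨fun n : ℕ => Set.Iic (n : ℝ), fun n => ⟨n, rfl⟩, ?_⟩
      refine Set.eq_univ_of_forall fun x => Set.mem_iUnion.mpr ?_
      exact exists_nat_ge x
    exact (generateFrom_eq_prod hb hb hs hs).symm
  have hmass : (fgmMixture F G θ).real Set.univ = 1 := by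
    rw [fgmMixture, measureReal_mixture hθ]
    simp only [probReal_univ]
    ring
  have huniv : fgmMixture F G θ Set.univ ≠ ⊤ := fun htop => by
    rw [Measure.real, htop] at hmass
    simp at hmass
  refine ext_of_generate_finite _ hgen (isPiSystem_Iic.prod isPiSystem_Iic) ?_ ?_
  · rintro _ ⟨_, ⟨x, rfl⟩, _, ⟨y, rfl⟩, rfl⟩
    have hfin : fgmMixture F G θ (Set.Iic x ×ˢ Set.Iic y) ≠ ⊤ :=
      ne_top_of_le_ne_top huniv (measure_mono (Set.subset_univ _))
    refine (ENNReal.toReal_eq_toReal_iff' (measure_ne_top _ _) hfin).mp ?_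
    change π.real _ = (fgmMixture F G θ).real _
    rw [fgmMixture, measureReal_mixture hθ]
    simp only [measureReal_prod_prod, minLaw_real_Iic, maxLaw_real_Iic]
    rcases lt_or_ge 0 y with hy | hy
    · rw [h x y hy, show tail F x = 1 - F.real (Set.Iic x) by rw [real_Iic_eq]; ring,
        show tail G y = 1 - G.real (Set.Iic y) by rw [real_Iic_eq]; ring]
      ring
    · have hGy : G.real (Set.Iic y) = 0 := by
        rw [measureReal_eq_zero_iff]
        exact measure_mono_null (Set.Iic_subset_Iic.mpr hy) hG
      -- for `y ≤ 0` the formula is not given, and right continuity at `0` is used instead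
      have hle : ∀ n : ℕ, π.real (Set.Iic x ×ˢ Set.Iic y) ≤
          2 * G.real (Set.Iic (1 / ((n : ℝ) + 1))) := fun n => by
        have hn : (0 : ℝ) < 1 / ((n : ℝ) + 1) := by positivity
        refine (measureReal_mono (Set.prod_mono_right
          (Set.Iic_subset_Iic.mpr (hy.trans hn.le)))).trans ?_
        rw [h x _ hn]
        have f1 := tail_nonneg F x
        have f2 := tail_le_one F x
        have g1 := tail_nonneg G (1 / ((n : ℝ) + 1))
        have g2 := tail_le_one G (1 / ((n : ℝ) + 1))
        have p0 := mul_nonneg f1 g1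
        have p1 : tail F x * tail G (1 / ((n : ℝ) + 1)) ≤ 1 := mul_le_one₀ f2 g1 g2
        have hb : 1 + θ * tail F x * tail G (1 / ((n : ℝ) + 1)) ≤ 2 := by
          rw [mul_assoc]
          nlinarith [hθ.1, hθ.2]
        have hF : F.real (Set.Iic x) ≤ 1 := measureReal_le_one
        have hFG : F.real (Set.Iic x) * G.real (Set.Iic (1 / ((n : ℝ) + 1))) ≤
            G.real (Set.Iic (1 / ((n : ℝ) + 1))) :=
          mul_le_of_le_one_left measureReal_nonneg hF
        have hFG0 : 0 ≤ F.real (Set.Iic x) * G.real (Set.Iic (1 / ((n : ℝ) + 1))) :=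
          mul_nonneg measureReal_nonneg measureReal_nonneg
        nlinarith
      have hlim : Tendsto (fun n : ℕ => 2 * G.real (Set.Iic (1 / ((n : ℝ) + 1)))) atTop
          (𝓝 (2 * cdf G 0)) := by
        simp_rw [← cdf_eq_real]
        refine Tendsto.const_mul 2 ?_
        have hr := (cdf G).right_continuous 0
        have h2 : Tendsto (fun n : ℕ => 1 / ((n : ℝ) + 1)) atTop (𝓝[≥] 0) :=
          tendsto_nhdsWithin_iff.mpr ⟨tendsto_one_div_add_atTop_nhds_zero_nat,
            Eventually.of_forall fun n => by simp only [Set.mem_Ici]; positivity⟩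
        exact hr.tendsto.comp h2
      have h0 := ge_of_tendsto' hlim hle
      have hG0 : G.real (Set.Iic 0) = 0 := by rw [Measure.real, hG, ENNReal.toReal_zero]
      rw [cdf_eq_real, hG0, mul_zero] at h0
      rw [hGy]
      have := measureReal_nonneg (μ := π) (s := Set.Iic x ×ˢ Set.Iic y)
      rw [le_antisymm h0 this]
      ring
  · refine (ENNReal.toReal_eq_toReal_iff' (measure_ne_top _ _) huniv).mp ?_
    exact probReal_univ.trans hmass.symm

/-- The law of `Y (X + Z)` for a pair `(X, Y)` with law `π` and an independent `Z` with law `ν`. -/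
noncomputable def stepLaw (π : Measure (ℝ × ℝ)) (ν : Measure ℝ) : Measure ℝ :=
  (π.prod ν).map (fun q : (ℝ × ℝ) × ℝ => q.1.2 * (q.1.1 + q.2))

lemma measurable_step : Measurable (fun q : (ℝ × ℝ) × ℝ => q.1.2 * (q.1.1 + q.2)) := by
  fun_prop

instance (π : Measure (ℝ × ℝ)) (ν : Measure ℝ) [IsProbabilityMeasure π] [IsProbabilityMeasure ν] :
    IsProbabilityMeasure (stepLaw π ν) :=
  Measure.isProbabilityMeasure_map measurable_step.aemeasurable

lemma stepLaw_prod (F G ν : Measure ℝ) [IsProbabilityMeasure F] [IsProbabilityMeasure G]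
    [IsProbabilityMeasure ν] :
    stepLaw (F.prod G) ν = Measure.mconv G (Measure.conv ν F) := by
  have h1 : (G.prod (ν.prod F)).map (fun q : ℝ × ℝ × ℝ => q.1 * (q.2.1 + q.2.2)) =
      Measure.mconv G (Measure.conv ν F) := by
    rw [Measure.mconv, Measure.conv]
    have hm := Measure.map_prod_map G (ν.prod F) measurable_id
      (g := fun p : ℝ × ℝ => p.1 + p.2) (by fun_prop)
    rw [Measure.map_id] at hm
    rw [hm, Measure.map_map (by fun_prop) (by fun_prop)]
    rfl
  have h2 : (G.prod (ν.prod F)) =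
      ((F.prod G).prod ν).map (fun q : (ℝ × ℝ) × ℝ => (q.1.2, q.2, q.1.1)) := by
    have e1 : (F.prod G).prod ν = ((F.prod (G.prod ν))).map (MeasurableEquiv.prodAssoc).symm :=
      ((measurePreserving_prodAssoc F G ν).symm _).map_eq.symm
    have e2 : (G.prod (ν.prod F)) = ((G.prod ν).prod F).map MeasurableEquiv.prodAssoc :=
      (measurePreserving_prodAssoc G ν F).map_eq.symm
    rw [e1, e2, ← Measure.prod_swap (μ := F), Measure.map_map (by fun_prop) (by fun_prop),
      Measure.map_map (by fun_prop) (by fun_prop)]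
    rfl
  rw [← h1, h2, Measure.map_map (by fun_prop) (by fun_prop), stepLaw]
  simp only [Function.comp_def, add_comm]

lemma tail_stepLaw {π : Measure (ℝ × ℝ)} [IsProbabilityMeasure π]
    (hθ : θ ∈ Set.Icc (-1 : ℝ) 1) (hG : G (Set.Iic 0) = 0) (h : IsFGM π F G θ)
    (ν : Measure ℝ) [IsProbabilityMeasure ν] (x : ℝ) :
    tail (stepLaw π ν) x =
      (1 + θ) / 4 * (tail (Measure.mconv (minLaw G) (Measure.conv ν (minLaw F))) x
        + tail (Measure.mconv (maxLaw G) (Measure.conv ν (maxLaw F))) x)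
      + (1 - θ) / 4 * (tail (Measure.mconv (maxLaw G) (Measure.conv ν (minLaw F))) x
        + tail (Measure.mconv (minLaw G) (Measure.conv ν (maxLaw F))) x) := by
  have hw := measurable_step
  have hfin : ∀ (c : ℝ) (ρ : Measure (ℝ × ℝ)) [IsFiniteMeasure ρ],
      IsFiniteMeasure (ENNReal.ofReal c • ρ) := fun c ρ _ =>
    Measure.smul_finite ρ ENNReal.ofReal_ne_top
  have e : stepLaw π ν = ENNReal.ofReal ((1 + θ) / 4) • stepLaw ((minLaw F).prod (minLaw G)) ν
      + ENNReal.ofReal ((1 + θ) / 4) • stepLaw ((maxLaw F).prod (maxLaw G)) ν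
      + ENNReal.ofReal ((1 - θ) / 4) • stepLaw ((minLaw F).prod (maxLaw G)) ν
      + ENNReal.ofReal ((1 - θ) / 4) • stepLaw ((maxLaw F).prod (minLaw G)) ν := by
    rw [h.eq_fgmMixture hθ hG, fgmMixture]
    simp only [stepLaw, Measure.add_prod, Measure.prod_smul_left, Measure.map_add _ _ hw,
      Measure.map_smul]
  simp only [tail]
  rw [e, measureReal_mixture hθ]
  simp only [stepLaw_prod]

end FGM


/-! ### The tails of the two risks and one step of the recursion -/

lemma StrongRegVar.tailReg_tail {α : ℝ} {H : Measure ℝ} [IsProbabilityMeasure H]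
    (hH : StrongRegVar α H) : TailReg α H (tail H) where
  nonneg := tail_nonneg H
  bdd := ⟨1, zero_le_one, fun x => by rw [one_mul]⟩
  meas := measurable_tail H
  scale w hw := by
    have := (hH.scale w hw).sub_const (w ^ α)
    rw [sub_self] at this
    refine this.congr fun x => ?_
    have := (hH.pos x).ne'
    field_simp

lemma TailReg.zero (α : ℝ) (H : Measure ℝ) : TailReg α H (fun _ => 0) where
  nonneg _ := le_rfl
  bdd := ⟨0, le_rfl, fun x => by rw [zero_mul]⟩
  meas := measurable_const
  scale w _ := by simp

/-- The equally weighted mixture of `F` and `G`, whose tail is the reference scale. -/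
noncomputable def halfMix (F G : Measure ℝ) : Measure ℝ :=
  ENNReal.ofReal (1 / 2) • F + ENNReal.ofReal (1 - 1 / 2) • G

/-- The asymptotic regularity of the two risks that the assumption on convex combinations
provides. -/
structure RiskTails (α : ℝ) (F G : Measure ℝ) : Prop where
  strong : StrongRegVar α (halfMix F G)
  regF : TailReg α (halfMix F G) (tail F)
  regG : TailReg α (halfMix F G) (tail G)

lemma TailReg.comb {α : ℝ} {F G : Measure ℝ} (R : RiskTails α F G) {a b : ℝ} (ha : 0 ≤ a)
    (hb : 0 ≤ b) : TailReg α (halfMix F G) (fun x => a * tail F x + b * tail G x) :=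
  (R.regF.const_mul ha).add (R.regG.const_mul hb)

section

variable {α θ : ℝ} {F G : Measure ℝ} [IsProbabilityMeasure F] [IsProbabilityMeasure G]

lemma convexComb_real {p : ℝ} (h0 : 0 ≤ p) (h1 : p ≤ 1) (s : Set ℝ) :
    (ENNReal.ofReal p • F + ENNReal.ofReal (1 - p) • G).real s =
      p * F.real s + (1 - p) * G.real s := by
  have hf : ∀ (r : ℝ) (ρ : Measure ℝ) [IsFiniteMeasure ρ], (ENNReal.ofReal r • ρ) s ≠ ⊤ :=
    fun r ρ _ => by
      rw [Measure.smul_apply, smul_eq_mul]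
      exact ENNReal.mul_ne_top ENNReal.ofReal_ne_top (measure_ne_top _ _)
  rw [measureReal_add_apply (hf _ _) (hf _ _), measureReal_ennreal_smul_apply,
    measureReal_ennreal_smul_apply, ENNReal.toReal_ofReal h0,
    ENNReal.toReal_ofReal (sub_nonneg.mpr h1)]

lemma convexComb_prob {p : ℝ} (h0 : 0 ≤ p) (h1 : p ≤ 1) :
    IsProbabilityMeasure (ENNReal.ofReal p • F + ENNReal.ofReal (1 - p) • G) := by
  refine ⟨?_⟩
  rw [Measure.add_apply, Measure.smul_apply, Measure.smul_apply, measure_univ, measure_univ,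
    smul_eq_mul, smul_eq_mul, mul_one, mul_one, ← ENNReal.ofReal_add h0 (sub_nonneg.mpr h1)]
  simp

instance : IsProbabilityMeasure (halfMix F G) := convexComb_prob (by norm_num) (by norm_num)

lemma tail_halfMix (x : ℝ) : tail (halfMix F G) x = 1 / 2 * tail F x + 1 / 2 * tail G x := by
  rw [tail, halfMix, convexComb_real (by norm_num) (by norm_num), tail, tail]
  norm_num

/-- `F̄` and `Ḡ` are linear combinations of the tails of two different convex combinations of `F`
and `G`, each of which is regularly varying. -/
theorem ConvexCombStronglyRegVarying.riskTails (hα : 0 ≤ α)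
    (h : ConvexCombStronglyRegVarying α F G) : RiskTails α F G := by
  have hH : StrongRegVar α (halfMix F G) :=
    IsStronglyRegVarying.strongRegVar hα (h (1 / 2) (by norm_num) (by norm_num))
  set K := ENNReal.ofReal (3 / 4) • F + ENNReal.ofReal (1 - 3 / 4) • G with hK
  have : IsProbabilityMeasure K := convexComb_prob (by norm_num) (by norm_num)
  have hKr : StrongRegVar α K :=
    IsStronglyRegVarying.strongRegVar hα (h (3 / 4) (by norm_num) (by norm_num))
  have hKt : ∀ x, tail K x = 3 / 4 * tail F x + 1 / 4 * tail G x := fun x => by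
    rw [tail, hK, convexComb_real (by norm_num) (by norm_num), tail, tail]
    norm_num
  have hHt := tail_halfMix (F := F) (G := G)
  have sK : ∀ w, 0 < w → Tendsto (fun x => (tail K (x / w) - w ^ α * tail K x) /
      tail (halfMix F G) x) atTop (𝓝 0) := fun w hw => by
    have h1 := (hKr.tailReg_tail.scale w hw).norm.mul_const (3 / 2)
    rw [norm_zero, zero_mul] at h1
    refine squeeze_zero_norm (fun x => ?_) h1
    rw [norm_div, norm_div, Real.norm_of_nonneg (hKr.pos x).le, Real.norm_of_nonneg (hH.pos x).le,
      div_mul_eq_mul_div, div_le_div_iff₀ (hH.pos x) (hKr.pos x), mul_assoc]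
    refine mul_le_mul_of_nonneg_left ?_ (norm_nonneg _)
    rw [hKt, hHt]
    linarith [tail_nonneg G x]
  have sH := hH.tailReg_tail.scale
  have reg : ∀ (g : ℝ → ℝ) (a b : ℝ), Measurable g → (∀ x, 0 ≤ g x) →
      (∀ x, g x ≤ 2 * tail (halfMix F G) x) →
      (∀ x, g x = a * tail (halfMix F G) x + b * tail K x) → TailReg α (halfMix F G) g := by
    intro g a b hm h0 h2 heq
    refine ⟨h0, ⟨2, by norm_num, h2⟩, hm, fun w hw => ?_⟩
    have := ((sH w hw).const_mul a).add ((sK w hw).const_mul b)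
    rw [mul_zero, mul_zero, add_zero] at this
    refine this.congr fun x => ?_
    rw [heq, heq]
    ring
  refine ⟨hH, reg _ (-1) 2 (measurable_tail F) (tail_nonneg F) (fun x => ?_) fun x => ?_,
    reg _ 3 (-2) (measurable_tail G) (tail_nonneg G) (fun x => ?_) fun x => ?_⟩
  · rw [hHt]; linarith [tail_nonneg G x]
  · rw [hHt, hKt]; ring
  · rw [hHt]; linarith [tail_nonneg F x]
  · rw [hHt, hKt]; ring

lemma TailBounded.conv {H ν₁ ν₂ : Measure ℝ} [IsProbabilityMeasure H] [IsProbabilityMeasure ν₁]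
    [IsProbabilityMeasure ν₂] (hH : StrongRegVar α H) (h₁ : TailBounded H ν₁)
    (h₂ : TailBounded H ν₂) : TailBounded H (Measure.conv ν₁ ν₂) := by
  obtain ⟨C₁, hC₁, hb₁⟩ := h₁
  obtain ⟨C₂, hC₂, hb₂⟩ := h₂
  have r₁ := hH.tailReg_tail.const_mul hC₁
  have r₂ := hH.tailReg_tail.const_mul hC₂
  exact (TailLE.conv hH r₁ r₂ (.of_le hb₁) (.of_le hb₂)).tailBounded hH (r₁.add r₂)

lemma RiskTails.boundedF (_R : RiskTails α F G) : TailBounded (halfMix F G) F :=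
  ⟨2, by norm_num, fun x => by rw [tail_halfMix]; linarith [tail_nonneg G x]⟩

lemma RiskTails.boundedG (_R : RiskTails α F G) : TailBounded (halfMix F G) G :=
  ⟨2, by norm_num, fun x => by rw [tail_halfMix]; linarith [tail_nonneg F x]⟩

section MaxMinTails

variable {H V : Measure ℝ} [IsProbabilityMeasure V]

lemma TailBounded.maxLaw (h : TailBounded H V) : TailBounded H (maxLaw V) := by
  obtain ⟨C, hC, hb⟩ := h
  refine ⟨2 * C, by positivity, fun x => ?_⟩
  rw [tail_maxLaw]
  nlinarith [hb x, sq_nonneg (tail V x)]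

lemma TailBounded.minLaw (h : TailBounded H V) : TailBounded H (minLaw V) := by
  obtain ⟨C, hC, hb⟩ := h
  refine ⟨C, hC, fun x => ?_⟩
  rw [tail_minLaw]
  nlinarith [hb x, tail_nonneg V x, tail_le_one V x]

lemma TailBounded.sq_negligible (hH : StrongRegVar α H) (h : TailBounded H V) :
    TailLE H (fun x => tail V x ^ 2) (fun _ => 0) := by
  have := h.mul_tendsto_zero hH one_pos (tendsto_tail_atTop V)
  simpa only [div_one, ← sq] using this

lemma tailLE_maxLaw : TailLE H (tail (RiskModel.maxLaw V)) (fun x => 2 * tail V x) :=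
  .of_le fun x => by rw [tail_maxLaw]; linarith [sq_nonneg (tail V x)]

lemma le_tailLE_maxLaw (hH : StrongRegVar α H) (h : TailBounded H V) :
    TailLE H (fun x => 2 * tail V x) (tail (RiskModel.maxLaw V)) := by
  refine TailLE.trans (.of_le fun x => le_of_eq ?_)
    (((TailLE.of_le (H := H) (f := tail (RiskModel.maxLaw V)) fun _ => le_rfl).add
      (h.sq_negligible hH)).trans (.of_le fun x => le_of_eq (add_zero _)))
  rw [tail_maxLaw]
  ring

lemma tailLE_minLaw (hH : StrongRegVar α H) (h : TailBounded H V) :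
    TailLE H (tail (RiskModel.minLaw V)) (fun _ => 0) :=
  TailLE.trans (.of_le fun x => (tail_minLaw V x).le) (h.sq_negligible hH)

end MaxMinTails

lemma posMoment_add {μ ν : Measure ℝ} (hμ : FinitePosMoment α μ) (hν : FinitePosMoment α ν) :
    posMoment α (μ + ν) = posMoment α μ + posMoment α ν := by
  rw [posMoment, Measure.restrict_add, integral_add_measure hμ hν]
  rfl

lemma posMoment_minLaw_add_maxLaw {H V : Measure ℝ} [IsProbabilityMeasure H]
    [IsProbabilityMeasure V] (hα : 0 ≤ α) (hH : StrongRegVar α H) (h : TailBounded H V) :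
    posMoment α (minLaw V) + posMoment α (maxLaw V) = 2 * posMoment α V := by
  rw [← posMoment_add (h.minLaw.finitePosMoment hα hH) (h.maxLaw.finitePosMoment hα hH),
    minLaw_add_maxLaw, posMoment_add (h.finitePosMoment hα hH) (h.finitePosMoment hα hH), two_mul]

lemma posMoment_conv_minLaw_add_maxLaw {H V ν : Measure ℝ} [IsProbabilityMeasure H]
    [IsProbabilityMeasure V] [IsProbabilityMeasure ν] (hα : 0 ≤ α) (hH : StrongRegVar α H)
    (h : TailBounded H V) (hν : TailBounded H ν) :
    posMoment α (Measure.conv ν (minLaw V)) + posMoment α (Measure.conv ν (maxLaw V)) =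
      2 * posMoment α (Measure.conv ν V) := by
  rw [← posMoment_add ((hν.conv hH h.minLaw).finitePosMoment hα hH)
      ((hν.conv hH h.maxLaw).finitePosMoment hα hH), ← Measure.conv_add, minLaw_add_maxLaw,
    Measure.conv_add, posMoment_add ((hν.conv hH h).finitePosMoment hα hH)
    ((hν.conv hH h).finitePosMoment hα hH), two_mul]

/-- `(1 - θ) E (Z + X)₊^α + θ E (Z + X̌)₊^α` for independent variables, in terms of the law `ν` of
`Z`. -/
noncomputable def stepCoeff (θ α : ℝ) (F ν : Measure ℝ) : ℝ :=
  (1 - θ) * posMoment α (Measure.conv ν F) + θ * posMoment α (Measure.conv ν (maxLaw F))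

variable {π : Measure (ℝ × ℝ)} [IsProbabilityMeasure π] {ν : Measure ℝ} [IsProbabilityMeasure ν]

/-- The coefficient of `Ḡ` as a combination with nonnegative weights. -/
lemma stepCoeff_eq (hα : 0 ≤ α) (R : RiskTails α F G) (hν : TailBounded (halfMix F G) ν) :
    stepCoeff θ α F ν = (1 - θ) / 2 * posMoment α (Measure.conv ν (minLaw F))
      + (1 + θ) / 2 * posMoment α (Measure.conv ν (maxLaw F)) := by
  have := posMoment_conv_minLaw_add_maxLaw hα R.strong R.boundedF hν
  rw [stepCoeff]
  linear_combination (1 - θ) / 2 * (-this)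

lemma coeffY_eq (hα : 0 ≤ α) (R : RiskTails α F G) :
    coeffY θ α G = (1 - θ) / 2 * posMoment α (minLaw G) + (1 + θ) / 2 * posMoment α (maxLaw G) := by
  have := posMoment_minLaw_add_maxLaw hα R.strong R.boundedG
  rw [coeffY]
  linear_combination (1 - θ) / 2 * (-this)

lemma stepCoeff_nonneg (hα : 0 ≤ α) (R : RiskTails α F G) (hθ : θ ∈ Set.Icc (-1 : ℝ) 1)
    (hν : TailBounded (halfMix F G) ν) : 0 ≤ stepCoeff θ α F ν := by
  rw [stepCoeff_eq hα R hν]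
  have h1 := posMoment_nonneg α (Measure.conv ν (minLaw F))
  have h2 := posMoment_nonneg α (Measure.conv ν (maxLaw F))
  have := mul_nonneg (show 0 ≤ (1 - θ) / 2 by linarith [hθ.2]) h1
  have := mul_nonneg (show 0 ≤ (1 + θ) / 2 by linarith [hθ.1]) h2
  linarith

lemma coeffY_nonneg (hα : 0 ≤ α) (R : RiskTails α F G) (hθ : θ ∈ Set.Icc (-1 : ℝ) 1) :
    0 ≤ coeffY θ α G := by
  rw [coeffY_eq hα R]
  have h1 := posMoment_nonneg α (minLaw G)
  have h2 := posMoment_nonneg α (maxLaw G)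
  have := mul_nonneg (show 0 ≤ (1 - θ) / 2 by linarith [hθ.2]) h1
  have := mul_nonneg (show 0 ≤ (1 + θ) / 2 by linarith [hθ.1]) h2
  linarith

/-- The action of one step of the recursion on the coefficients of an upper tail bound. -/
theorem TailLE.stepLaw (hα : 0 ≤ α) (R : RiskTails α F G) (hθ : θ ∈ Set.Icc (-1 : ℝ) 1)
    (hG : G (Set.Iic 0) = 0) (hπ : IsFGM π F G θ) {a b : ℝ} (ha : 0 ≤ a) (hb : 0 ≤ b)
    (h : TailLE (halfMix F G) (tail ν) (fun x => a * tail F x + b * tail G x)) :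
    TailLE (halfMix F G) (tail (stepLaw π ν)) (fun x =>
      (coeffY θ α G + posMoment α G * a) * tail F x
        + (stepCoeff θ α F ν + posMoment α G * b) * tail G x) := by
  have hH := R.strong
  have hν := h.tailBounded hH (TailReg.comb R ha hb)
  have hr := TailReg.comb R ha hb
  have cmin := TailLE.conv hH hr (TailReg.zero α _) h (tailLE_minLaw hH R.boundedF)
  have cmax := TailLE.conv hH hr (R.regF.const_mul zero_le_two) h tailLE_maxLaw
  have rmin := hr.add (TailReg.zero α (halfMix F G))
  have rmax := hr.add (R.regF.const_mul zero_le_two)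
  have zG := TailReg.zero α (halfMix F G)
  have rG := R.regG.const_mul zero_le_two
  have lG := tailLE_minLaw hH R.boundedG
  have uG : TailLE (halfMix F G) (tail (maxLaw G)) (fun x => 2 * tail G x) := tailLE_maxLaw
  have t1 := TailLE.mconv hα hH (minLaw_Iic_eq_zero hG) zG rmin lG cmin
  have t2 := TailLE.mconv hα hH (maxLaw_Iic_eq_zero hG) rG rmax uG cmax
  have t3 := TailLE.mconv hα hH (maxLaw_Iic_eq_zero hG) rG rmin uG cmin
  have t4 := TailLE.mconv hα hH (minLaw_Iic_eq_zero hG) zG rmax lG cmax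
  have hall := ((t1.add t2).const_mul (show 0 ≤ (1 + θ) / 4 by linarith [hθ.1])).add
    ((t3.add t4).const_mul (show 0 ≤ (1 - θ) / 4 by linarith [hθ.2]))
  refine TailLE.trans (.of_le fun x => (tail_stepLaw hθ hG hπ ν x).le)
    (hall.trans (.of_le fun x => le_of_eq ?_))
  have e1 := posMoment_minLaw_add_maxLaw hα hH R.boundedG
  rw [stepCoeff_eq hα R hν, coeffY_eq hα R]
  linear_combination (1 / 2 * (a * tail F x + b * tail G x)) * e1

/-- The action of one step of the recursion on the coefficients of a lower tail bound. -/
theorem TailLE.le_stepLaw (hα : 0 ≤ α) (R : RiskTails α F G) (hθ : θ ∈ Set.Icc (-1 : ℝ) 1)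
    (hG : G (Set.Iic 0) = 0) (hπ : IsFGM π F G θ) {a b : ℝ} (ha : 0 ≤ a) (hb : 0 ≤ b)
    (hν : TailBounded (halfMix F G) ν)
    (h : TailLE (halfMix F G) (fun x => a * tail F x + b * tail G x) (tail ν)) :
    TailLE (halfMix F G) (fun x => (coeffY θ α G + posMoment α G * a) * tail F x
        + (stepCoeff θ α F ν + posMoment α G * b) * tail G x) (tail (RiskModel.stepLaw π ν)) := by
  have hH := R.strong
  have hr := TailReg.comb R ha hb
  have bF := R.boundedF
  have bG := R.boundedG
  have zero_le : ∀ V : Measure ℝ, TailLE (halfMix F G) (fun _ => 0) (tail V) :=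
    fun V => .of_le (tail_nonneg V)
  have cmin := TailLE.le_conv hH hr (TailReg.zero α _) hν bF.minLaw h (zero_le (minLaw F))
  have cmax := TailLE.le_conv hH hr (R.regF.const_mul zero_le_two) hν bF.maxLaw h
    (le_tailLE_maxLaw hH bF)
  have rmin := hr.add (TailReg.zero α (halfMix F G))
  have rmax := hr.add (R.regF.const_mul zero_le_two)
  have zG := TailReg.zero α (halfMix F G)
  have rG := R.regG.const_mul zero_le_two
  have lG := zero_le (minLaw G)
  have uG := le_tailLE_maxLaw hH bG
  have bmin := hν.conv hH bF.minLaw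
  have bmax := hν.conv hH bF.maxLaw
  have t1 := TailLE.le_mconv hα hH (minLaw_Iic_eq_zero hG) zG rmin bG.minLaw bmin lG cmin
  have t2 := TailLE.le_mconv hα hH (maxLaw_Iic_eq_zero hG) rG rmax bG.maxLaw bmax uG cmax
  have t3 := TailLE.le_mconv hα hH (maxLaw_Iic_eq_zero hG) rG rmin bG.maxLaw bmin uG cmin
  have t4 := TailLE.le_mconv hα hH (minLaw_Iic_eq_zero hG) zG rmax bG.minLaw bmax lG cmax
  have hall := ((t1.add t2).const_mul (show 0 ≤ (1 + θ) / 4 by linarith [hθ.1])).add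
    ((t3.add t4).const_mul (show 0 ≤ (1 - θ) / 4 by linarith [hθ.2]))
  refine TailLE.trans (.of_le fun x => le_of_eq ?_)
    (hall.trans (.of_le fun x => (tail_stepLaw hθ hG hπ ν x).ge))
  have e1 := posMoment_minLaw_add_maxLaw hα hH bG
  rw [stepCoeff_eq hα R hν, coeffY_eq hα R]
  linear_combination (-(1 / 2 * (a * tail F x + b * tail G x))) * e1

end


section

variable {α θ : ℝ} {F G : Measure ℝ} [IsProbabilityMeasure F] [IsProbabilityMeasure G]
  {π : Measure (ℝ × ℝ)} [IsProbabilityMeasure π] {ν : Measure ℝ} [IsProbabilityMeasure ν]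

/-! ### Marginals and positivity -/

lemma IsFGM.real_eq (hθ : θ ∈ Set.Icc (-1 : ℝ) 1) (hG : G (Set.Iic 0) = 0) (hπ : IsFGM π F G θ)
    (s t : Set ℝ) : π.real (s ×ˢ t) =
      (1 + θ) / 4 * ((minLaw F).real s * (minLaw G).real t + (maxLaw F).real s * (maxLaw G).real t)
      + (1 - θ) / 4 *
        ((minLaw F).real s * (maxLaw G).real t + (maxLaw F).real s * (minLaw G).real t) := by
  rw [hπ.eq_fgmMixture hθ hG, fgmMixture, measureReal_mixture hθ]
  simp only [measureReal_prod_prod]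

lemma minLaw_real_add_maxLaw_real (V : Measure ℝ) [IsProbabilityMeasure V] (s : Set ℝ) :
    (minLaw V).real s + (maxLaw V).real s = 2 * V.real s := by
  rw [← measureReal_add_apply, minLaw_add_maxLaw, measureReal_add_apply, two_mul]

lemma IsFGM.map_fst (hθ : θ ∈ Set.Icc (-1 : ℝ) 1) (hG : G (Set.Iic 0) = 0)
    (hπ : IsFGM π F G θ) : π.map Prod.fst = F := by
  have : IsProbabilityMeasure (π.map Prod.fst) :=
    Measure.isProbabilityMeasure_map measurable_fst.aemeasurable
  ext s hs
  refine (ENNReal.toReal_eq_toReal_iff' (measure_ne_top _ _) (measure_ne_top _ _)).mp ?_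
  change (π.map Prod.fst).real s = F.real s
  rw [map_measureReal_apply measurable_fst hs, ← Set.prod_univ, hπ.real_eq hθ hG]
  simp only [probReal_univ]
  linear_combination 1 / 2 * minLaw_real_add_maxLaw_real F s

lemma IsFGM.map_snd (hθ : θ ∈ Set.Icc (-1 : ℝ) 1) (hG : G (Set.Iic 0) = 0)
    (hπ : IsFGM π F G θ) : π.map Prod.snd = G := by
  have : IsProbabilityMeasure (π.map Prod.snd) :=
    Measure.isProbabilityMeasure_map measurable_snd.aemeasurable
  ext s hs
  refine (ENNReal.toReal_eq_toReal_iff' (measure_ne_top _ _) (measure_ne_top _ _)).mp ?_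
  change (π.map Prod.snd).real s = G.real s
  rw [map_measureReal_apply measurable_snd hs, ← Set.univ_prod, hπ.real_eq hθ hG]
  simp only [probReal_univ]
  linear_combination 1 / 2 * minLaw_real_add_maxLaw_real G s

lemma IsFGM.ae_snd_pos (hθ : θ ∈ Set.Icc (-1 : ℝ) 1) (hG : G (Set.Iic 0) = 0)
    (hπ : IsFGM π F G θ) : ∀ᵐ p ∂π, 0 < p.2 := by
  have : ∀ᵐ y ∂(π.map Prod.snd), 0 < y := by
    rw [hπ.map_snd hθ hG, ae_iff]
    exact measure_mono_null (fun y hy => not_lt.mp hy) hG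
  exact ae_of_ae_map measurable_snd.aemeasurable this

lemma IsFGM.rect_pos (hθ : θ ∈ Set.Icc (-1 : ℝ) 1) (hG : G (Set.Iic 0) = 0)
    (hπ : IsFGM π F G θ) {a b : ℝ} (ha : 0 < tail F a) (hb : 0 < G.real (Set.Iic b)) :
    0 < π.real (Set.Ioi a ×ˢ Set.Iic b) := by
  rw [hπ.real_eq hθ hG]
  have h1 : 0 < (maxLaw F).real (Set.Ioi a) := by
    have := tail_maxLaw F a
    rw [tail] at this
    rw [this]
    nlinarith [tail_le_one F a]
  have h2 : 0 < (maxLaw G).real (Set.Iic b) := by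
    rw [maxLaw_real_Iic]; positivity
  have h3 : 0 < (minLaw G).real (Set.Iic b) := by
    rw [minLaw_real_Iic]
    have : G.real (Set.Iic b) ≤ 1 := measureReal_le_one
    nlinarith
  have h0 : 0 ≤ (minLaw F).real (Set.Ioi a) := measureReal_nonneg
  have k1 : 0 ≤ (minLaw F).real (Set.Ioi a) * (minLaw G).real (Set.Iic b) := by positivity
  have k2 : 0 < (maxLaw F).real (Set.Ioi a) * (maxLaw G).real (Set.Iic b) := by positivity
  have k3 : 0 ≤ (minLaw F).real (Set.Ioi a) * (maxLaw G).real (Set.Iic b) := by positivity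
  have k4 : 0 < (maxLaw F).real (Set.Ioi a) * (minLaw G).real (Set.Iic b) := by positivity
  rcases le_total θ 0 with h | h
  · have e1 := mul_nonneg (show 0 ≤ (1 + θ) / 4 by linarith [hθ.1]) (add_nonneg k1 k2.le)
    have e2 := mul_pos (show 0 < (1 - θ) / 4 by linarith) (add_pos_of_nonneg_of_pos k3 k4)
    linarith
  · have e1 := mul_pos (show 0 < (1 + θ) / 4 by linarith) (add_pos_of_nonneg_of_pos k1 k2)
    have e2 := mul_nonneg (show 0 ≤ (1 - θ) / 4 by linarith [hθ.2]) (add_nonneg k3 k4.le)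
    linarith

/-- If each of `Z ≥ -s`, `X > a` and `Y ≤ b` has positive probability, then so has
`Y (X + Z) ≥ -b (s - a)₊`. -/
lemma stepLaw_Ici_pos (hθ : θ ∈ Set.Icc (-1 : ℝ) 1) (hG : G (Set.Iic 0) = 0)
    (hπ : IsFGM π F G θ) {a b s : ℝ} (ha : 0 < tail F a) (hb : 0 < G.real (Set.Iic b))
    (hs : 0 < ν.real (Set.Ici (-s))) :
    0 < (stepLaw π ν).real (Set.Ici (-(b * max (s - a) 0))) := by
  have hpos : 0 < (π.prod ν).real ((Set.Ioi a ×ˢ Set.Iic b) ×ˢ Set.Ici (-s)) := by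
    rw [measureReal_prod_prod]
    exact mul_pos (hπ.rect_pos hθ hG ha hb) hs
  refine hpos.trans_le ?_
  rw [stepLaw, map_measureReal_apply measurable_step measurableSet_Ici]
  refine ENNReal.toReal_mono (measure_ne_top _ _) (measure_mono_ae ?_)
  have hae : ∀ᵐ q ∂(π.prod ν), 0 < q.1.2 :=
    Measure.quasiMeasurePreserving_fst.ae (hπ.ae_snd_pos hθ hG)
  filter_upwards [hae] with q hq hmem
  obtain ⟨⟨h1, h2⟩, h3⟩ := hmem
  have h1 : a < q.1.1 := h1
  have h2 : q.1.2 ≤ b := h2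
  have h3 : -s ≤ q.2 := h3
  have h4 : -max (s - a) 0 ≤ q.1.1 + q.2 := by linarith [le_max_left (s - a) 0]
  have h5 := mul_le_mul_of_nonneg_left h4 hq.le
  have h6 := mul_le_mul_of_nonneg_right h2 (le_max_right (s - a) 0)
  exact show -(b * max (s - a) 0) ≤ q.1.2 * (q.1.1 + q.2) by linarith

lemma stepLaw_Ici_zero_pos (hθ : θ ∈ Set.Icc (-1 : ℝ) 1) (hG : G (Set.Iic 0) = 0)
    (hπ : IsFGM π F G θ) (hF : 0 < tail F 0) (hν : 0 < ν.real (Set.Ici 0)) :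
    0 < (stepLaw π ν).real (Set.Ici 0) := by
  obtain ⟨b, hb⟩ : ∃ b, 0 < G.real (Set.Iic b) := by
    obtain ⟨b, hb⟩ := ((tendsto_tail_atTop G).eventually (gt_mem_nhds one_pos)).exists
    exact ⟨b, by rw [real_Iic_eq]; linarith⟩
  have := stepLaw_Ici_pos (s := 0) (ν := ν) hθ hG hπ hF hb (by rwa [neg_zero])
  simpa using this

/-- For a fixed point of the recursion the half-line `[0, ∞)` is charged, because each step with
`X > a` and `Y ≤ 1` moves the value up by `a` as long as it is negative. -/
lemma fixedPoint_Ici_zero_pos (hα : 0 ≤ α) (R : RiskTails α F G) (hθ : θ ∈ Set.Icc (-1 : ℝ) 1)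
    (hG : G (Set.Iic 0) = 0) (hπ : IsFGM π F G θ) (hμ : posMoment α G < 1) (hF : 0 < tail F 0)
    (hfix : ν = stepLaw π ν) : 0 < ν.real (Set.Ici 0) := by
  have hb : 0 < G.real (Set.Iic 1) := by
    refine lt_of_le_of_ne measureReal_nonneg fun h0 => not_le.mpr hμ ?_
    have h1 : tail G 1 = 1 := by
      have := real_Iic_eq G 1
      linarith
    have hfin := R.boundedG.finitePosMoment hα R.strong
    calc (1 : ℝ) = ∫ _ in Set.Ioi (1 : ℝ), (1 : ℝ) ∂G := by
          rw [setIntegral_const, smul_eq_mul, mul_one]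
          exact h1.symm
      _ ≤ ∫ z in Set.Ioi (1 : ℝ), z ^ α ∂G := by
          refine setIntegral_mono_on (integrable_const _).integrableOn
            (hfin.mono_set (Set.Ioi_subset_Ioi zero_le_one)) measurableSet_Ioi fun z hz => ?_
          exact Real.one_le_rpow (le_of_lt hz) hα
      _ ≤ posMoment α G := by
          refine setIntegral_mono_set hfin ?_ (Set.Ioi_subset_Ioi zero_le_one).eventuallyLE
          rw [EventuallyLE, ae_restrict_iff' measurableSet_Ioi]
          exact ae_of_all _ fun z hz => Real.rpow_nonneg (le_of_lt hz) _
  obtain ⟨a, ha0, ha⟩ : ∃ a, 0 < a ∧ 0 < tail F a := by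
    by_contra! hcon
    have hle : ∀ n : ℕ, 1 ≤ cdf F (1 / ((n : ℝ) + 1)) := fun n => by
      rw [cdf_eq_real, real_Iic_eq]
      linarith [hcon (1 / ((n : ℝ) + 1)) (by positivity)]
    have h2 : Tendsto (fun n : ℕ => 1 / ((n : ℝ) + 1)) atTop (𝓝[≥] 0) :=
      tendsto_nhdsWithin_iff.mpr ⟨tendsto_one_div_add_atTop_nhds_zero_nat,
        Eventually.of_forall fun n => by simp only [Set.mem_Ici]; positivity⟩
    have h3 := ge_of_tendsto' (((cdf F).right_continuous 0).tendsto.comp h2) hle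
    rw [cdf_eq_real, real_Iic_eq] at h3
    linarith
  obtain ⟨s, hs⟩ : ∃ s, 0 < ν.real (Set.Ici (-s)) := by
    have h1 := tendsto_tail_atBot ν
    rw [probReal_univ] at h1
    obtain ⟨t, ht⟩ := (h1.eventually (lt_mem_nhds one_pos)).exists
    exact ⟨-t, by rw [neg_neg]; exact ht.trans_le (measureReal_mono Set.Ioi_subset_Ici_self)⟩
  have hiter : ∀ n : ℕ, 0 < ν.real (Set.Ici (-(max (s - n * a) 0))) := by
    intro n
    induction n with
    | zero =>
      refine hs.trans_le (measureReal_mono (Set.Ici_subset_Ici.mpr ?_))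
      simp
    | succ n ih =>
      have h := stepLaw_Ici_pos hθ hG hπ ha hb ih
      rw [← hfix, one_mul] at h
      convert h using 4
      push_cast
      rcases le_total (s - n * a) 0 with h0 | h0
      · rw [max_eq_right h0, max_eq_right (by linarith), max_eq_right (by linarith)]
      · rw [max_eq_left h0]
        congr 1
        ring
  obtain ⟨n, hn⟩ := exists_nat_ge (s / a)
  have := hiter n
  rw [div_le_iff₀ ha0] at hn
  rwa [max_eq_right (by linarith), neg_zero] at this

lemma stepCoeff_pos (hα : 0 ≤ α) (R : RiskTails α F G) (hθ : θ ∈ Set.Icc (-1 : ℝ) 1)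
    (hF : 0 < tail F 0) (hν : TailBounded (halfMix F G) ν) (hν0 : 0 < ν.real (Set.Ici 0)) :
    0 < stepCoeff θ α F ν := by
  have key : ∀ (V : Measure ℝ) [IsProbabilityMeasure V], TailBounded (halfMix F G) V →
      0 < tail V 0 → 0 < posMoment α (Measure.conv ν V) := fun V _ hV hV0 => by
    refine posMoment_pos_of_tail_pos ((hν.conv R.strong hV).finitePosMoment hα R.strong) ?_
    have : 0 < (ν.prod V).real (Set.Ici 0 ×ˢ Set.Ioi 0) := by
      rw [measureReal_prod_prod]
      exact mul_pos hν0 hV0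
    refine this.trans_le ?_
    rw [tail, Measure.conv, map_measureReal_apply (by fun_prop) measurableSet_Ioi]
    exact measureReal_mono fun p hp =>
      show 0 < p.1 + p.2 from add_pos_of_nonneg_of_pos hp.1 hp.2
  have h1 := key (minLaw F) R.boundedF.minLaw (by rw [tail_minLaw]; positivity)
  have h2 := key (maxLaw F) R.boundedF.maxLaw (by
    rw [tail_maxLaw]; nlinarith [tail_le_one F 0])
  rw [stepCoeff_eq hα R hν]
  rcases le_total θ 0 with h | h
  · have e1 := mul_pos (show 0 < (1 - θ) / 2 by linarith) h1
    have e2 := mul_nonneg (show 0 ≤ (1 + θ) / 2 by linarith [hθ.1]) h2.le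
    linarith
  · have e1 := mul_nonneg (show 0 ≤ (1 - θ) / 2 by linarith [hθ.2]) h1.le
    have e2 := mul_pos (show 0 < (1 + θ) / 2 by linarith) h2
    linarith

lemma tail_zero_eq_one (hG : G (Set.Iic 0) = 0) : tail G 0 = 1 := by
  rw [tail_eq, probReal_univ, Measure.real, hG, ENNReal.toReal_zero, sub_zero]

lemma coeffY_pos (hα : 0 ≤ α) (R : RiskTails α F G) (hθ : θ ∈ Set.Icc (-1 : ℝ) 1)
    (hG : G (Set.Iic 0) = 0) : 0 < coeffY θ α G := by
  have hH := R.strong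
  have h1 := posMoment_pos_of_tail_pos (R.boundedG.minLaw.finitePosMoment hα hH)
    (by rw [tail_minLaw, tail_zero_eq_one hG]; norm_num)
  have h2 := posMoment_pos_of_tail_pos (R.boundedG.maxLaw.finitePosMoment hα hH)
    (by rw [tail_maxLaw, tail_zero_eq_one hG]; norm_num)
  rw [coeffY_eq hα R]
  rcases le_total θ 0 with h | h
  · have e1 := mul_pos (show 0 < (1 - θ) / 2 by linarith) h1
    have e2 := mul_nonneg (show 0 ≤ (1 + θ) / 2 by linarith [hθ.1]) h2.le
    linarith
  · have e1 := mul_nonneg (show 0 ≤ (1 - θ) / 2 by linarith [hθ.2]) h1.le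
    have e2 := mul_pos (show 0 < (1 + θ) / 2 by linarith) h2
    linarith

lemma tail_conv_zero_eq_zero {μ V : Measure ℝ} [IsProbabilityMeasure μ] [IsProbabilityMeasure V]
    (h₁ : tail μ 0 = 0) (h₂ : tail V 0 = 0) : tail (Measure.conv μ V) 0 = 0 := by
  have h := tail_conv_le (ν₁ := μ) (ν₂ := V) 1 0
  simp only [div_one, sub_self, h₁, h₂, mul_zero, add_zero] at h
  exact le_antisymm h (tail_nonneg _ _)

lemma stepCoeff_eq_zero (hF : tail F 0 = 0) (hν : tail ν 0 = 0) : stepCoeff θ α F ν = 0 := by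
  have h1 := tail_conv_zero_eq_zero hν hF
  have h2 := tail_conv_zero_eq_zero (V := maxLaw F) hν (by rw [tail_maxLaw, hF]; ring)
  rw [stepCoeff, posMoment_eq_zero_of_tail_eq_zero h1, posMoment_eq_zero_of_tail_eq_zero h2]
  ring

lemma tail_stepLaw_zero_eq_zero (hθ : θ ∈ Set.Icc (-1 : ℝ) 1) (hG : G (Set.Iic 0) = 0)
    (hπ : IsFGM π F G θ) (hF : tail F 0 = 0) (hν : tail ν 0 = 0) :
    tail (stepLaw π ν) 0 = 0 := by
  rw [tail, stepLaw, map_measureReal_apply measurable_step measurableSet_Ioi,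
    measureReal_eq_zero_iff]
  have h1 : ∀ᵐ q ∂(π.prod ν), 0 < q.1.2 :=
    Measure.quasiMeasurePreserving_fst.ae (hπ.ae_snd_pos hθ hG)
  have h2 : ∀ᵐ q ∂(π.prod ν), q.1.1 ≤ 0 := by
    have : ∀ᵐ x ∂(π.map Prod.fst), x ≤ 0 := by
      rw [hπ.map_fst hθ hG, ae_iff]
      refine measure_mono_null (fun y hy => not_le.mp hy) ?_
      exact (measureReal_eq_zero_iff (measure_ne_top _ _)).mp hF
    exact Measure.quasiMeasurePreserving_fst.ae (ae_of_ae_map measurable_fst.aemeasurable this)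
  have h3 : ∀ᵐ q ∂(π.prod ν), q.2 ≤ 0 := by
    refine Measure.quasiMeasurePreserving_snd.ae (p := fun z => z ≤ 0) ?_
    rw [ae_iff]
    refine measure_mono_null (fun y hy => not_le.mp hy) ?_
    exact (measureReal_eq_zero_iff (measure_ne_top _ _)).mp hν
  have h4 : ∀ᵐ q ∂(π.prod ν), ¬ 0 < q.1.2 * (q.1.1 + q.2) := by
    filter_upwards [h1, h2, h3] with q k1 k2 k3
    exact not_lt.mpr (mul_nonpos_of_nonneg_of_nonpos k1.le (by linarith))
  rw [ae_iff] at h4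
  exact measure_mono_null (fun q hq => not_not.mpr hq) h4

/-! ### Contraction and fixed points -/

/-- Multiplication by an independent factor of law `G` contracts uniform tail bounds of order
`tail H`, up to an additive constant, when `E Y^α < 1`. -/
lemma exists_contraction (hα : 0 ≤ α) (R : RiskTails α F G) (hG : G (Set.Iic 0) = 0) {ρ : ℝ}
    (hρ : posMoment α G < ρ) : ∃ A C : ℝ, 0 < A ∧ 0 ≤ C ∧ ∀ᶠ x in atTop,
      ∀ (ν : Measure ℝ) [IsProbabilityMeasure ν] (K : ℝ), 0 ≤ K →
      (∀ z, A ≤ z → tail ν z ≤ K * tail (halfMix F G) z) →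
      tail (Measure.mconv G ν) x ≤ (K * ρ + C) * tail (halfMix F G) x := by
  have hH := R.strong
  set ε := (ρ - posMoment α G) / 3 with hε
  have hεp : 0 < ε := by rw [hε]; linarith
  obtain ⟨CG, hCG, hbG⟩ := R.boundedG
  obtain ⟨A, hA, hlarge⟩ := hH.both_large (ε / (CG + 1)) (by positivity)
  have hint := TailLE.of_tendsto (H := halfMix F G) hH.pos le_rfl
    (hH.tailReg_tail.tendsto_integral_comp_div (ν := G) hα hH hA) ε hεp
  refine ⟨A, CG * (A ^ α + 1), hA, by positivity, ?_⟩
  filter_upwards [hlarge, hint, hH.eventually_tail_div_le hA, eventually_ge_atTop (A * A)]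
    with x hx1 hx2 hx3 hx4 ν _ K hK hν
  have hx0 : 0 < x := lt_of_lt_of_le (mul_pos hA hA) hx4
  have hxA : A ≤ x / A := (le_div_iff₀ hA).mpr hx4
  have hdiv : ∀ u ∈ Set.Ioc 0 A, x / A ≤ x / u := fun u hu =>
    div_le_div_of_nonneg_left hx0.le hu.1 hu.2
  rw [tail_mconv_eq hG hA hx4]
  have b1 : ∫ u in Set.Ioc 0 A, tail ν (x / u) ∂G ≤
      K * ((posMoment α G + ε) * tail (halfMix F G) x) := by
    calc ∫ u in Set.Ioc 0 A, tail ν (x / u) ∂G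
        ≤ ∫ u in Set.Ioc 0 A, K * tail (halfMix F G) (x / u) ∂G := by
          refine setIntegral_mono_on
            (integrable_comp_div_Ioc (measurable_tail ν) abs_tail_le A x)
            ((integrable_comp_div_Ioc (measurable_tail _) abs_tail_le A x).const_mul K)
            measurableSet_Ioc fun u hu => hν _ (hxA.trans (hdiv u hu))
      _ = K * ∫ u in Set.Ioc 0 A, tail (halfMix F G) (x / u) ∂G := integral_const_mul _ _
      _ ≤ K * ((posMoment α G + ε) * tail (halfMix F G) x) := by
          refine mul_le_mul_of_nonneg_left (hx2.trans ?_) hK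
          have := setIntegral_rpow_Ioc_le (R.boundedG.finitePosMoment hα hH) A
          nlinarith [hH.pos x]
  have b2 : ∫ v in Set.Ioc 0 A, tail G (x / v) ∂ν ≤
      CG * (A ^ α + 1) * tail (halfMix F G) x := by
    have hc : ∀ v ∈ Set.Ioc 0 A, tail G (x / v) ≤ CG * (A ^ α + 1) * tail (halfMix F G) x :=
      fun v hv => by
        rw [mul_assoc]
        exact ((tail_antitone G (hdiv v hv)).trans (hbG _)).trans
          (mul_le_mul_of_nonneg_left hx3 hCG)
    refine (setIntegral_mono_on (integrable_comp_div_Ioc (measurable_tail G) abs_tail_le A x)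
      (integrable_const _) measurableSet_Ioc hc).trans ?_
    rw [setIntegral_const, smul_eq_mul]
    exact mul_le_of_le_one_left (mul_nonneg (by positivity) (tail_nonneg _ _)) measureReal_le_one
  have b3 : (G.prod ν).real {p | A < p.1 ∧ A < p.2 ∧ x < p.1 * p.2} ≤
      K * (ε * tail (halfMix F G) x) := by
    have hs1 := measureReal_both_large_le (μ := G) (x := x) hA hν
    have hs2 := measureReal_both_large_le (μ := halfMix F G) (ν₁ := G) (ν₂ := halfMix F G)
      (x := x) hA fun z _ => hbG z
    rw [measureReal_both_large_swap] at hs2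
    refine hs1.trans (mul_le_mul_of_nonneg_left (hs2.trans ?_) hK)
    refine (mul_le_mul_of_nonneg_left hx1 hCG).trans ?_
    have : CG * (ε / (CG + 1) * tail (halfMix F G) x) =
        CG / (CG + 1) * (ε * tail (halfMix F G) x) := by ring
    rw [this]
    refine mul_le_of_le_one_left (mul_nonneg hεp.le (tail_nonneg _ _)) ?_
    exact (div_le_one (by positivity)).mpr (by linarith)
  have hρ' : ρ = posMoment α G + 3 * ε := by rw [hε]; ring
  have hpos : 0 ≤ K * (ε * tail (halfMix F G) x) :=
    mul_nonneg hK (mul_nonneg hεp.le (tail_nonneg _ _))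
  rw [hρ']
  nlinarith

/-- `Y (X + Z)` exceeds `x` only if `Y Z` exceeds `x / w` or `Y X` exceeds `x - x / w`. -/
lemma tail_stepLaw_le (hθ : θ ∈ Set.Icc (-1 : ℝ) 1) (hG : G (Set.Iic 0) = 0)
    (hπ : IsFGM π F G θ) (w x : ℝ) :
    tail (stepLaw π ν) x ≤ tail (stepLaw π (Measure.dirac 0)) (x - x / w)
      + tail (Measure.mconv G ν) (x / w) := by
  have e1 : tail (stepLaw π (Measure.dirac 0)) (x - x / w) =
      (π.prod ν).real {q | x - x / w < q.1.2 * q.1.1} := by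
    rw [tail, stepLaw, Measure.prod_dirac, Measure.map_map (by fun_prop) (by fun_prop)]
    have : π = (π.prod ν).map Prod.fst := (measurePreserving_fst (μ := π) (ν := ν)).map_eq.symm
    conv_lhs => rw [this]
    rw [Measure.map_map (by fun_prop) (by fun_prop),
      map_measureReal_apply (by fun_prop) measurableSet_Ioi]
    congr 1
    ext q
    simp
  have e2 : tail (Measure.mconv G ν) (x / w) = (π.prod ν).real {q | x / w < q.1.2 * q.2} := by
    have hm := Measure.map_prod_map π ν (f := Prod.snd) (g := id) measurable_snd measurable_id
    rw [Measure.map_id, hπ.map_snd hθ hG] at hm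
    rw [tail, Measure.mconv, hm, Measure.map_map (by fun_prop) (by fun_prop),
      map_measureReal_apply (by fun_prop) measurableSet_Ioi]
    rfl
  rw [e1, e2, tail, stepLaw, map_measureReal_apply measurable_step measurableSet_Ioi]
  refine (measureReal_mono fun q hq => ?_).trans (measureReal_union_le _ _)
  have hq : x < q.1.2 * (q.1.1 + q.2) := hq
  rcases lt_or_ge (x / w) (q.1.2 * q.2) with h | h
  · exact Or.inr h
  · exact Or.inl (show x - x / w < q.1.2 * q.1.1 by linarith)

/-- Uniform tail bound along the recursion when `E Y^α < 1`. -/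
theorem exists_uniform_tail_bound (hα : 0 ≤ α) (R : RiskTails α F G)
    (hθ : θ ∈ Set.Icc (-1 : ℝ) 1) (hG : G (Set.Iic 0) = 0) (hπ : IsFGM π F G θ)
    (hμ : posMoment α G < 1) (ν : ℕ → Measure ℝ) [∀ n, IsProbabilityMeasure (ν n)]
    (h0 : TailBounded (halfMix F G) (ν 0))
    (hstep : ∀ n x, 0 < x → tail (ν (n + 1)) x ≤ tail (stepLaw π (ν n)) x) :
    ∃ K, 0 ≤ K ∧ ∀ n x, tail (ν n) x ≤ K * tail (halfMix F G) x := by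
  have hH := R.strong
  set ρ₀ := (posMoment α G + 1) / 2 with hρ₀
  have hm0 := posMoment_nonneg α G
  obtain ⟨A, C, hA, hC, hcon⟩ := exists_contraction hα R hG
    (show posMoment α G < ρ₀ by rw [hρ₀]; linarith)
  set η := (1 - ρ₀) / 2 with hη
  have hηp : 0 < η := by rw [hη]; linarith
  obtain ⟨w, hw1, hw2, -⟩ := exists_rpow_near_one α hηp
  have hw0 : 0 < w := by linarith
  have hv0 : 0 < 1 - w⁻¹ := by
    have := inv_lt_one_of_one_lt₀ hw1
    linarith
  have hd : TailBounded (halfMix F G) (stepLaw π (Measure.dirac 0)) := by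
    have hz : TailLE (halfMix F G) (tail (Measure.dirac 0))
        (fun x => 0 * tail F x + 0 * tail G x) := by
      refine .of_eventually_le ?_
      filter_upwards [eventually_ge_atTop 0] with x hx
      simp [tail, Measure.real, Measure.dirac_apply' _ measurableSet_Ioi, not_lt.mpr hx]
    have hs := TailLE.stepLaw (π := π) hα R hθ hG hπ le_rfl le_rfl hz
    refine hs.tailBounded hH (TailReg.comb R ?_ ?_)
    · rw [mul_zero, add_zero]; exact coeffY_nonneg hα R hθ
    · rw [mul_zero, add_zero]
      refine stepCoeff_nonneg hα R hθ (hz.tailBounded hH (TailReg.comb R le_rfl le_rfl))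
  obtain ⟨C₁, hC₁, hb₁⟩ := hd.eventually_div hH (inv_pos.mpr hv0)
  have ht : Tendsto (fun x : ℝ => x / w) atTop atTop := tendsto_id.atTop_div_const hw0
  have hev := (((hb₁.and (ht.eventually hcon)).and ((hH.scale w hw0).eventually
    (gt_mem_nhds hw2))).and (eventually_gt_atTop 0))
  obtain ⟨x₁, hx₁⟩ := eventually_atTop.mp hev
  obtain ⟨C₀, hC₀, hb₀⟩ := h0
  set C' := C₁ + C * (1 + η) with hC'
  set K := max (max C₀ (1 / tail (halfMix F G) x₁)) (C' / η) with hK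
  have hKC : C' ≤ K * η := by
    rw [← div_le_iff₀ hηp]
    exact le_max_right _ _
  have hK0 : 0 ≤ K := hC₀.trans ((le_max_left _ _).trans (le_max_left _ _))
  refine ⟨K, hK0, fun n => ?_⟩
  induction n with
  | zero =>
    exact fun x => (hb₀ x).trans (mul_le_mul_of_nonneg_right
      ((le_max_left _ _).trans (le_max_left _ _)) (tail_nonneg _ _))
  | succ n ih =>
    intro x
    rcases le_total x x₁ with hx | hx
    · calc tail (ν (n + 1)) x ≤ 1 := tail_le_one _ _
        _ = 1 / tail (halfMix F G) x₁ * tail (halfMix F G) x₁ := by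
            have := (hH.pos x₁).ne'
            field_simp
        _ ≤ K * tail (halfMix F G) x :=
            mul_le_mul ((le_max_right _ _).trans (le_max_left _ _)) (tail_antitone _ hx)
              (tail_nonneg _ _) hK0
    · obtain ⟨⟨⟨k1, k2⟩, k3⟩, k4⟩ := hx₁ x hx
      have hsub : x - x / w = x / (1 - w⁻¹)⁻¹ := by
        rw [div_inv_eq_mul, div_eq_mul_inv]; ring
      have k5 := k2 (ν n) K hK0 fun z _ => ih z
      rw [div_lt_iff₀ (hH.pos x)] at k3
      have k6 := (hstep n x k4).trans (tail_stepLaw_le (ν := ν n) hθ hG hπ w x)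
      rw [hsub] at k6
      have hρ0 : 0 ≤ ρ₀ := by rw [hρ₀]; linarith
      have k7 : (K * ρ₀ + C) * tail (halfMix F G) (x / w) ≤
          (K * ρ₀ + C) * ((1 + η) * tail (halfMix F G) x) :=
        mul_le_mul_of_nonneg_left k3.le (by positivity)
      have k8 : K * ρ₀ * (1 + η) + C' ≤ K := by
        have hρη : ρ₀ = 1 - 2 * η := by rw [hη]; ring
        have : ρ₀ * (1 + η) ≤ 1 - η := by rw [hρη]; nlinarith
        nlinarith [mul_le_mul_of_nonneg_left this hK0]
      calc tail (ν (n + 1)) x ≤ C₁ * tail (halfMix F G) x +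
            (K * ρ₀ + C) * ((1 + η) * tail (halfMix F G) x) := by linarith
        _ = (K * ρ₀ * (1 + η) + C') * tail (halfMix F G) x := by rw [hC']; ring
        _ ≤ K * tail (halfMix F G) x := mul_le_mul_of_nonneg_right k8 (tail_nonneg _ _)

/-- The coefficients of the tail of a fixed point of the recursion: iterating one step of the
recursion, any a priori bounds converge geometrically to the coefficients fixed by that step. -/
theorem fixedPoint_tail (hα : 0 ≤ α) (R : RiskTails α F G) (hθ : θ ∈ Set.Icc (-1 : ℝ) 1)
    (hG : G (Set.Iic 0) = 0) (hπ : IsFGM π F G θ) (hμ : posMoment α G < 1)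
    (hν : TailBounded (halfMix F G) ν) (hfix : ∀ x, 0 < x → tail ν x = tail (stepLaw π ν) x) :
    TailLE (halfMix F G) (tail ν) (fun x => coeffAInf θ α G * tail F x
      + 1 / (1 - posMoment α G) * stepCoeff θ α F ν * tail G x) ∧
    TailLE (halfMix F G) (fun x => coeffAInf θ α G * tail F x
      + 1 / (1 - posMoment α G) * stepCoeff θ α F ν * tail G x) (tail ν) := by
  have hH := R.strong
  set μ := posMoment α G with hμd
  have hm0 : 0 ≤ μ := posMoment_nonneg α G
  have h1μ : 0 < 1 - μ := by linarith
  set a := coeffAInf θ α G with ha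
  set b := 1 / (1 - μ) * stepCoeff θ α F ν with hb
  have ea : coeffY θ α G = (1 - μ) * a := by
    rw [ha, coeffAInf, ← hμd]; field_simp
  have eb : stepCoeff θ α F ν = (1 - μ) * b := by
    rw [hb]; field_simp
  have ha0 : 0 ≤ a := mul_nonneg (by positivity) (coeffY_nonneg hα R hθ)
  have hb0 : 0 ≤ b := mul_nonneg (by positivity) (stepCoeff_nonneg hα R hθ hν)
  have hpn : ∀ n : ℕ, 0 ≤ μ ^ n ∧ μ ^ n ≤ 1 := fun n => ⟨pow_nonneg hm0 n, pow_le_one₀ hm0 hμ.le⟩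
  have hnn : ∀ (n : ℕ) (c k : ℝ), 0 ≤ c → 0 ≤ k → 0 ≤ c + μ ^ n * (k - c) := fun n c k hc hk => by
    obtain ⟨h1, h2⟩ := hpn n
    nlinarith [mul_nonneg h1 hk, mul_nonneg (sub_nonneg.mpr h2) hc]
  have hrec : ∀ (n : ℕ) (c k : ℝ), (1 - μ) * c + μ * (c + μ ^ n * (k - c)) =
      c + μ ^ (n + 1) * (k - c) := fun n c k => by ring
  have hfe : tail ν =ᶠ[atTop] tail (stepLaw π ν) := by
    filter_upwards [eventually_gt_atTop 0] with x hx using hfix x hx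
  obtain ⟨C, hC, hbC⟩ := hν
  have hν : TailBounded (halfMix F G) ν := ⟨C, hC, hbC⟩
  have up : ∀ n : ℕ, TailLE (halfMix F G) (tail ν) (fun x =>
      (a + μ ^ n * (C / 2 - a)) * tail F x + (b + μ ^ n * (C / 2 - b)) * tail G x) := by
    intro n
    induction n with
    | zero =>
      refine .of_le fun x => (hbC x).trans (le_of_eq ?_)
      rw [tail_halfMix]
      ring
    | succ n ih =>
      have hs := TailLE.stepLaw (π := π) hα R hθ hG hπ (hnn n a _ ha0 (by positivity))
        (hnn n b _ hb0 (by positivity)) ih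
      rw [ea, eb, ← hμd, hrec, hrec] at hs
      exact TailLE.trans (.of_eventually_le hfe.le) hs
  have low : ∀ n : ℕ, TailLE (halfMix F G) (fun x =>
      (a + μ ^ n * (0 - a)) * tail F x + (b + μ ^ n * (0 - b)) * tail G x) (tail ν) := by
    intro n
    induction n with
    | zero =>
      refine .of_le fun x => le_trans (le_of_eq ?_) (tail_nonneg ν x)
      ring
    | succ n ih =>
      have hs := TailLE.le_stepLaw (π := π) hα R hθ hG hπ (hnn n a _ ha0 le_rfl)
        (hnn n b _ hb0 le_rfl) hν ih
      rw [ea, eb, ← hμd, hrec, hrec] at hs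
      exact TailLE.trans hs (.of_eventually_le hfe.symm.le)
  have hpow : ∀ c η : ℝ, 0 < η → ∃ n : ℕ, |μ ^ n * c| < η := fun c η hη => by
    have := ((tendsto_pow_atTop_nhds_zero_of_lt_one hm0 hμ).mul_const c).abs
    rw [zero_mul, abs_zero] at this
    exact (this.eventually (gt_mem_nhds hη)).exists
  refine ⟨.of_forall_error fun η hη => ?_, .of_forall_error fun η hη => ?_⟩
  · obtain ⟨n, hn⟩ := hpow (C / 2) (η / 2) (half_pos hη)
    refine (up n).trans (.of_le fun x => ?_)
    have hn := (abs_lt.mp hn).2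
    have h1 := mul_nonneg (hpn n).1 ha0
    have h2 := mul_nonneg (hpn n).1 hb0
    rw [tail_halfMix]
    nlinarith [tail_nonneg F x, tail_nonneg G x]
  · obtain ⟨n, hn⟩ := hpow (a + b) (η / 2) (half_pos hη)
    refine TailLE.trans (.of_le fun x => ?_)
      ((low n).add (.of_le (H := halfMix F G) (f := fun x => η * tail (halfMix F G) x)
        fun _ => le_rfl))
    have hn := (abs_lt.mp hn).2
    have h1 := mul_nonneg (hpn n).1 ha0
    have h2 := mul_nonneg (hpn n).1 hb0
    rw [tail_halfMix]
    nlinarith [tail_nonneg F x, tail_nonneg G x]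

/-- Upper and lower bounds with positive coefficients make an asymptotic equivalence. -/
lemma isEquivalent_of_tailLE {f : ℝ → ℝ} {a b : ℝ} (ha : 0 < a) (hb : 0 < b)
    (h₁ : TailLE (halfMix F G) f (fun x => a * tail F x + b * tail G x))
    (h₂ : TailLE (halfMix F G) (fun x => a * tail F x + b * tail G x) f) :
    f ~[atTop] (fun x => a * tail F x + b * tail G x) := by
  rw [IsEquivalent, isLittleO_iff]
  intro c hc
  have hm : 0 < min a b := lt_min ha hb
  filter_upwards [h₁ (c * min a b) (by positivity), h₂ (c * min a b) (by positivity)]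
    with x h1 h2
  have hF := tail_nonneg F x
  have hG := tail_nonneg G x
  have hle : min a b * tail (halfMix F G) x ≤ a * tail F x + b * tail G x := by
    rw [tail_halfMix]
    nlinarith [mul_le_mul_of_nonneg_right (min_le_left a b) hF,
      mul_le_mul_of_nonneg_right (min_le_right a b) hG, mul_nonneg ha.le hF, mul_nonneg hb.le hG]
  have h0 : 0 ≤ a * tail F x + b * tail G x := by positivity
  have h3 := mul_le_mul_of_nonneg_left hle hc.le
  rw [Real.norm_of_nonneg h0, Real.norm_eq_abs, Pi.sub_apply, abs_le]
  constructor <;> nlinarith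

end


/-! ### Recursion for the coefficients and finite horizons -/

lemma sum_Icc_one_succ (f : ℕ → ℝ) (n : ℕ) :
    ∑ i ∈ Finset.Icc 1 (n + 1), f i = f 1 + ∑ i ∈ Finset.Icc 1 n, f (i + 1) := by
  induction n with
  | zero => simp
  | succ n ih =>
    rw [Finset.sum_Icc_succ_top (by lia), ih, Finset.sum_Icc_succ_top (by lia)]
    ring

lemma prod_Icc_one_succ (f : ℕ → ℝ) (n : ℕ) :
    ∏ i ∈ Finset.Icc 1 (n + 1), f i = f 1 * ∏ i ∈ Finset.Icc 1 n, f (i + 1) := by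
  induction n with
  | zero => simp
  | succ n ih =>
    rw [Finset.prod_Icc_succ_top (by lia), ih, Finset.prod_Icc_succ_top (by lia)]
    ring

lemma coeffA_zero (θ α : ℝ) (G : Measure ℝ) : coeffA θ α G 0 = 0 := by simp [coeffA]

lemma coeffA_succ (θ α : ℝ) (G : Measure ℝ) (n : ℕ) :
    coeffA θ α G (n + 1) = coeffY θ α G + posMoment α G * coeffA θ α G n := by
  have h : ∑ i ∈ Finset.Icc 1 n, posMoment α G ^ (i + 1 - 1) =
      posMoment α G * ∑ i ∈ Finset.Icc 1 n, posMoment α G ^ (i - 1) := by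
    rw [Finset.mul_sum]
    refine Finset.sum_congr rfl fun i hi => ?_
    rw [← pow_succ']
    congr 1
    have := (Finset.mem_Icc.mp hi).1
    lia
  rw [coeffA, coeffA, sum_Icc_one_succ, h]
  simp only [tsub_self, pow_zero]
  ring

lemma coeffBC_zero {Ω : Type*} [MeasurableSpace Ω] (P : Measure Ω) (θ α : ℝ) (F G : Measure ℝ)
    (Z X : ℕ → Ω → ℝ) : coeffBC P θ α F G Z X 0 = 0 := by simp [coeffBC]

lemma coeffBC_succ {Ω : Type*} [MeasurableSpace Ω] (P : Measure Ω) (θ α : ℝ) (F G : Measure ℝ)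
    (Z X : ℕ → Ω → ℝ) (n : ℕ) : coeffBC P θ α F G Z X (n + 1) =
      coeffX P θ α F (Z n) (X (n + 1)) + posMoment α G * coeffBC P θ α F G Z X n := by
  have h : ∑ i ∈ Finset.Icc 1 n, posMoment α G ^ (i + 1 - 1) *
        coeffX P θ α F (Z (n + 1 - (i + 1))) (X (n + 1 - (i + 1) + 1)) =
      posMoment α G * ∑ i ∈ Finset.Icc 1 n, posMoment α G ^ (i - 1) *
        coeffX P θ α F (Z (n - i)) (X (n - i + 1)) := by
    rw [Finset.mul_sum]
    refine Finset.sum_congr rfl fun i hi => ?_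
    have h1 := (Finset.mem_Icc.mp hi).1
    have e1 : n + 1 - (i + 1) = n - i := by lia
    have e2 : i + 1 - 1 = i - 1 + 1 := by lia
    rw [e1, e2, pow_succ', mul_assoc]
  rw [coeffBC, coeffBC, sum_Icc_one_succ, h]
  simp

lemma tail_eq_zero_of_nonneg {V : Measure ℝ} [IsFiniteMeasure V] (h : tail V 0 = 0) {x : ℝ}
    (hx : 0 ≤ x) : tail V x = 0 :=
  le_antisymm (h ▸ tail_antitone V hx) (tail_nonneg V x)

/-- Asymptotic equivalence when `X ≤ 0`: both sides vanish on the positive half-line. -/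
lemma isEquivalent_of_tail_eq_zero {F G V : Measure ℝ} [IsFiniteMeasure F]
    [IsFiniteMeasure V] (hF : tail F 0 = 0)
    (hV : tail V 0 = 0) (a : ℝ) {b : ℝ} (hb : b = 0) :
    (fun x => tail V x) ~[atTop] (fun x => a * tail F x + b * tail G x) := by
  refine EventuallyEq.isEquivalent ?_
  filter_upwards [eventually_ge_atTop 0] with x hx
  rw [tail_eq_zero_of_nonneg hV hx, tail_eq_zero_of_nonneg hF hx, hb]
  ring

section

variable {α θ : ℝ} {F G : Measure ℝ} [IsProbabilityMeasure F] [IsProbabilityMeasure G]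
  {π : Measure (ℝ × ℝ)} [IsProbabilityMeasure π]

/-- Tail bounds along the recursion, with coefficients `a n` and `b n`. -/
lemma sequence_tail (hα : 0 ≤ α) (R : RiskTails α F G) (hθ : θ ∈ Set.Icc (-1 : ℝ) 1)
    (hG : G (Set.Iic 0) = 0) (hπ : IsFGM π F G θ) {ν : ℕ → Measure ℝ}
    [∀ n, IsProbabilityMeasure (ν n)] (h0 : tail (ν 0) 0 = 0)
    (hstep : ∀ n x, 0 ≤ x → tail (ν (n + 1)) x = tail (stepLaw π (ν n)) x) {b : ℕ → ℝ}
    (hb0 : b 0 = 0) (hb : ∀ n, b (n + 1) = stepCoeff θ α F (ν n) + posMoment α G * b n) (n : ℕ) :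
    0 ≤ coeffA θ α G n ∧ 0 ≤ b n ∧ TailBounded (halfMix F G) (ν n) ∧
    TailLE (halfMix F G) (tail (ν n)) (fun x => coeffA θ α G n * tail F x + b n * tail G x) ∧
    TailLE (halfMix F G) (fun x => coeffA θ α G n * tail F x + b n * tail G x) (tail (ν n)) := by
  have hm := posMoment_nonneg α G
  induction n with
  | zero =>
    have hz : TailLE (halfMix F G) (tail (ν 0))
        (fun x => coeffA θ α G 0 * tail F x + b 0 * tail G x) := by
      refine .of_eventually_le ?_
      filter_upwards [eventually_ge_atTop 0] with x hx
      rw [coeffA_zero, hb0, zero_mul, zero_mul, add_zero, ← h0]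
      exact tail_antitone _ hx
    refine ⟨(coeffA_zero _ _ _).ge, hb0.ge, hz.tailBounded R.strong
      (TailReg.comb R (coeffA_zero _ _ _).ge hb0.ge), hz, .of_le fun x => ?_⟩
    rw [coeffA_zero, hb0, zero_mul, zero_mul, add_zero]
    exact tail_nonneg _ _
  | succ n ih =>
    obtain ⟨ha, hbn, hbd, hup, hlow⟩ := ih
    have ha' : 0 ≤ coeffA θ α G (n + 1) := by
      rw [coeffA_succ]
      exact add_nonneg (coeffY_nonneg hα R hθ) (mul_nonneg hm ha)
    have hb' : 0 ≤ b (n + 1) := by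
      rw [hb]
      exact add_nonneg (stepCoeff_nonneg hα R hθ hbd) (mul_nonneg hm hbn)
    have he : tail (ν (n + 1)) =ᶠ[atTop] tail (stepLaw π (ν n)) := by
      filter_upwards [eventually_ge_atTop 0] with x hx using hstep n x hx
    have hup' := TailLE.stepLaw (π := π) hα R hθ hG hπ ha hbn hup
    have hlow' := TailLE.le_stepLaw (π := π) hα R hθ hG hπ ha hbn hbd hlow
    rw [← coeffA_succ, ← hb] at hup' hlow'
    have hup'' := TailLE.trans (.of_eventually_le he.le) hup'
    exact ⟨ha', hb', hup''.tailBounded R.strong (TailReg.comb R ha' hb'), hup'',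
      hlow'.trans (.of_eventually_le he.symm.le)⟩

/-- The finite horizon asymptotics. -/
theorem sequence_isEquivalent (hα : 0 ≤ α) (R : RiskTails α F G) (hθ : θ ∈ Set.Icc (-1 : ℝ) 1)
    (hG : G (Set.Iic 0) = 0) (hπ : IsFGM π F G θ) {ν : ℕ → Measure ℝ}
    [∀ n, IsProbabilityMeasure (ν n)] (h0 : tail (ν 0) 0 = 0)
    (hstep : ∀ n x, 0 ≤ x → tail (ν (n + 1)) x = tail (stepLaw π (ν n)) x)
    (hpos : 0 < tail F 0 → ∀ n, 0 < (ν n).real (Set.Ici 0)) {b : ℕ → ℝ}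
    (hb0 : b 0 = 0) (hb : ∀ n, b (n + 1) = stepCoeff θ α F (ν n) + posMoment α G * b n)
    (n : ℕ) (hn : 1 ≤ n) :
    (fun x => tail (ν n) x) ~[atTop] (fun x => coeffA θ α G n * tail F x + b n * tail G x) := by
  have hall := sequence_tail hα R hθ hG hπ h0 hstep hb0 hb
  obtain ⟨k, rfl⟩ := Nat.exists_eq_succ_of_ne_zero (Nat.one_le_iff_ne_zero.mp hn)
  have hm := posMoment_nonneg α G
  rcases (tail_nonneg F 0).eq_or_lt with hF | hF
  · have hz : ∀ m, tail (ν m) 0 = 0 := fun m => by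
      induction m with
      | zero => exact h0
      | succ m ih => rw [hstep m 0 le_rfl, tail_stepLaw_zero_eq_zero hθ hG hπ hF.symm ih]
    have hbz : ∀ m, b m = 0 := fun m => by
      induction m with
      | zero => exact hb0
      | succ m ih => rw [hb, ih, stepCoeff_eq_zero hF.symm (hz m), mul_zero, add_zero]
    exact isEquivalent_of_tail_eq_zero hF.symm (hz _) _ (hbz _)
  · obtain ⟨ha, hbk, hbd, -, -⟩ := hall k
    obtain ⟨-, -, -, hup, hlow⟩ := hall (k + 1)
    refine isEquivalent_of_tailLE ?_ ?_ hup hlow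
    · rw [coeffA_succ]
      exact add_pos_of_pos_of_nonneg (coeffY_pos hα R hθ hG) (mul_nonneg hm ha)
    · rw [hb]
      exact add_pos_of_pos_of_nonneg (stepCoeff_pos hα R hθ hF hbd (hpos hF k))
        (mul_nonneg hm hbk)

end

/-! ### Shifting the sequence of risks -/

/-- The increasing enumeration of the natural numbers different from `k`. -/
def skip (k i : ℕ) : ℕ := if i < k then i else i + 1

lemma skip_injective (k : ℕ) : Function.Injective (skip k) := by
  intro i j h
  unfold skip at h
  split_ifs at h <;> lia

lemma skip_ne (k i : ℕ) : skip k i ≠ k := by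
  unfold skip
  split_ifs <;> lia

lemma skip_of_lt {k i : ℕ} (h : i < k) : skip k i = i := if_pos h

lemma skip_of_le {k i : ℕ} (h : k ≤ i) : skip k i = i + 1 := if_neg (not_lt.mpr h)

section Trajectories

variable {Ω : Type*}

/-- The sum of `n` terms depends only on the pairs `1, …, n`. -/
lemma S_congr {Ω' : Type*} {X Y : ℕ → Ω → ℝ} {X' Y' : ℕ → Ω' → ℝ} {n : ℕ} {ω : Ω} {ω' : Ω'}
    (h : ∀ i, 1 ≤ i → i ≤ n → X i ω = X' i ω' ∧ Y i ω = Y' i ω') :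
    S X Y n ω = S X' Y' n ω' := by
  refine Finset.sum_congr rfl fun i hi => ?_
  have hi := Finset.mem_Icc.mp hi
  rw [(h i hi.1 hi.2).1]
  congr 1
  refine Finset.prod_congr rfl fun j hj => ?_
  have hj := Finset.mem_Icc.mp hj
  exact (h j hj.1 (hj.2.trans hi.2)).2

lemma M_congr {Ω' : Type*} {X Y : ℕ → Ω → ℝ} {X' Y' : ℕ → Ω' → ℝ} {n : ℕ} {ω : Ω} {ω' : Ω'}
    (h : ∀ i, 1 ≤ i → i ≤ n → X i ω = X' i ω' ∧ Y i ω = Y' i ω') :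
    M X Y n ω = M X' Y' n ω' := by
  refine Finset.sup'_congr _ rfl fun k hk => S_congr fun i h1 h2 => h i h1 (h2.trans ?_)
  exact Nat.lt_succ_iff.mp (Finset.mem_range.mp hk)

variable (X Y : ℕ → Ω → ℝ)

@[simp] lemma S_zero (ω : Ω) : S X Y 0 ω = 0 := by simp [S]

lemma S_succ (n : ℕ) (ω : Ω) : S X Y (n + 1) ω =
    Y 1 ω * (X 1 ω + S (fun i => X (skip 1 i)) (fun i => Y (skip 1 i)) n ω) := by
  have hs : S (fun i => X (skip 1 i)) (fun i => Y (skip 1 i)) n ω =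
      ∑ i ∈ Finset.Icc 1 n, X (i + 1) ω * ∏ j ∈ Finset.Icc 1 i, Y (j + 1) ω := by
    refine Finset.sum_congr rfl fun i hi => ?_
    simp only [skip_of_le (Finset.mem_Icc.mp hi).1]
    congr 1
    refine Finset.prod_congr rfl fun j hj => ?_
    simp only [skip_of_le (Finset.mem_Icc.mp hj).1]
  rw [hs, S, sum_Icc_one_succ, mul_add, Finset.mul_sum]
  congr 1
  · simp [mul_comm]
  · refine Finset.sum_congr rfl fun i _ => ?_
    rw [prod_Icc_one_succ (fun j => Y j ω)]
    ring

lemma M_le_iff {n : ℕ} {ω : Ω} {c : ℝ} : M X Y n ω ≤ c ↔ ∀ k ≤ n, S X Y k ω ≤ c := by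
  rw [M, Finset.sup'_le_iff]
  simp only [Finset.mem_range, Nat.lt_succ_iff]

lemma S_le_M {k n : ℕ} (h : k ≤ n) (ω : Ω) : S X Y k ω ≤ M X Y n ω :=
  (M_le_iff X Y).mp le_rfl k h

lemma M_zero (ω : Ω) : M X Y 0 ω = 0 := by simp [M]

lemma M_nonneg (n : ℕ) (ω : Ω) : 0 ≤ M X Y n ω := by
  simpa using S_le_M X Y (Nat.zero_le n) ω

lemma M_monotone (ω : Ω) : Monotone (fun n => M X Y n ω) := fun _ _ h =>
  (M_le_iff X Y).mpr fun _ hk => S_le_M X Y (hk.trans h) ω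

lemma M_succ (n : ℕ) {ω : Ω} (hY : 0 ≤ Y 1 ω) : M X Y (n + 1) ω =
    max (Y 1 ω * (X 1 ω + M (fun i => X (skip 1 i)) (fun i => Y (skip 1 i)) n ω)) 0 := by
  refine le_antisymm ((M_le_iff X Y).mpr fun k hk => ?_) (max_le ?_ (M_nonneg X Y _ ω))
  · rcases k with - | k
    · rw [S_zero]; exact le_max_right _ _
    · refine le_max_of_le_left ?_
      rw [S_succ]
      gcongr
      exact S_le_M _ _ (by lia) ω
  · obtain ⟨k, hk, he⟩ := Finset.exists_mem_eq_sup' (Finset.nonempty_range_add_one (n := n))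
      (fun k => S (fun i => X (skip 1 i)) (fun i => Y (skip 1 i)) k ω)
    rw [M, he, ← S_succ]
    exact S_le_M X Y (by have := Finset.mem_range.mp hk; lia) ω

variable [MeasurableSpace Ω] {X Y}

lemma measurable_S (hX : ∀ i, Measurable (X i)) (hY : ∀ i, Measurable (Y i)) (n : ℕ) :
    Measurable (S X Y n) := by
  unfold S
  exact Finset.measurable_sum _ fun i _ => (hX i).mul (Finset.measurable_prod _ fun j _ => hY j)

lemma measurable_M (hX : ∀ i, Measurable (X i)) (hY : ∀ i, Measurable (Y i)) (n : ℕ) :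
    Measurable (M X Y n) := by
  refine measurable_of_Iic fun c => ?_
  have : M X Y n ⁻¹' Set.Iic c = ⋂ k ≤ n, S X Y k ⁻¹' Set.Iic c := by
    ext ω
    simp only [Set.mem_preimage, Set.mem_Iic, Set.mem_iInter]
    exact M_le_iff X Y
  rw [this]
  exact MeasurableSet.biInter (Set.to_countable _) fun k _ => measurable_S hX hY k measurableSet_Iic

end Trajectories

/-! ### Independent sequences of pairs with a common law -/

section Sequences

variable {Ω : Type*} [MeasurableSpace Ω] {P : Measure Ω} [IsProbabilityMeasure P]
  {π : Measure (ℝ × ℝ)} [IsProbabilityMeasure π] {ξ : ℕ → Ω → ℝ × ℝ}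

/-- The law of an independent sequence of pairs with law `π`. -/
noncomputable def seqLaw (π : Measure (ℝ × ℝ)) [IsProbabilityMeasure π] :
    Measure (ℕ → ℝ × ℝ) := Measure.infinitePi fun _ => π

instance : IsProbabilityMeasure (seqLaw π) :=
  inferInstanceAs (IsProbabilityMeasure (Measure.infinitePi fun _ : ℕ => π))

lemma map_seq_eq (hm : ∀ i, Measurable (ξ i)) (hi : iIndepFun ξ P) (hl : ∀ i, P.map (ξ i) = π)
    {g : ℕ → ℕ} (hg : Function.Injective g) :
    P.map (fun ω i => ξ (g i) ω) = seqLaw π := by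
  rw [(iIndepFun_iff_map_fun_eq_infinitePi_map fun i => hm (g i)).mp (hi.precomp hg), seqLaw]
  simp only [hl]

/-- One pair of the sequence is independent of the sequence of all others. -/
lemma map_prodMk_skip_eq (hm : ∀ i, Measurable (ξ i)) (hi : iIndepFun ξ P)
    (hl : ∀ i, P.map (ξ i) = π) (k : ℕ) :
    P.map (fun ω => (ξ k ω, fun i => ξ (skip k i) ω)) = π.prod (seqLaw π) := by
  have hind : IndepFun (ξ k) (fun ω i => ξ (skip k i) ω) P := by
    have h := indep_iSup_of_disjoint (S := {k}) (T := {k}ᶜ)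
      (fun i => (hm i).comap_le) ((iIndepFun_iff_iIndep _ ξ P).mp hi)
      (Set.disjoint_compl_right_iff_subset.mpr le_rfl)
    rw [IndepFun_iff_Indep]
    refine indep_of_indep_of_le_left (indep_of_indep_of_le_right h ?_) ?_
    · rw [← measurable_iff_comap_le]
      refine @measurable_pi_lambda _ _ _ (_) _ _ fun i => ?_
      rw [measurable_iff_comap_le]
      exact le_iSup₂_of_le (skip k i) (skip_ne k i) le_rfl
    · exact le_iSup₂_of_le k rfl le_rfl
  rw [hind.map_prod_eq_prod_map_map (hm k).aemeasurable
    (measurable_pi_lambda _ fun i => hm (skip k i)).aemeasurable, hl,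
    map_seq_eq hm hi hl (skip_injective k)]

/-- The first entries of a sequence of pairs. -/
def coordX (i : ℕ) (s : ℕ → ℝ × ℝ) : ℝ := (s i).1

/-- The second entries of a sequence of pairs. -/
def coordY (i : ℕ) (s : ℕ → ℝ × ℝ) : ℝ := (s i).2

lemma measurable_coordX (i : ℕ) : Measurable (coordX i) := by unfold coordX; fun_prop

lemma measurable_coordY (i : ℕ) : Measurable (coordY i) := by unfold coordY; fun_prop

lemma iIndepFun_coord : iIndepFun (fun (i : ℕ) (s : ℕ → ℝ × ℝ) => s i) (seqLaw π) :=
  iIndepFun_infinitePi (P := fun _ : ℕ => π) (X := fun _ p => p) fun _ => measurable_id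

lemma map_coord (i : ℕ) : (seqLaw π).map (fun s => s i) = π :=
  Measure.infinitePi_map_eval _ i

/-- The functional `Y₁ (X₁ + Φ)` of a sequence, with `Φ` evaluated at the shifted sequence, has
the law produced by one step of the recursion. -/
lemma map_step_eq {Φ : (ℕ → ℝ × ℝ) → ℝ} (hΦ : Measurable Φ) :
    (seqLaw π).map (fun s => (s 1).2 * ((s 1).1 + Φ (fun i => s (skip 1 i)))) =
      stepLaw π ((seqLaw π).map Φ) := by
  have h := map_prodMk_skip_eq (ξ := fun (i : ℕ) (s : ℕ → ℝ × ℝ) => s i) (P := seqLaw π) (π := π)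
    (fun i => measurable_pi_apply i) iIndepFun_coord map_coord 1
  have hp := Measure.map_prod_map π (seqLaw π) measurable_id hΦ
  rw [Measure.map_id] at hp
  rw [stepLaw, hp, ← h, Measure.map_map (by fun_prop) (by fun_prop),
    Measure.map_map (by fun_prop) (by fun_prop)]
  rfl

/-- A functional of all pairs but the `k`th one, plus the first entry of the `k`th pair. -/
lemma map_add_eq_conv (hm : ∀ i, Measurable (ξ i)) (hi : iIndepFun ξ P)
    (hl : ∀ i, P.map (ξ i) = π) (k : ℕ) {Φ : (ℕ → ℝ × ℝ) → ℝ} (hΦ : Measurable Φ) {Z : Ω → ℝ}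
    (hZ : ∀ ω, Φ (fun i => ξ (skip k i) ω) = Z ω) :
    P.map (fun ω => Z ω + (ξ k ω).1) = Measure.conv (P.map Z) (π.map Prod.fst) := by
  have h := map_prodMk_skip_eq hm hi hl k
  have : IsProbabilityMeasure (π.map Prod.fst) :=
    Measure.isProbabilityMeasure_map measurable_fst.aemeasurable
  have : IsProbabilityMeasure ((seqLaw π).map Φ) :=
    Measure.isProbabilityMeasure_map hΦ.aemeasurable
  have hp := Measure.map_prod_map π (seqLaw π) measurable_fst hΦ
  have hZl : P.map Z = (seqLaw π).map Φ := by
    rw [← map_seq_eq hm hi hl (skip_injective k), Measure.map_map hΦ (by fun_prop)]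
    exact congrArg (P.map ·) (funext fun ω => (hZ ω).symm)
  rw [hZl, Measure.conv_comm, Measure.conv, hp, ← h, Measure.map_map (by fun_prop) (by fun_prop),
    Measure.map_map (by fun_prop) (by fun_prop)]
  simp only [Function.comp_def, Prod.map_apply, hZ, add_comm]

end Sequences


section

variable {α θ : ℝ} {F G : Measure ℝ} [IsProbabilityMeasure F] [IsProbabilityMeasure G]
  {π : Measure (ℝ × ℝ)} [IsProbabilityMeasure π]

/-! ### The laws of the sums and maxima -/

lemma ae_coord {p : ℝ × ℝ → Prop} (h : ∀ᵐ z ∂π, p z) (i : ℕ) : ∀ᵐ s ∂(seqLaw π), p (s i) := by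
  rw [← map_coord (π := π) i] at h
  exact ae_of_ae_map (measurable_pi_apply i).aemeasurable h

/-- The law of the sum of `n` terms. -/
noncomputable def lawS (π : Measure (ℝ × ℝ)) [IsProbabilityMeasure π] (n : ℕ) : Measure ℝ :=
  (seqLaw π).map (S coordX coordY n)

/-- The law of the maximum of the first `n` sums. -/
noncomputable def lawM (π : Measure (ℝ × ℝ)) [IsProbabilityMeasure π] (n : ℕ) : Measure ℝ :=
  (seqLaw π).map (M coordX coordY n)

lemma measurable_S_coord (n : ℕ) : Measurable (S coordX coordY n) :=
  measurable_S measurable_coordX measurable_coordY n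

lemma measurable_M_coord (n : ℕ) : Measurable (M coordX coordY n) :=
  measurable_M measurable_coordX measurable_coordY n

instance (n : ℕ) : IsProbabilityMeasure (lawS π n) :=
  Measure.isProbabilityMeasure_map (measurable_S_coord n).aemeasurable

instance (n : ℕ) : IsProbabilityMeasure (lawM π n) :=
  Measure.isProbabilityMeasure_map (measurable_M_coord n).aemeasurable

lemma tail_lawM (n : ℕ) (x : ℝ) :
    tail (lawM π n) x = (seqLaw π).real {s | x < M coordX coordY n s} := by
  rw [tail, lawM, map_measureReal_apply (measurable_M_coord n) measurableSet_Ioi]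
  rfl

lemma lawS_succ (n : ℕ) : lawS π (n + 1) = stepLaw π (lawS π n) := by
  rw [lawS, lawS, ← map_step_eq (measurable_S_coord n)]
  exact congrArg ((seqLaw π).map ·) (funext fun s => S_succ coordX coordY n s)

lemma tail_lawM_succ (hπ : ∀ᵐ p ∂π, 0 < p.2) (n : ℕ) {x : ℝ} (hx : 0 ≤ x) :
    tail (lawM π (n + 1)) x = tail (stepLaw π (lawM π n)) x := by
  rw [tail_lawM, lawM, ← map_step_eq (measurable_M_coord n), tail]
  have hmeas := measurable_M_coord n
  rw [map_measureReal_apply (by fun_prop) measurableSet_Ioi]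
  refine measureReal_congr ?_
  filter_upwards [ae_coord hπ 1] with s hs
  have h := M_succ coordX coordY n (ω := s) hs.le
  refine propext (show x < M coordX coordY (n + 1) s ↔ _ from ?_)
  rw [h, lt_max_iff]
  exact or_iff_left (not_lt.mpr hx)

lemma tail_lawS_zero : tail (lawS π 0) 0 = 0 := by
  rw [tail, lawS, map_measureReal_apply (measurable_S_coord 0) measurableSet_Ioi,
    measureReal_eq_zero_iff]
  convert measure_empty (μ := seqLaw π)
  ext s
  simp

lemma tail_lawM_zero : tail (lawM π 0) 0 = 0 := by
  rw [tail_lawM, measureReal_eq_zero_iff]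
  convert measure_empty (μ := seqLaw π)
  ext s
  simp [M_zero]

lemma lawM_Ici_zero_pos (n : ℕ) : 0 < (lawM π n).real (Set.Ici 0) := by
  have : M coordX coordY n ⁻¹' Set.Ici 0 = Set.univ :=
    Set.eq_univ_of_forall fun s => M_nonneg coordX coordY n s
  rw [lawM, map_measureReal_apply (measurable_M_coord n) measurableSet_Ici, this, probReal_univ]
  exact one_pos

lemma lawS_Ici_zero_pos (hθ : θ ∈ Set.Icc (-1 : ℝ) 1) (hG : G (Set.Iic 0) = 0)
    (hπ : IsFGM π F G θ) (hF : 0 < tail F 0) (n : ℕ) : 0 < (lawS π n).real (Set.Ici 0) := by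
  induction n with
  | zero =>
    have : S coordX coordY 0 ⁻¹' Set.Ici 0 = Set.univ :=
      Set.eq_univ_of_forall fun s => (S_zero coordX coordY s).ge
    rw [lawS, map_measureReal_apply (measurable_S_coord 0) measurableSet_Ici, this, probReal_univ]
    exact one_pos
  | succ n ih =>
    rw [lawS_succ]
    exact stepLaw_Ici_zero_pos hθ hG hπ hF ih

/-! ### Infinite horizon: convergence and fixed points -/

/-- The pathwise limit of a sequence of functionals, as a measurable function defined
everywhere. -/
noncomputable def pathLim (Z : ℕ → (ℕ → ℝ × ℝ) → ℝ) (s : ℕ → ℝ × ℝ) : ℝ :=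
  limsup (fun n => Z n s) atTop

lemma measurable_pathLim {Z : ℕ → (ℕ → ℝ × ℝ) → ℝ} (hZ : ∀ n, Measurable (Z n)) :
    Measurable (pathLim Z) := Measurable.limsup hZ

lemma tendsto_pathLim {Z : ℕ → (ℕ → ℝ × ℝ) → ℝ} {s : ℕ → ℝ × ℝ}
    (h : ∃ l, Tendsto (fun n => Z n s) atTop (𝓝 l)) :
    Tendsto (fun n => Z n s) atTop (𝓝 (pathLim Z s)) := by
  obtain ⟨l, hl⟩ := h
  rwa [pathLim, hl.limsup_eq]

lemma ae_shift {p : (ℕ → ℝ × ℝ) → Prop} (h : ∀ᵐ s ∂(seqLaw π), p s) :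
    ∀ᵐ s ∂(seqLaw π), p (fun i => s (skip 1 i)) := by
  have he := map_seq_eq (ξ := fun (i : ℕ) (s : ℕ → ℝ × ℝ) => s i) (P := seqLaw π) (π := π)
    (fun i => measurable_pi_apply i) iIndepFun_coord map_coord (skip_injective 1)
  rw [← he] at h
  exact ae_of_ae_map
    (measurable_pi_lambda _ fun i => measurable_pi_apply (skip 1 i)).aemeasurable h

/-- Any limit of the maxima or sums exceeds `x` only if some maximum does. -/
lemma measureReal_exists_lt_M_le {K x : ℝ} {H : Measure ℝ}
    (hK : ∀ n x, tail (lawM π n) x ≤ K * tail H x) :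
    (seqLaw π).real {s | ∃ n, x < M coordX coordY n s} ≤ K * tail H x := by
  have hun : {s | ∃ n, x < M coordX coordY n s} = ⋃ n, {s | x < M coordX coordY n s} := by
    ext s; simp
  have hmono : Monotone fun n => {s | x < M coordX coordY n s} := fun m n h s hs =>
    lt_of_lt_of_le hs (M_monotone coordX coordY s h)
  have ht := (ENNReal.tendsto_toReal (measure_ne_top (seqLaw π) _)).comp
    (tendsto_measure_iUnion_atTop (μ := seqLaw π) hmono)
  rw [hun]
  refine le_of_tendsto' ht fun n => ?_
  have := hK n x
  rwa [tail_lawM] at this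

lemma ae_exists_M_le {K : ℝ} {H : Measure ℝ} [IsFiniteMeasure H]
    (hK : ∀ n x, tail (lawM π n) x ≤ K * tail H x) :
    ∀ᵐ s ∂(seqLaw π), ∃ c, ∀ n, M coordX coordY n s ≤ c := by
  have h0 : (seqLaw π).real {s | ¬ ∃ c, ∀ n, M coordX coordY n s ≤ c} = 0 := by
    refine le_antisymm ?_ measureReal_nonneg
    have hlim := (tendsto_tail_atTop H).const_mul K
    rw [mul_zero] at hlim
    refine ge_of_tendsto' hlim fun x => (measureReal_mono fun s hs => ?_).trans
      (measureReal_exists_lt_M_le hK)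
    by_contra hcon
    exact hs ⟨x, fun n => not_lt.mp fun h => hcon ⟨n, h⟩⟩
  rw [ae_iff]
  exact (measureReal_eq_zero_iff (measure_ne_top _ _)).mp h0

lemma ae_tendsto_M {K : ℝ} {H : Measure ℝ} [IsFiniteMeasure H]
    (hK : ∀ n x, tail (lawM π n) x ≤ K * tail H x) :
    ∀ᵐ s ∂(seqLaw π), Tendsto (fun n => M coordX coordY n s) atTop
      (𝓝 (pathLim (M coordX coordY) s)) := by
  filter_upwards [ae_exists_M_le hK] with s hs
  obtain ⟨c, hc⟩ := hs
  exact tendsto_pathLim ⟨_, tendsto_atTop_ciSup (M_monotone coordX coordY s)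
    ⟨c, by rintro _ ⟨n, rfl⟩; exact hc n⟩⟩

lemma tail_pathLim_le {K : ℝ} {H : Measure ℝ} (hK : ∀ n x, tail (lawM π n) x ≤ K * tail H x)
    {Z : ℕ → (ℕ → ℝ × ℝ) → ℝ} (hZ : ∀ n, Measurable (Z n))
    (hle : ∀ n s, Z n s ≤ M coordX coordY n s)
    (hconv : ∀ᵐ s ∂(seqLaw π), Tendsto (fun n => Z n s) atTop (𝓝 (pathLim Z s))) (x : ℝ) :
    tail ((seqLaw π).map (pathLim Z)) x ≤ K * tail H x := by
  rw [tail, map_measureReal_apply (measurable_pathLim hZ) measurableSet_Ioi]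
  refine le_trans (ENNReal.toReal_mono (measure_ne_top _ _) (measure_mono_ae ?_))
    (measureReal_exists_lt_M_le hK)
  filter_upwards [hconv] with s hs hx
  obtain ⟨n, hn⟩ := (hs.eventually (lt_mem_nhds hx)).exists
  exact ⟨n, hn.trans_le (hle n s)⟩

lemma tail_pathLim_M_eq (hπ : ∀ᵐ p ∂π, 0 < p.2)
    (hconv : ∀ᵐ s ∂(seqLaw π), Tendsto (fun n => M coordX coordY n s) atTop
      (𝓝 (pathLim (M coordX coordY) s))) {x : ℝ} (hx : 0 ≤ x) :
    tail ((seqLaw π).map (pathLim (M coordX coordY))) x =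
      tail (stepLaw π ((seqLaw π).map (pathLim (M coordX coordY)))) x := by
  have hmeas := measurable_pathLim measurable_M_coord
  rw [← map_step_eq hmeas, tail, tail, map_measureReal_apply hmeas measurableSet_Ioi,
    map_measureReal_apply (by fun_prop) measurableSet_Ioi]
  refine measureReal_congr ?_
  filter_upwards [ae_coord hπ 1, hconv, ae_shift hconv] with s h1 h2 h3
  have h4 := (((h3.const_add (s 1).1).const_mul (s 1).2).max
    (tendsto_const_nhds (x := (0 : ℝ)))).congr
    fun n => (M_succ coordX coordY n (ω := s) h1.le).symm
  have h5 := tendsto_nhds_unique (h2.comp (tendsto_add_atTop_nat 1)) h4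
  refine propext (show x < pathLim (M coordX coordY) s ↔ _ from ?_)
  rw [h5, lt_max_iff]
  exact or_iff_left (not_lt.mpr hx)

lemma map_pathLim_S_eq
    (hconv : ∀ᵐ s ∂(seqLaw π), Tendsto (fun n => S coordX coordY n s) atTop
      (𝓝 (pathLim (S coordX coordY) s))) :
    (seqLaw π).map (pathLim (S coordX coordY)) =
      stepLaw π ((seqLaw π).map (pathLim (S coordX coordY))) := by
  rw [← map_step_eq (measurable_pathLim measurable_S_coord)]
  refine Measure.map_congr ?_
  filter_upwards [hconv, ae_shift hconv] with s h2 h3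
  have h4 := ((h3.const_add (s 1).1).const_mul (s 1).2).congr
    fun n => (S_succ coordX coordY n s).symm
  exact tendsto_nhds_unique (h2.comp (tendsto_add_atTop_nat 1)) h4

/-- The asymptotics of a fixed point of the recursion. -/
theorem fixedPoint_isEquivalent (hα : 0 ≤ α) (R : RiskTails α F G)
    (hθ : θ ∈ Set.Icc (-1 : ℝ) 1) (hG : G (Set.Iic 0) = 0) (hπ : IsFGM π F G θ)
    (hμ : posMoment α G < 1) {ν : Measure ℝ} [IsProbabilityMeasure ν]
    (hν : TailBounded (halfMix F G) ν) (hfix : ∀ x, 0 < x → tail ν x = tail (stepLaw π ν) x)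
    (hpos : 0 < tail F 0 → 0 < ν.real (Set.Ici 0)) (hzero : tail F 0 = 0 → tail ν 0 = 0) :
    (fun x => tail ν x) ~[atTop] (fun x => coeffAInf θ α G * tail F x
      + 1 / (1 - posMoment α G) * stepCoeff θ α F ν * tail G x) := by
  rcases (tail_nonneg F 0).eq_or_lt with hF | hF
  · refine isEquivalent_of_tail_eq_zero hF.symm (hzero hF.symm) _ ?_
    rw [stepCoeff_eq_zero hF.symm (hzero hF.symm), mul_zero]
  · obtain ⟨h1, h2⟩ := fixedPoint_tail hα R hθ hG hπ hμ hν hfix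
    have h3 : 0 < 1 / (1 - posMoment α G) := one_div_pos.mpr (by linarith)
    exact isEquivalent_of_tailLE (mul_pos h3 (coeffY_pos hα R hθ hG))
      (mul_pos h3 (stepCoeff_pos hα R hθ hF hν (hpos hF))) h1 h2

lemma tail_lawM_zero_eq_zero (hθ : θ ∈ Set.Icc (-1 : ℝ) 1) (hG : G (Set.Iic 0) = 0)
    (hπ : IsFGM π F G θ) (hF : tail F 0 = 0) (n : ℕ) : tail (lawM π n) 0 = 0 := by
  induction n with
  | zero => exact tail_lawM_zero
  | succ n ih =>
    rw [tail_lawM_succ (hπ.ae_snd_pos hθ hG) n le_rfl, tail_stepLaw_zero_eq_zero hθ hG hπ hF ih]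

lemma tail_pathLim_zero_eq_zero (hθ : θ ∈ Set.Icc (-1 : ℝ) 1) (hG : G (Set.Iic 0) = 0)
    (hπ : IsFGM π F G θ) (hF : tail F 0 = 0) {Z : ℕ → (ℕ → ℝ × ℝ) → ℝ}
    (hZ : ∀ n, Measurable (Z n)) (hle : ∀ n s, Z n s ≤ M coordX coordY n s)
    (hconv : ∀ᵐ s ∂(seqLaw π), Tendsto (fun n => Z n s) atTop (𝓝 (pathLim Z s))) :
    tail ((seqLaw π).map (pathLim Z)) 0 = 0 := by
  have hM : ∀ᵐ s ∂(seqLaw π), ∀ n, M coordX coordY n s ≤ 0 := by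
    rw [ae_all_iff]
    intro n
    rw [ae_iff]
    have := tail_lawM_zero_eq_zero hθ hG hπ hF n
    rw [tail_lawM, measureReal_eq_zero_iff] at this
    exact measure_mono_null (fun s hs => not_le.mp hs) this
  rw [tail, map_measureReal_apply (measurable_pathLim hZ) measurableSet_Ioi,
    measureReal_eq_zero_iff]
  have h : ∀ᵐ s ∂(seqLaw π), pathLim Z s ≤ 0 := by
    filter_upwards [hM, hconv] with s h1 h2
    exact le_of_tendsto' h2 fun n => (hle n s).trans (h1 n)
  rw [ae_iff] at h
  exact measure_mono_null (fun s hs => not_le.mpr hs) h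

/-! ### Almost sure convergence of the sums -/

lemma lintegral_abs_prod_rpow (n : ℕ) :
    ∫⁻ s, ENNReal.ofReal (|∏ j ∈ Finset.Icc 1 n, coordY j s| ^ α) ∂(seqLaw π) =
      (∫⁻ p, ENNReal.ofReal (|p.2| ^ α) ∂π) ^ n := by
  induction n with
  | zero => simp
  | succ n ih =>
    have h := map_prodMk_skip_eq (ξ := fun (i : ℕ) (s : ℕ → ℝ × ℝ) => s i) (P := seqLaw π)
      (π := π) (fun i => measurable_pi_apply i) iIndepFun_coord map_coord 1
    have hmeas : Measurable fun t : ℕ → ℝ × ℝ =>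
        ENNReal.ofReal (|∏ j ∈ Finset.Icc 1 n, coordY j t| ^ α) := by
      have : Measurable fun t : ℕ → ℝ × ℝ => ∏ j ∈ Finset.Icc 1 n, coordY j t :=
        Finset.measurable_prod _ fun j _ => measurable_coordY j
      exact ((_root_.continuous_abs.measurable.comp this).pow_const α).ennreal_ofReal
    have hmeas2 : Measurable fun p : ℝ × ℝ => ENNReal.ofReal (|p.2| ^ α) :=
      ((_root_.continuous_abs.measurable.comp measurable_snd).pow_const α).ennreal_ofReal
    have hprod := lintegral_prod_mul (μ := π) (ν := seqLaw π) hmeas2.aemeasurable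
      hmeas.aemeasurable
    have hmeas3 : Measurable fun z : (ℝ × ℝ) × (ℕ → ℝ × ℝ) => ENNReal.ofReal (|z.1.2| ^ α) *
        ENNReal.ofReal (|∏ j ∈ Finset.Icc 1 n, coordY j z.2| ^ α) :=
      (hmeas2.comp measurable_fst).mul (hmeas.comp measurable_snd)
    rw [← h, lintegral_map hmeas3 ((measurable_pi_apply 1).prodMk
      (measurable_pi_lambda _ fun i => measurable_pi_apply (skip 1 i))), ih] at hprod
    rw [pow_succ', ← hprod]
    refine lintegral_congr fun s => ?_
    rw [prod_Icc_one_succ (fun j => coordY j s), abs_mul, Real.mul_rpow (abs_nonneg _)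
      (abs_nonneg _), ENNReal.ofReal_mul (Real.rpow_nonneg (abs_nonneg _) _)]
    congr 4
    refine Finset.prod_congr rfl fun j hj => ?_
    simp only [coordY, skip_of_le (Finset.mem_Icc.mp hj).1]

lemma lintegral_abs_rpow_snd (hθ : θ ∈ Set.Icc (-1 : ℝ) 1) (hG : G (Set.Iic 0) = 0)
    (hπ : IsFGM π F G θ) (hfin : FinitePosMoment α G) :
    ∫⁻ p, ENNReal.ofReal (|p.2| ^ α) ∂π = ENNReal.ofReal (posMoment α G) := by
  have hmeas : Measurable fun y : ℝ => ENNReal.ofReal (|y| ^ α) :=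
    (_root_.continuous_abs.measurable.pow_const α).ennreal_ofReal
  have h1 : ∫⁻ p, ENNReal.ofReal (|p.2| ^ α) ∂π = ∫⁻ y, ENNReal.ofReal (|y| ^ α) ∂G := by
    conv_rhs => rw [← hπ.map_snd hθ hG]
    rw [lintegral_map hmeas measurable_snd]
  have hres : G.restrict (Set.Ioi 0) = G := by
    refine Measure.restrict_eq_self_of_ae_mem ?_
    rw [ae_iff]
    exact measure_mono_null (fun y hy => not_lt.mp (show ¬ (0 : ℝ) < y from hy)) hG
  rw [h1, posMoment, ofReal_integral_eq_lintegral_ofReal hfin]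
  · conv_lhs => rw [← hres]
    refine setLIntegral_congr_fun measurableSet_Ioi fun y hy => ?_
    simp only [abs_of_pos (show (0 : ℝ) < y from hy)]
  · rw [EventuallyLE, ae_restrict_iff' measurableSet_Ioi]
    exact ae_of_all _ fun z hz => Real.rpow_nonneg (le_of_lt hz) _

/-- If `E Y^α < 1`, then the products `Y₁ ⋯ Yₙ` decay geometrically. -/
lemma ae_eventually_prod_le (hα : 0 < α) (hθ : θ ∈ Set.Icc (-1 : ℝ) 1) (hG : G (Set.Iic 0) = 0)
    (hπ : IsFGM π F G θ) (hfin : FinitePosMoment α G) (hμ : posMoment α G < 1) :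
    ∃ ρ : ℝ, 0 < ρ ∧ ρ < 1 ∧ ∀ᵐ s ∂(seqLaw π), ∀ᶠ n : ℕ in atTop,
      |∏ j ∈ Finset.Icc 1 n, coordY j s| ≤ ρ ^ n := by
  set r := (posMoment α G + 1) / 2 with hr
  have hm0 := posMoment_nonneg α G
  have hr0 : 0 < r := by rw [hr]; linarith
  have hr1 : r < 1 := by rw [hr]; linarith
  refine ⟨r ^ α⁻¹, Real.rpow_pos_of_pos hr0 _,
    Real.rpow_lt_one hr0.le hr1 (inv_pos.mpr hα), ?_⟩
  set f : ℕ → (ℕ → ℝ × ℝ) → ENNReal := fun n s =>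
    ENNReal.ofReal (|∏ j ∈ Finset.Icc 1 n, coordY j s| ^ α) * ENNReal.ofReal (r⁻¹ ^ n) with hf
  have hmeas0 : ∀ n, Measurable fun s : ℕ → ℝ × ℝ =>
      ENNReal.ofReal (|∏ j ∈ Finset.Icc 1 n, coordY j s| ^ α) := fun n => by
    have : Measurable fun t : ℕ → ℝ × ℝ => ∏ j ∈ Finset.Icc 1 n, coordY j t :=
      Finset.measurable_prod _ fun j _ => measurable_coordY j
    exact ((_root_.continuous_abs.measurable.comp this).pow_const α).ennreal_ofReal
  have hmeas : ∀ n, Measurable (f n) := fun n => (hmeas0 n).mul_const _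
  have hsum : ∫⁻ s, ∑' n, f n s ∂(seqLaw π) ≠ ⊤ := by
    rw [lintegral_tsum fun n => (hmeas n).aemeasurable]
    have hterm : ∀ n, ∫⁻ s, f n s ∂(seqLaw π) = ENNReal.ofReal (posMoment α G * r⁻¹) ^ n :=
      fun n => by
        rw [hf, lintegral_mul_const _ (hmeas0 n), lintegral_abs_prod_rpow,
          lintegral_abs_rpow_snd hθ hG hπ hfin, ENNReal.ofReal_mul hm0, mul_pow,
          ENNReal.ofReal_pow (inv_nonneg.mpr hr0.le)]
    simp_rw [hterm]
    rw [ENNReal.tsum_geometric]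
    refine ENNReal.inv_ne_top.mpr (tsub_pos_of_lt ?_).ne'
    rw [ENNReal.ofReal_lt_one, ← div_eq_mul_inv, div_lt_one hr0, hr]
    linarith
  filter_upwards [ae_lt_top (Measurable.tsum hmeas) hsum] with s hs
  have h0 := ENNReal.tendsto_atTop_zero_of_tsum_ne_top hs.ne
  filter_upwards [h0.eventually (gt_mem_nhds one_pos)] with n hn
  rw [hf] at hn
  simp only at hn
  rw [← ENNReal.ofReal_mul (Real.rpow_nonneg (abs_nonneg _) _), ENNReal.ofReal_lt_one, inv_pow,
    ← div_eq_mul_inv, div_lt_one (pow_pos hr0 n)] at hn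
  have h1 := Real.rpow_le_rpow (Real.rpow_nonneg (abs_nonneg _) _) hn.le (inv_nonneg.mpr hα.le)
  rw [Real.rpow_rpow_inv (abs_nonneg _) hα.ne'] at h1
  refine h1.trans (le_of_eq ?_)
  rw [← Real.rpow_natCast, ← Real.rpow_natCast, ← Real.rpow_mul hr0.le, ← Real.rpow_mul hr0.le,
    mul_comm]

omit [IsProbabilityMeasure F] in
/-- The positive part has a logarithmic moment because it has a moment of order `α > 0`. -/
lemma integrable_log_max_abs (hα : 0 < α) (hfin : FinitePosMoment α F)
    (hint : Integrable (fun x => Real.log (max (max (-x) 0) 1)) F) :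
    Integrable (fun x => Real.log (max |x| 1)) F := by
  have h1 : Integrable ((Set.Ioi (0 : ℝ)).indicator fun z => z ^ α / α) F :=
    (integrable_indicator_iff measurableSet_Ioi).mpr (hfin.div_const α)
  refine (hint.add h1).mono'
    (Real.measurable_log.comp (_root_.continuous_abs.measurable.max
      measurable_const)).aestronglyMeasurable (ae_of_all _ fun x => ?_)
  rw [Real.norm_of_nonneg (Real.log_nonneg (le_max_right _ _))]
  have h2 : 0 ≤ Real.log (max (max (-x) 0) 1) := Real.log_nonneg (le_max_right _ _)
  rcases le_or_gt x 0 with hx | hx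
  · rw [Pi.add_apply, Set.indicator_of_notMem (show x ∉ Set.Ioi (0 : ℝ) from not_lt.mpr hx),
      add_zero, abs_of_nonpos hx, max_eq_left (show 0 ≤ -x by linarith)]
  · rw [Pi.add_apply, Set.indicator_of_mem (show x ∈ Set.Ioi (0 : ℝ) from hx), abs_of_pos hx]
    have h3 : Real.log (max x 1) ≤ x ^ α / α := by
      rcases le_total x 1 with h | h
      · rw [max_eq_right h, Real.log_one]; positivity
      · rw [max_eq_left h]; exact Real.log_le_rpow_div hx.le hα
    linarith

/-- Logarithmic moments prevent exponential growth of the terms. -/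
lemma ae_eventually_log_le (hF : π.map Prod.fst = F)
    (hint : Integrable (fun x => Real.log (max |x| 1)) F) {ε : ℝ} (hε : 0 < ε) :
    ∀ᵐ s ∂(seqLaw π), ∀ᶠ n : ℕ in atTop, Real.log (max |coordX n s| 1) ≤ ε * n := by
  let _ : MeasureSpace ℝ := ⟨F⟩
  have : IsProbabilityMeasure (volume : Measure ℝ) := inferInstanceAs (IsProbabilityMeasure F)
  have hlt := tsum_prob_mem_Ioi_lt_top (Ω := ℝ) (X := fun x => Real.log (max |x| 1) / ε)
    (hint.div_const ε) fun x => div_nonneg (Real.log_nonneg (le_max_right _ _)) hε.le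
  have hmeas : Measurable fun x : ℝ => Real.log (max |x| 1) / ε :=
    (Real.measurable_log.comp (_root_.continuous_abs.measurable.max measurable_const)).div_const ε
  have heq : ∀ n : ℕ, seqLaw π {s | (n : ℝ) < Real.log (max |coordX n s| 1) / ε} =
      F {x | Real.log (max |x| 1) / ε ∈ Set.Ioi (n : ℝ)} := fun n => by
    have h1 := Measure.map_apply (μ := π) measurable_fst
      (hmeas (measurableSet_Ioi (a := (n : ℝ))))
    have h2 := Measure.map_apply (μ := seqLaw π) (measurable_pi_apply n)
      (measurable_fst (hmeas (measurableSet_Ioi (a := (n : ℝ)))))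
    rw [hF] at h1
    rw [map_coord] at h2
    exact (h1.trans h2).symm
  have hsum : ∑' n : ℕ, seqLaw π {s | (n : ℝ) < Real.log (max |coordX n s| 1) / ε} ≠ ⊤ := by
    simp_rw [heq]
    exact ne_of_lt hlt
  filter_upwards [ae_eventually_notMem hsum] with s hs
  filter_upwards [hs] with n hn
  have hn : ¬ (n : ℝ) < Real.log (max |coordX n s| 1) / ε := hn
  rw [not_lt, div_le_iff₀ hε] at hn
  linarith

theorem ae_tendsto_S (hα : 0 < α) (hθ : θ ∈ Set.Icc (-1 : ℝ) 1) (hG : G (Set.Iic 0) = 0)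
    (hπ : IsFGM π F G θ) (hfinG : FinitePosMoment α G) (hfinF : FinitePosMoment α F)
    (hμ : posMoment α G < 1) (hint : Integrable (fun x => Real.log (max (max (-x) 0) 1)) F) :
    ∀ᵐ s ∂(seqLaw π), Tendsto (fun n => S coordX coordY n s) atTop
      (𝓝 (pathLim (S coordX coordY) s)) := by
  obtain ⟨ρ, hρ0, hρ1, hprod⟩ := ae_eventually_prod_le hα hθ hG hπ hfinG hμ
  set ε := -Real.log ρ / 2 with hε
  have hlog : Real.log ρ < 0 := Real.log_neg hρ0 hρ1
  have hεp : 0 < ε := by rw [hε]; linarith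
  have hq1 : Real.exp ε * ρ < 1 := by
    have h : Real.exp ε * ρ = Real.exp (ε + Real.log ρ) := by rw [Real.exp_add, Real.exp_log hρ0]
    rw [h, Real.exp_lt_one_iff, hε]
    linarith
  filter_upwards [hprod, ae_eventually_log_le (hπ.map_fst hθ hG)
    (integrable_log_max_abs hα hfinF hint) hεp] with s h1 h2
  have hsum : Summable fun n => coordX n s * ∏ j ∈ Finset.Icc 1 n, coordY j s := by
    refine Summable.of_norm_bounded_eventually_nat
      (summable_geometric_of_lt_one (by positivity) hq1) ?_
    filter_upwards [h1, h2] with n k1 k2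
    rw [norm_mul, mul_pow, ← Real.exp_nat_mul, mul_comm (n : ℝ), Real.norm_eq_abs, Real.norm_eq_abs]
    refine mul_le_mul ?_ k1 (abs_nonneg _) (Real.exp_pos _).le
    rw [Real.log_le_iff_le_exp (lt_max_of_lt_right one_pos)] at k2
    exact (le_max_left _ _).trans k2
  have hS : ∀ n, S coordX coordY n s = ∑ i ∈ Finset.range n,
      coordX (i + 1) s * ∏ j ∈ Finset.Icc 1 (i + 1), coordY j s := fun n => by
    induction n with
    | zero => simp
    | succ n ih => rw [Finset.sum_range_succ, ← ih, S, Finset.sum_Icc_succ_top (by lia), S]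
  have ht := ((summable_nat_add_iff 1).mpr hsum).hasSum.tendsto_sum_nat
  exact tendsto_pathLim ⟨_, ht.congr fun n => (hS n).symm⟩

end


/-! ### Transfer to the original probability space -/

section Transfer

variable {Ω : Type*} [MeasurableSpace Ω] {P : Measure Ω} {α θ : ℝ} {F G : Measure ℝ}

lemma measureReal_lt_eq_tail {Z : Ω → ℝ} (hZ : Measurable Z) (x : ℝ) :
    P.real {ω | x < Z ω} = tail (P.map Z) x := by
  rw [tail, map_measureReal_apply hZ measurableSet_Ioi]
  rfl

lemma coeffX_eq_stepCoeff {Z X : Ω → ℝ}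
    (h : P.map (fun ω => Z ω + X ω) = Measure.conv (P.map Z) F) :
    coeffX P θ α F Z X = stepCoeff θ α F (P.map Z) := by
  rw [coeffX, h, lawAddCheck, stepCoeff]

lemma RiskTails.finiteMomentsX [IsProbabilityMeasure P] [IsProbabilityMeasure F]
    [IsProbabilityMeasure G] (hα : 0 ≤ α) (R : RiskTails α F G) {Z X : Ω → ℝ}
    (hZ : Measurable Z) (hb : TailBounded (halfMix F G) (P.map Z))
    (h : P.map (fun ω => Z ω + X ω) = Measure.conv (P.map Z) F) :
    FiniteMomentsX P α F Z X := by
  have : IsProbabilityMeasure (P.map Z) := Measure.isProbabilityMeasure_map hZ.aemeasurable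
  rw [FiniteMomentsX, lawAddCheck, h]
  exact ⟨(hb.conv R.strong R.boundedF).finitePosMoment hα R.strong,
    (hb.conv R.strong R.boundedF.maxLaw).finitePosMoment hα R.strong⟩

lemma posMoment_zero_eq_one [IsProbabilityMeasure G] (hG : G (Set.Iic 0) = 0) :
    posMoment 0 G = 1 := by
  have h : G (Set.Ioi 0) = 1 := by
    rw [← Set.compl_Iic, prob_compl_eq_one_iff measurableSet_Iic, hG]
  simp [posMoment, measureReal_def, h]

lemma map_pathLim_M_Ici_zero_pos {π : Measure (ℝ × ℝ)} [IsProbabilityMeasure π]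
    (hconv : ∀ᵐ s ∂(seqLaw π), Tendsto (fun n => M coordX coordY n s) atTop
      (𝓝 (pathLim (M coordX coordY) s))) :
    0 < ((seqLaw π).map (pathLim (M coordX coordY))).real (Set.Ici 0) := by
  have hmeas := measurable_pathLim measurable_M_coord
  have h : ∀ᵐ s ∂(seqLaw π), s ∈ pathLim (M coordX coordY) ⁻¹' Set.Ici 0 := by
    filter_upwards [hconv] with s hs
    exact ge_of_tendsto' hs fun n => M_nonneg coordX coordY n s
  rw [map_measureReal_apply hmeas measurableSet_Ici, measureReal_def,
    (mem_ae_iff_prob_eq_one (hmeas measurableSet_Ici)).mp h]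
  simp

variable {X Y : ℕ → Ω → ℝ} {π : Measure (ℝ × ℝ)} [IsProbabilityMeasure π]

lemma map_S_eq (hX : ∀ i, Measurable (X i)) (hY : ∀ i, Measurable (Y i))
    (hseq : P.map (fun ω i => (X i ω, Y i ω)) = seqLaw π) (n : ℕ) :
    P.map (S X Y n) = lawS π n := by
  rw [lawS, ← hseq, Measure.map_map (measurable_S_coord n)
    (measurable_pi_lambda _ fun i => (hX i).prodMk (hY i))]
  rfl

lemma map_M_eq (hX : ∀ i, Measurable (X i)) (hY : ∀ i, Measurable (Y i))
    (hseq : P.map (fun ω i => (X i ω, Y i ω)) = seqLaw π) (n : ℕ) :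
    P.map (M X Y n) = lawM π n := by
  rw [lawM, ← hseq, Measure.map_map (measurable_M_coord n)
    (measurable_pi_lambda _ fun i => (hX i).prodMk (hY i))]
  rfl

end Transfer

end RiskModel

theorem corollary2p1 {Ω : Type*} [MeasurableSpace Ω] (P : Measure Ω) [IsProbabilityMeasure P]
    (F G : Measure ℝ) [IsProbabilityMeasure F] [IsProbabilityMeasure G]
    (hG : G (Set.Iic 0) = 0)
    (θ : ℝ) (hθ : θ ∈ Set.Icc (-1 : ℝ) 1) (α : ℝ) (hα : 0 ≤ α)
    (X Y : ℕ → Ω → ℝ) (hX : ∀ i, Measurable (X i)) (hY : ∀ i, Measurable (Y i))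
    (hindep : iIndepFun (fun i ω => (X i ω, Y i ω)) P)
    (hident : ∀ i, IdentDistrib (fun ω => (X i ω, Y i ω)) (fun ω => (X 0 ω, Y 0 ω)) P P)
    (hFGM : RiskModel.IsFGM (P.map (fun ω => (X 0 ω, Y 0 ω))) F G θ)
    (hA : RiskModel.ConvexCombStronglyRegVarying α F G) :
    -- the moments in the coefficients for finite `n` are finite
    (RiskModel.FinitePosMoment α G ∧ RiskModel.FinitePosMoment α (RiskModel.maxLaw G) ∧
      ∀ n : ℕ, RiskModel.FiniteMomentsX P α F (RiskModel.M X Y n) (X (n + 1)) ∧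
        RiskModel.FiniteMomentsX P α F (RiskModel.S X Y n) (X (n + 1))) ∧
    -- (a)
    (∀ n : ℕ, 1 ≤ n →
      (fun x : ℝ => P.real {ω | x < RiskModel.M X Y n ω}) ~[atTop]
        (fun x : ℝ => RiskModel.coeffA θ α G n * RiskModel.tail F x
          + RiskModel.coeffBC P θ α F G (RiskModel.M X Y) X n * RiskModel.tail G x) ∧
      (fun x : ℝ => P.real {ω | x < RiskModel.S X Y n ω}) ~[atTop]
        (fun x : ℝ => RiskModel.coeffA θ α G n * RiskModel.tail F x
          + RiskModel.coeffBC P θ α F G (RiskModel.S X Y) X n * RiskModel.tail G x)) ∧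
    -- (b)
    (RiskModel.posMoment α G < 1 →
      ∃ Minf : Ω → ℝ, Measurable Minf ∧
        (∀ᵐ ω ∂P, Tendsto (fun n => RiskModel.M X Y n ω) atTop (𝓝 (Minf ω))) ∧
        RiskModel.FiniteMomentsX P α F Minf (X 0) ∧
        (fun x : ℝ => P.real {ω | x < Minf ω}) ~[atTop]
          (fun x : ℝ => RiskModel.coeffAInf θ α G * RiskModel.tail F x
            + RiskModel.coeffBCInf P θ α F G Minf (X 0) * RiskModel.tail G x)) ∧
    -- (c)
    (RiskModel.posMoment α G < 1 →
      Integrable (fun ω => Real.log (max (max (-(X 0 ω)) 0) 1)) P →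
      ∃ Sinf : Ω → ℝ, Measurable Sinf ∧
        (∀ᵐ ω ∂P, Tendsto (fun n => RiskModel.S X Y n ω) atTop (𝓝 (Sinf ω))) ∧
        RiskModel.FiniteMomentsX P α F Sinf (X 0) ∧
        (fun x : ℝ => P.real {ω | x < Sinf ω}) ~[atTop]
          (fun x : ℝ => RiskModel.coeffAInf θ α G * RiskModel.tail F x
            + RiskModel.coeffBCInf P θ α F G Sinf (X 0) * RiskModel.tail G x)) := by
  have hm : ∀ i, Measurable fun ω => (X i ω, Y i ω) := fun i => (hX i).prodMk (hY i)
  have : IsProbabilityMeasure (P.map fun ω => (X 0 ω, Y 0 ω)) :=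
    Measure.isProbabilityMeasure_map (hm 0).aemeasurable
  set π := P.map (fun ω => (X 0 ω, Y 0 ω)) with hπdef
  have hl : ∀ i, P.map (fun ω => (X i ω, Y i ω)) = π := fun i => (hident i).map_eq
  have R := hA.riskTails hα
  have hH := R.strong
  have hfst := hFGM.map_fst hθ hG
  have hpos := hFGM.ae_snd_pos hθ hG
  have hseq : P.map (fun ω i => (X i ω, Y i ω)) = RiskModel.seqLaw π :=
    RiskModel.map_seq_eq hm hindep hl Function.injective_id
  have hseqm : Measurable fun ω (i : ℕ) => (X i ω, Y i ω) := measurable_pi_lambda _ hm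
  have hfinG := R.boundedG.finitePosMoment hα hH
  have hfinF := R.boundedF.finitePosMoment hα hH
  have hmM := RiskModel.measurable_M hX hY
  have hmS := RiskModel.measurable_S hX hY
  have hlawM := RiskModel.map_M_eq hX hY hseq
  have hlawS := RiskModel.map_S_eq hX hY hseq
  -- `M n` and `S n` only involve the pairs `1, …, n`, so they are independent of `X (n + 1)`.
  have hcM : ∀ n, P.map (fun ω => RiskModel.M X Y n ω + X (n + 1) ω) =
      Measure.conv (P.map (RiskModel.M X Y n)) F := fun n => by
    rw [← hfst]
    refine RiskModel.map_add_eq_conv hm hindep hl (n + 1) (RiskModel.measurable_M_coord n)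
      fun ω => RiskModel.M_congr fun i _ hi => ?_
    simp only [RiskModel.coordX, RiskModel.coordY, RiskModel.skip_of_lt (Nat.lt_succ_of_le hi),
      and_self]
  have hcS : ∀ n, P.map (fun ω => RiskModel.S X Y n ω + X (n + 1) ω) =
      Measure.conv (P.map (RiskModel.S X Y n)) F := fun n => by
    rw [← hfst]
    refine RiskModel.map_add_eq_conv hm hindep hl (n + 1) (RiskModel.measurable_S_coord n)
      fun ω => RiskModel.S_congr fun i _ hi => ?_
    simp only [RiskModel.coordX, RiskModel.coordY, RiskModel.skip_of_lt (Nat.lt_succ_of_le hi),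
      and_self]
  have hbM : ∀ n, RiskModel.coeffBC P θ α F G (RiskModel.M X Y) X (n + 1) =
      RiskModel.stepCoeff θ α F (RiskModel.lawM π n) + RiskModel.posMoment α G *
        RiskModel.coeffBC P θ α F G (RiskModel.M X Y) X n := fun n => by
    rw [RiskModel.coeffBC_succ, RiskModel.coeffX_eq_stepCoeff (hcM n), hlawM]
  have hbS : ∀ n, RiskModel.coeffBC P θ α F G (RiskModel.S X Y) X (n + 1) =
      RiskModel.stepCoeff θ α F (RiskModel.lawS π n) + RiskModel.posMoment α G *
        RiskModel.coeffBC P θ α F G (RiskModel.S X Y) X n := fun n => by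
    rw [RiskModel.coeffBC_succ, RiskModel.coeffX_eq_stepCoeff (hcS n), hlawS]
  have hstepM := fun n x (hx : 0 ≤ x) => RiskModel.tail_lawM_succ hpos n hx
  have hstepS : ∀ n x, 0 ≤ x → RiskModel.tail (RiskModel.lawS π (n + 1)) x =
      RiskModel.tail (RiskModel.stepLaw π (RiskModel.lawS π n)) x := fun n x _ => by
    rw [RiskModel.lawS_succ]
  have hbdM : ∀ n, RiskModel.TailBounded (RiskModel.halfMix F G) (RiskModel.lawM π n) := fun n =>
    (RiskModel.sequence_tail hα R hθ hG hFGM RiskModel.tail_lawM_zero hstepM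
      (RiskModel.coeffBC_zero _ _ _ _ _ _ _) hbM n).2.2.1
  have hbdS : ∀ n, RiskModel.TailBounded (RiskModel.halfMix F G) (RiskModel.lawS π n) := fun n =>
    (RiskModel.sequence_tail hα R hθ hG hFGM RiskModel.tail_lawS_zero hstepS
      (RiskModel.coeffBC_zero _ _ _ _ _ _ _) hbS n).2.2.1
  -- A limit of functionals of the pairs `1, 2, …` is independent of the generic variable `X 0`.
  have hlim : ∀ Z : ℕ → (ℕ → ℝ × ℝ) → ℝ, (∀ n, Measurable (Z n)) →
      (∀ n ω, Z n (fun i => (X (i - 1 + 1) ω, Y (i - 1 + 1) ω)) = Z n (fun i => (X i ω, Y i ω))) →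
      P.map (fun ω => RiskModel.pathLim Z (fun i => (X i ω, Y i ω)) + X 0 ω) = Measure.conv
        (P.map fun ω => RiskModel.pathLim Z (fun i => (X i ω, Y i ω))) F := fun Z hZ hloc => by
    rw [← hfst]
    refine RiskModel.map_add_eq_conv (ξ := fun i ω => (X i ω, Y i ω)) hm hindep hl 0
      (Φ := fun t => RiskModel.pathLim Z (fun i => t (i - 1)))
      ((RiskModel.measurable_pathLim hZ).comp
        (measurable_pi_lambda _ fun i => measurable_pi_apply (i - 1)))
      fun ω => ?_
    simp only [RiskModel.pathLim, RiskModel.skip_of_le (Nat.zero_le _), hloc]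
  have hmapLim : ∀ Z : ℕ → (ℕ → ℝ × ℝ) → ℝ, (∀ n, Measurable (Z n)) →
      P.map (fun ω => RiskModel.pathLim Z (fun i => (X i ω, Y i ω))) =
        (RiskModel.seqLaw π).map (RiskModel.pathLim Z) := fun Z hZ => by
    rw [← hseq, Measure.map_map (RiskModel.measurable_pathLim hZ) hseqm]
    rfl
  refine ⟨⟨hfinG, R.boundedG.maxLaw.finitePosMoment hα hH, fun n =>
    ⟨R.finiteMomentsX hα (hmM n) (hlawM n ▸ hbdM n) (hcM n),
      R.finiteMomentsX hα (hmS n) (hlawS n ▸ hbdS n) (hcS n)⟩⟩, fun n hn => ⟨?_, ?_⟩,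
    fun hμ => ?_, fun hμ hint => ?_⟩
  · simp only [RiskModel.measureReal_lt_eq_tail (hmM n), hlawM]
    exact RiskModel.sequence_isEquivalent hα R hθ hG hFGM RiskModel.tail_lawM_zero hstepM
      (fun _ => RiskModel.lawM_Ici_zero_pos) (RiskModel.coeffBC_zero _ _ _ _ _ _ _) hbM n hn
  · simp only [RiskModel.measureReal_lt_eq_tail (hmS n), hlawS]
    exact RiskModel.sequence_isEquivalent hα R hθ hG hFGM RiskModel.tail_lawS_zero hstepS
      (RiskModel.lawS_Ici_zero_pos hθ hG hFGM) (RiskModel.coeffBC_zero _ _ _ _ _ _ _) hbS n hn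
  · obtain ⟨K, hK0, hK⟩ := RiskModel.exists_uniform_tail_bound hα R hθ hG hFGM hμ
      (RiskModel.lawM π) (hbdM 0) fun n x hx => (hstepM n x hx.le).le
    have hZ := RiskModel.measurable_M_coord
    have hconv := RiskModel.ae_tendsto_M hK
    have hmeas : Measurable fun ω => RiskModel.pathLim (RiskModel.M RiskModel.coordX
        RiskModel.coordY) (fun i => (X i ω, Y i ω)) :=
      (RiskModel.measurable_pathLim hZ).comp hseqm
    have hc := hlim _ hZ fun n ω => RiskModel.M_congr fun i h1 _ => by
      simp only [RiskModel.coordX, RiskModel.coordY, Nat.sub_add_cancel h1, and_self]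
    have hbd : RiskModel.TailBounded (RiskModel.halfMix F G)
        ((RiskModel.seqLaw π).map (RiskModel.pathLim (RiskModel.M RiskModel.coordX
          RiskModel.coordY))) :=
      ⟨K, hK0, RiskModel.tail_pathLim_le hK hZ (fun _ _ => le_rfl) hconv⟩
    have : IsProbabilityMeasure ((RiskModel.seqLaw π).map (RiskModel.pathLim (RiskModel.M
        RiskModel.coordX RiskModel.coordY))) :=
      Measure.isProbabilityMeasure_map (RiskModel.measurable_pathLim hZ).aemeasurable
    refine ⟨_, hmeas, ?_, R.finiteMomentsX hα hmeas ((hmapLim _ hZ).symm ▸ hbd) hc, ?_⟩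
    · rw [← hseq] at hconv
      exact ae_of_ae_map hseqm.aemeasurable hconv
    · simp only [RiskModel.measureReal_lt_eq_tail hmeas]
      rw [RiskModel.coeffBCInf, RiskModel.coeffX_eq_stepCoeff hc]
      rw [hmapLim _ hZ]
      refine RiskModel.fixedPoint_isEquivalent hα R hθ hG hFGM hμ hbd
        (fun x hx => RiskModel.tail_pathLim_M_eq hpos hconv hx.le) (fun _ => ?_)
        fun hF => RiskModel.tail_pathLim_zero_eq_zero hθ hG hFGM hF hZ (fun _ _ => le_rfl) hconv
      exact RiskModel.map_pathLim_M_Ici_zero_pos hconv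
  · obtain ⟨K, hK0, hK⟩ := RiskModel.exists_uniform_tail_bound hα R hθ hG hFGM hμ
      (RiskModel.lawM π) (hbdM 0) fun n x hx => (hstepM n x hx.le).le
    -- For `α = 0` the moment of `G` is its total mass, so that `α > 0` here.
    have hα' : 0 < α := hα.lt_of_ne fun h => by
      subst h
      exact hμ.ne (RiskModel.posMoment_zero_eq_one hG)
    have hX0 : P.map (X 0) = F := by
      rw [← hfst, hπdef, Measure.map_map measurable_fst (hm 0)]
      rfl
    have hint' : Integrable (fun x => Real.log (max (max (-x) 0) 1)) F := by
      rw [← hX0]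
      exact (integrable_map_measure (by
        exact (Real.measurable_log.comp ((measurable_neg.max measurable_const).max
          measurable_const)).aestronglyMeasurable) (hX 0).aemeasurable).mpr hint
    have hZ := RiskModel.measurable_S_coord
    have hconv := RiskModel.ae_tendsto_S hα' hθ hG hFGM hfinG hfinF hμ hint'
    have hle : ∀ n s, RiskModel.S RiskModel.coordX RiskModel.coordY n s ≤
        RiskModel.M RiskModel.coordX RiskModel.coordY n s := fun n s =>
      RiskModel.S_le_M _ _ le_rfl s
    have hmeas : Measurable fun ω => RiskModel.pathLim (RiskModel.S RiskModel.coordX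
        RiskModel.coordY) (fun i => (X i ω, Y i ω)) :=
      (RiskModel.measurable_pathLim hZ).comp hseqm
    have hc := hlim _ hZ fun n ω => RiskModel.S_congr fun i h1 _ => by
      simp only [RiskModel.coordX, RiskModel.coordY, Nat.sub_add_cancel h1, and_self]
    have hbd : RiskModel.TailBounded (RiskModel.halfMix F G)
        ((RiskModel.seqLaw π).map (RiskModel.pathLim (RiskModel.S RiskModel.coordX
          RiskModel.coordY))) :=
      ⟨K, hK0, RiskModel.tail_pathLim_le hK hZ hle hconv⟩
    have : IsProbabilityMeasure ((RiskModel.seqLaw π).map (RiskModel.pathLim (RiskModel.S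
        RiskModel.coordX RiskModel.coordY))) :=
      Measure.isProbabilityMeasure_map (RiskModel.measurable_pathLim hZ).aemeasurable
    have hfix := RiskModel.map_pathLim_S_eq hconv
    refine ⟨_, hmeas, ?_, R.finiteMomentsX hα hmeas ((hmapLim _ hZ).symm ▸ hbd) hc, ?_⟩
    · rw [← hseq] at hconv
      exact ae_of_ae_map hseqm.aemeasurable hconv
    · simp only [RiskModel.measureReal_lt_eq_tail hmeas]
      rw [RiskModel.coeffBCInf, RiskModel.coeffX_eq_stepCoeff hc]
      rw [hmapLim _ hZ]
      exact RiskModel.fixedPoint_isEquivalent hα R hθ hG hFGM hμ hbd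
        (fun x _ => congrArg (RiskModel.tail · x) hfix)
        (fun hF => RiskModel.fixedPoint_Ici_zero_pos hα R hθ hG hFGM hμ hF hfix)
        fun hF => RiskModel.tail_pathLim_zero_eq_zero hθ hG hFGM hF hZ hle hconv
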